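/- An MV-algebra is an algebra $(A,\oplus,\neg,0)$ such that $(A,\oplus,0)$ is a commutative monoid and the identities $\neg\neg f=f$, $f\oplus\neg 0=\neg 0$ and $\neg(\neg f\oplus g)\oplus g=\neg(\neg g\oplus f)\oplus f$ hold. Write $1=\neg 0$, $f\vee g=\neg(\neg f\oplus g)\oplus g$ and $f\wedge g=\neg(\neg f\vee\neg g)$. The real interval $[0,1]$ is an MV-algebra with $a\oplus b=\min(1,a+b)$ and $\neg a=1-a$. A state on $A$ is a map $m:A\to[0,1]$ such that $m(0)=0$, $m(1)=1$, and $m(f\oplus g)=m(f)+m(g)$ whenever $\neg(\neg f\oplus\neg g)=0$. Let $n\ge 2$, let $\mathrm{Free}_n$ be the free MV-algebra on $n$ generators, and let $\rho$ be the homomorphism from $\mathrm{Free}_n$ to the algebra of all functions $[0,1]^n\to[0,1]$ with componentwise operations that sends the $i$-th free generator to the $i$-th coordinate projection. (Every $\rho(f)$ is continuous.) Let $$m(f)=\int_{[0,1]^n}\rho(f)\,d\lambda\qquad(f\in\mathrm{Free}_n),$$ where $\lambda$ is Lebesgue measure on $[0,1]^n$. Theorem. There is exactly one state on $\mathrm{Free}_n$,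 namely $m$, that satisfies the following two conditions: (B1) $m(\sigma(f))=m(f)$ for every automorphism $\sigma$ of $\mathrm{Free}_n$ and every $f\in\mathrm{Free}_n$; (B2) for every $f\in\mathrm{Free}_n$ that is a weak unit, that is, such that for every $g\in\mathrm{Free}_n$, $f\wedge g=0$ implies $g=0$, one has $$\lim_{k\to\infty}m(\underbrace{f\oplus\cdots\oplus f}_{k\text{ summands}})=1.$$ -/

import Mathlib

open MeasureTheory Filter Topology

/-- An MV-algebra `(A, ⊕, ¬, 0)`. -/
class MVAlgebra (A : Type*) where
  oplus : A → A → A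
  neg : A → A
  zero : A
  oplus_assoc : ∀ f g h : A, oplus (oplus f g) h = oplus f (oplus g h)
  oplus_comm : ∀ f g : A, oplus f g = oplus g f
  oplus_zero : ∀ f : A, oplus f zero = f
  neg_neg : ∀ f : A, neg (neg f) = f
  oplus_neg_zero : ∀ f : A, oplus f (neg zero) = neg zero
  lukasiewicz : ∀ f g : A,
    oplus (neg (oplus (neg f) g)) g = oplus (neg (oplus (neg g) f)) f

namespace MVAlgebra

/-- The top element `1 = ¬0`. -/
def one {A : Type*} [MVAlgebra A] : A := neg zero

/-- The join `f ∨ g = ¬(¬f ⊕ g) ⊕ g` of the underlying lattice. -/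
def sup {A : Type*} [MVAlgebra A] (f g : A) : A := oplus (neg (oplus (neg f) g)) g

/-- The meet `f ∧ g = ¬(¬f ∨ ¬g)` of the underlying lattice. -/
def inf {A : Type*} [MVAlgebra A] (f g : A) : A := neg (sup (neg f) (neg g))

/-- The `k`-fold sum `f ⊕ ⋯ ⊕ f`. -/
def nfold {A : Type*} [MVAlgebra A] : ℕ → A → A
  | 0, _ => zero
  | k + 1, f => oplus (nfold k f) f

/-- `f` is a weak unit: `f ∧ g = 0` implies `g = 0`. -/
def IsWeakUnit {A : Type*} [MVAlgebra A] (f : A) : Prop :=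
  ∀ g : A, inf f g = zero → g = zero

/-- A homomorphism of MV-algebras. -/
structure Hom (A B : Type*) [MVAlgebra A] [MVAlgebra B] where
  toFun : A → B
  map_oplus : ∀ f g : A, toFun (oplus f g) = oplus (toFun f) (toFun g)
  map_neg : ∀ f : A, toFun (neg f) = neg (toFun f)
  map_zero : toFun zero = zero

/-- An automorphism of an MV-algebra: a bijective endomorphism. -/
structure Aut (A : Type*) [MVAlgebra A] extends Hom A A where
  bijective : Function.Bijective toFun

/-- A state on an MV-algebra `A`: a map `m : A → [0,1]` with `m 0 = 0`, `m 1 = 1`, and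
`m (f ⊕ g) = m f + m g` whenever `¬(¬f ⊕ ¬g) = 0`. -/
structure IsState {A : Type*} [MVAlgebra A] (m : A → ℝ) : Prop where
  mem_Icc : ∀ f : A, m f ∈ Set.Icc (0 : ℝ) 1
  map_zero : m zero = 0
  map_one : m one = 1
  map_oplus : ∀ f g : A, neg (oplus (neg f) (neg g)) = zero → m (oplus f g) = m f + m g

/-- Invariance under all automorphisms. -/
def IsAutInvariant {A : Type*} [MVAlgebra A] (m : A → ℝ) : Prop :=
  ∀ (σ : Aut A) (f : A), m (σ.toFun f) = m f

/-- For every weak unit `f`, `m (f ⊕ ⋯ ⊕ f)` (`k` summands) tends to `1` as `k → ∞`. -/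
def TendsToOneOnWeakUnits {A : Type*} [MVAlgebra A] (m : A → ℝ) : Prop :=
  ∀ f : A, IsWeakUnit f → Tendsto (fun k : ℕ => m (nfold k f)) atTop (𝓝 1)

/-- The MV-algebra `[0,1]`: `a ⊕ b = min (1, a + b)` and `¬a = 1 - a`. -/
noncomputable instance instUnitInterval : MVAlgebra unitInterval where
  oplus a b := ⟨min 1 ((a : ℝ) + b), le_min zero_le_one (add_nonneg a.2.1 b.2.1), min_le_left _ _⟩
  neg a := ⟨1 - (a : ℝ), sub_nonneg.2 a.2.2, sub_le_self _ a.2.1⟩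
  zero := 0
  oplus_assoc := by
    rintro ⟨a, ha⟩ ⟨b, hb⟩ ⟨c, hc⟩
    obtain ⟨ha, ha'⟩ := ha
    obtain ⟨hb, hb'⟩ := hb
    obtain ⟨hc, hc'⟩ := hc
    apply Subtype.ext
    simp only [min_def]
    split_ifs <;> linarith
  oplus_comm a b := Subtype.ext (by simp only [add_comm])
  oplus_zero a := Subtype.ext (by simpa using a.2.2)
  neg_neg a := Subtype.ext (by simp)
  oplus_neg_zero a := Subtype.ext (by simpa using a.2.1)
  lukasiewicz := by
    rintro ⟨a, ha⟩ ⟨b, hb⟩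
    obtain ⟨ha, ha'⟩ := ha
    obtain ⟨hb, hb'⟩ := hb
    apply Subtype.ext
    simp only [min_def]
    split_ifs <;> linarith

/-- The power `A ^ Y` with componentwise operations. -/
instance instFun {Y A : Type*} [MVAlgebra A] : MVAlgebra (Y → A) where
  oplus f g := fun y => oplus (f y) (g y)
  neg f := fun y => neg (f y)
  zero := fun _ => zero
  oplus_assoc f g h := funext fun y => oplus_assoc (f y) (g y) (h y)
  oplus_comm f g := funext fun y => oplus_comm (f y) (g y)
  oplus_zero f := funext fun y => oplus_zero (f y)
  neg_neg f := funext fun y => neg_neg (f y)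
  oplus_neg_zero f := funext fun y => oplus_neg_zero (f y)
  lukasiewicz f g := funext fun y => lukasiewicz (f y) (g y)

end MVAlgebra

/-- Terms in the language of MV-algebras over the variables `X`. -/
inductive MVTerm (X : Type*) where
  | var : X → MVTerm X
  | zero : MVTerm X
  | neg : MVTerm X → MVTerm X
  | oplus : MVTerm X → MVTerm X → MVTerm X

namespace MVTerm

/-- Provable equality of terms: the congruence generated by the MV-algebra identities. -/
inductive Rel {X : Type*} : MVTerm X → MVTerm X → Prop where
  | refl (f) : Rel f f
  | symm {f g} : Rel f g → Rel g f
  | trans {f g h} : Rel f g → Rel g h → Rel f h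
  | neg_congr {f g} : Rel f g → Rel (neg f) (neg g)
  | oplus_congr {f f' g g'} : Rel f f' → Rel g g' → Rel (oplus f g) (oplus f' g')
  | oplus_assoc (f g h) : Rel (oplus (oplus f g) h) (oplus f (oplus g h))
  | oplus_comm (f g) : Rel (oplus f g) (oplus g f)
  | oplus_zero (f) : Rel (oplus f zero) f
  | neg_neg (f) : Rel (neg (neg f)) f
  | oplus_neg_zero (f) : Rel (oplus f (neg zero)) (neg zero)
  | lukasiewicz (f g) :
      Rel (oplus (neg (oplus (neg f) g)) g) (oplus (neg (oplus (neg g) f)) f)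

/-- Provable equality as a setoid. -/
def setoid (X : Type*) : Setoid (MVTerm X) := ⟨Rel, ⟨Rel.refl, Rel.symm, Rel.trans⟩⟩

/-- The value of a term in an MV-algebra under an assignment of the variables. -/
def eval {X A : Type*} [MVAlgebra A] (v : X → A) : MVTerm X → A
  | var i => v i
  | zero => MVAlgebra.zero
  | neg f => MVAlgebra.neg (eval v f)
  | oplus f g => MVAlgebra.oplus (eval v f) (eval v g)

theorem eval_eq_of_rel {X A : Type*} [MVAlgebra A] (v : X → A) {f g : MVTerm X}
    (h : Rel f g) : eval v f = eval v g := by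
  induction h with
  | refl => rfl
  | symm _ ih => exact ih.symm
  | trans _ _ ih₁ ih₂ => exact ih₁.trans ih₂
  | neg_congr _ ih => simp only [eval, ih]
  | oplus_congr _ _ ih₁ ih₂ => simp only [eval, ih₁, ih₂]
  | oplus_assoc => exact MVAlgebra.oplus_assoc _ _ _
  | oplus_comm => exact MVAlgebra.oplus_comm _ _
  | oplus_zero => exact MVAlgebra.oplus_zero _
  | neg_neg => exact MVAlgebra.neg_neg _
  | oplus_neg_zero => exact MVAlgebra.oplus_neg_zero _
  | lukasiewicz => exact MVAlgebra.lukasiewicz _ _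

end MVTerm

/-- The free MV-algebra over the set `X` of generators: terms modulo provable equality. -/
def FreeMV (X : Type*) : Type _ := Quotient (MVTerm.setoid X)

namespace FreeMV

instance instMVAlgebra {X : Type*} : MVAlgebra (FreeMV X) where
  oplus := Quotient.map₂ MVTerm.oplus fun _ _ h₁ _ _ h₂ => MVTerm.Rel.oplus_congr h₁ h₂
  neg := Quotient.map MVTerm.neg fun _ _ h => MVTerm.Rel.neg_congr h
  zero := Quotient.mk _ MVTerm.zero
  oplus_assoc := by
    rintro ⟨f⟩ ⟨g⟩ ⟨h⟩
    exact Quotient.sound (MVTerm.Rel.oplus_assoc f g h)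
  oplus_comm := by
    rintro ⟨f⟩ ⟨g⟩
    exact Quotient.sound (MVTerm.Rel.oplus_comm f g)
  oplus_zero := by
    rintro ⟨f⟩
    exact Quotient.sound (MVTerm.Rel.oplus_zero f)
  neg_neg := by
    rintro ⟨f⟩
    exact Quotient.sound (MVTerm.Rel.neg_neg f)
  oplus_neg_zero := by
    rintro ⟨f⟩
    exact Quotient.sound (MVTerm.Rel.oplus_neg_zero f)
  lukasiewicz := by
    rintro ⟨f⟩ ⟨g⟩
    exact Quotient.sound (MVTerm.Rel.lukasiewicz f g)

/-- The free generators. -/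
def gen {X : Type*} (i : X) : FreeMV X := Quotient.mk _ (MVTerm.var i)

/-- The homomorphism on the free MV-algebra that extends a map given on the generators. -/
def lift {X A : Type*} [MVAlgebra A] (v : X → A) : MVAlgebra.Hom (FreeMV X) A where
  toFun := Quotient.lift (MVTerm.eval v) fun _ _ h => MVTerm.eval_eq_of_rel v h
  map_oplus := by
    rintro ⟨f⟩ ⟨g⟩
    rfl
  map_neg := by
    rintro ⟨f⟩
    rfl
  map_zero := rfl

theorem lift_gen {X A : Type*} [MVAlgebra A] (v : X → A) (i : X) :
    (lift v).toFun (gen i) = v i := rfl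

/-- A homomorphism on the free MV-algebra is determined by its values on the generators. -/
theorem eq_lift {X A : Type*} [MVAlgebra A] (v : X → A) (φ : MVAlgebra.Hom (FreeMV X) A)
    (hφ : ∀ i, φ.toFun (gen i) = v i) (f : FreeMV X) : φ.toFun f = (lift v).toFun f := by
  obtain ⟨t⟩ := f
  induction t with
  | var i => exact hφ i
  | zero => exact φ.map_zero
  | neg f ih => exact (φ.map_neg (Quotient.mk _ f)).trans (congrArg MVAlgebra.neg ih)
  | oplus f g ihf ihg =>
    exact (φ.map_oplus (Quotient.mk _ f) (Quotient.mk _ g)).trans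
      (congrArg₂ MVAlgebra.oplus ihf ihg)

/-- The representation `ρ` of the free `n`-generated MV-algebra by `[0,1]`-valued functions on
`[0,1]ⁿ` that sends the `i`-th free generator to the `i`-th projection. -/
noncomputable def rho (n : ℕ) :
    MVAlgebra.Hom (FreeMV (Fin n)) ((Fin n → unitInterval) → unitInterval) :=
  lift fun i t => t i

theorem continuous_rho (n : ℕ) (f : FreeMV (Fin n)) : Continuous ((rho n).toFun f) := by
  obtain ⟨t⟩ := f
  induction t with
  | var i => exact continuous_apply i
  | zero => exact continuous_const
  | neg f ih =>
    exact Continuous.subtype_mk (continuous_const.sub (continuous_subtype_val.comp ih)) _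
  | oplus f g ihf ihg =>
    exact Continuous.subtype_mk (continuous_const.min
      ((continuous_subtype_val.comp ihf).add (continuous_subtype_val.comp ihg))) _

theorem integrable_rho (n : ℕ) (f : FreeMV (Fin n)) :
    Integrable (fun t : Fin n → unitInterval => ((rho n).toFun f t : ℝ)) volume :=
  (continuous_subtype_val.comp (continuous_rho n f)).integrable_of_hasCompactSupport
    (HasCompactSupport.of_compactSpace _)

/-- The average truth-value of `f`: the integral of `ρ f` over `[0,1]ⁿ` with respect to
Lebesgue measure. -/
noncomputable def average (n : ℕ) (f : FreeMV (Fin n)) : ℝ :=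
  ∫ t : Fin n → unitInterval, ((rho n).toFun f t : ℝ)

end FreeMV

-- Two facts turn the statement into measure theory. First, by Chang's completeness theorem
-- (`rho_injective`), elements of the free algebra may be compared as functions on the cube. A
-- nonzero element survives in a totally ordered quotient, such a chain embeds in a totally ordered
-- group, and the finitely many inequalities that determine the value of a term there can be copied
-- by real numbers (`exists_real_functional`). Second, a state is therefore positive on real
-- combinations of represented functions, and the extension theorem for positive functionals and the
-- Riesz theorem make it the integral against a probability measure μ (`exists_measure_of_isState`).
-- Condition (B1) makes μ invariant under the self-maps of the cube dual to automorphisms. Condition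
-- (B2) makes null every zero set of a McNaughton function whose complement is dense, in particular
-- the rational lines in two coordinates.
--
-- The average satisfies both conditions. The dual maps are piecewise affine with integer
-- coefficients; a nonzero integer determinant has absolute value at least 1, so volume cannot
-- shrink away from the degenerate pieces, which are null, and the total mass is fixed. The zero set
-- of a weak unit lies in finitely many hyperplanes.
--
-- For uniqueness, the triangle x + y ≤ 1 in a coordinate square is filled by triangular rings,
-- indexed by their least barycentric coordinate t. An explicit piecewise linear map rotates each
-- ring (`twist_ringCoord`). For irrational t < 1/4 the angle is an irrational part of the
-- perimeter, so its multiples are dense; choosing the multiple measurably in t shows that μ is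
-- invariant under every measurable family of rotations of these rings (`measurePreserving_rot`).
-- Conjugation by a reflection yields translations in a second direction. On a small parallelogram
-- the two families give all translations of a torus, so uniqueness of Haar measure determines the
-- measure there up to a factor, and rotations and reflections spread this to the whole square
-- (`TwistInvariant.exists_eq_smul`). Applied to μ restricted by a condition on the remaining
-- coordinates, this makes each coordinate uniform and independent of the others (`measure_pi_eq`),
-- so μ is Lebesgue measure.

universe u

/-! ### Arithmetic of MV-algebras: order, residuation, prelinearity -/

namespace MVAlgebra

section Arithmetic

variable {A : Type*} [MVAlgebra A]

/-- The truncated difference `f ⊖ g = ¬(¬f ⊕ g)`. -/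
def diff (f g : A) : A := neg (oplus (neg f) g)

/-- The Łukasiewicz conjunction `f ⊙ g = ¬(¬f ⊕ ¬g)`. -/
def odot (f g : A) : A := neg (oplus (neg f) (neg g))

/-- The natural order: `f ≤ g` when `¬f ⊕ g = 1`. -/
def Le (f g : A) : Prop := oplus (neg f) g = one

theorem neg_one_eq : neg (one : A) = zero := neg_neg zero

theorem zero_oplus (f : A) : oplus zero f = f := by rw [oplus_comm, oplus_zero]

theorem oplus_one (f : A) : oplus f one = one := oplus_neg_zero f

theorem one_oplus (f : A) : oplus one f = one := by rw [oplus_comm, oplus_one]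

theorem neg_oplus_self (f : A) : oplus (neg f) f = one := by
  have h := lukasiewicz f one
  rw [oplus_one, neg_one_eq, zero_oplus] at h
  exact h.symm

theorem oplus_neg_self (f : A) : oplus f (neg f) = one := by rw [oplus_comm, neg_oplus_self]

theorem oplus_left_comm (f g h : A) : oplus f (oplus g h) = oplus g (oplus f h) := by
  rw [← oplus_assoc, oplus_comm f g, oplus_assoc]

theorem Le.refl (f : A) : Le f f := neg_oplus_self f

theorem le_one (f : A) : Le f one := oplus_one _

theorem zero_le (f : A) : Le zero f := one_oplus f

theorem diff_oplus_comm (f g : A) : oplus (diff f g) g = oplus (diff g f) f := lukasiewicz f g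

theorem diff_eq_zero_iff {f g : A} : diff f g = zero ↔ Le f g := by
  constructor
  · intro h
    have := congrArg neg h
    rwa [diff, neg_neg] at this
  · intro h
    rw [diff, show oplus (neg f) g = one from h, neg_one_eq]

theorem diff_oplus_of_le {f g : A} (h : Le f g) : oplus (diff g f) f = g := by
  rw [← diff_oplus_comm, diff_eq_zero_iff.2 h, zero_oplus]

theorem Le.antisymm {f g : A} (h : Le f g) (h' : Le g f) : f = g := by
  rw [← diff_oplus_of_le h, diff_eq_zero_iff.2 h', zero_oplus]

/-- Residuation. -/
theorem diff_le_iff {f g h : A} : Le (diff f g) h ↔ Le f (oplus g h) := by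
  unfold Le diff
  rw [neg_neg, oplus_assoc]

theorem le_oplus_right (f g : A) : Le f (oplus f g) := by
  unfold Le
  rw [← oplus_assoc, neg_oplus_self, one_oplus]

theorem le_oplus_left (f g : A) : Le f (oplus g f) := by
  rw [oplus_comm]; exact le_oplus_right f g

theorem Le.trans {f g h : A} (h₁ : Le f g) (h₂ : Le g h) : Le f h := by
  have e : oplus f (oplus (diff h g) (diff g f)) = h := by
    rw [oplus_left_comm, oplus_comm f, diff_oplus_of_le h₁, diff_oplus_of_le h₂]
  rw [← e]
  exact le_oplus_right f _

theorem oplus_le_oplus_left {f g : A} (h : A) (hfg : Le f g) : Le (oplus h f) (oplus h g) := by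
  rw [← diff_oplus_of_le hfg, oplus_left_comm]
  exact le_oplus_left _ _

theorem oplus_le_oplus {f g f' g' : A} (h : Le f f') (h' : Le g g') :
    Le (oplus f g) (oplus f' g') := by
  refine (oplus_le_oplus_left f h').trans ?_
  rw [oplus_comm f, oplus_comm f']
  exact oplus_le_oplus_left _ h

theorem neg_le_neg {f g : A} (h : Le f g) : Le (neg g) (neg f) := by
  unfold Le
  rwa [neg_neg, oplus_comm]

theorem diff_le (f g : A) : Le (diff f g) f := diff_le_iff.2 (le_oplus_left f g)

theorem le_oplus_diff (f g : A) : Le f (oplus g (diff f g)) := diff_le_iff.1 (Le.refl _)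

theorem diff_le_diff_right {f g : A} (h : A) (hfg : Le f g) : Le (diff f h) (diff g h) :=
  diff_le_iff.2 (hfg.trans (le_oplus_diff g h))

theorem sup_eq (f g : A) : sup f g = oplus (diff f g) g := rfl

theorem sup_comm (f g : A) : sup f g = sup g f := lukasiewicz f g

theorem le_sup_right (f g : A) : Le g (sup f g) := le_oplus_left _ _

theorem le_sup_left (f g : A) : Le f (sup f g) := by
  rw [sup_comm]; exact le_sup_right g f

theorem sup_le {f g h : A} (hf : Le f h) (hg : Le g h) : Le (sup f g) h := by
  rw [sup_eq]
  refine (oplus_le_oplus (diff_le_diff_right g hf) (Le.refl g)).trans ?_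
  rw [diff_oplus_of_le hg]
  exact Le.refl h

theorem inf_le_left (f g : A) : Le (inf f g) f := by
  have := neg_le_neg (le_sup_left (neg f) (neg g))
  rwa [neg_neg] at this

theorem inf_le_right (f g : A) : Le (inf f g) g := by
  have := neg_le_neg (le_sup_right (neg f) (neg g))
  rwa [neg_neg] at this

theorem le_inf {f g h : A} (hf : Le h f) (hg : Le h g) : Le h (inf f g) := by
  have := neg_le_neg (sup_le (neg_le_neg hf) (neg_le_neg hg))
  rwa [neg_neg] at this

theorem eq_zero_of_le {f : A} (h : Le f zero) : f = zero := h.antisymm (zero_le f)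

theorem eq_one_of_le {f : A} (h : Le one f) : f = one := (le_one f).antisymm h

theorem diff_diff_oplus_diff (f g : A) : oplus (diff f (diff f g)) (diff f g) = f :=
  diff_oplus_of_le (diff_le f g)

/-- Both sides are the meet of `f` and `g`; the symmetry is the Łukasiewicz identity for the
negations. -/
theorem diff_diff_comm (f g : A) : diff f (diff f g) = diff g (diff g f) := by
  unfold diff
  congr 1
  rw [oplus_comm (neg f), oplus_comm (neg g)]
  have h := lukasiewicz (neg g) (neg f)
  rw [neg_neg, neg_neg, oplus_comm g, oplus_comm f] at h
  exact h

/-- If `f ≤ ¬g` then `(f ⊕ g) ⊖ g = f`. -/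
theorem oplus_diff_cancel {f g : A} (h : Le f (neg g)) : diff (oplus f g) g = f := by
  have e : oplus f g = neg (diff (neg g) f) := by
    rw [diff, neg_neg, neg_neg, oplus_comm]
  have e2 : diff (oplus f g) g = diff (neg g) (diff (neg g) f) := by
    rw [e]; unfold diff
    rw [neg_neg, neg_neg]
    congr 1
    rw [oplus_comm]
  rw [e2, diff_diff_comm, diff_eq_zero_iff.2 h]
  unfold diff
  rw [oplus_zero, neg_neg]

/-- Prelinearity. -/
theorem eq_zero_of_le_diff {f g h : A} (h₁ : Le h (diff f g)) (h₂ : Le h (diff g f)) :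
    h = zero := by
  -- Here `c` is the meet of `f` and `g`. The sum `c ⊕ h` still lies below `f` and below `g`, hence
  -- below `c`; since `h ≤ ¬c`, cancellation gives `h = 0`.
  set c := diff f (diff f g) with hc
  have hc' : c = diff g (diff g f) := diff_diff_comm f g
  have ha : Le (oplus c h) f := by
    have := oplus_le_oplus_left c h₁
    rwa [hc, diff_diff_oplus_diff] at this
  have hb : Le (oplus c h) g := by
    have := oplus_le_oplus_left c h₂
    rwa [hc', diff_diff_oplus_diff, ← hc'] at this
  have hcc : Le (oplus c h) c := by
    have h3 : Le (diff f g) (diff f (oplus c h)) := by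
      refine diff_le_iff.2 ?_
      refine (?_ : Le f (oplus (oplus c h) (diff f (oplus c h)))).trans
        (oplus_le_oplus hb (Le.refl _))
      exact le_oplus_diff _ _
    have h4 : Le (diff f (diff f (oplus c h))) (diff f (diff f g)) := by
      refine diff_le_iff.2 ((le_oplus_diff f (diff f g)).trans ?_)
      exact oplus_le_oplus h3 (Le.refl _)
    rw [diff_diff_comm f (oplus c h), diff_eq_zero_iff.2 ha] at h4
    have e : diff (oplus c h) zero = oplus c h := by
      unfold diff; rw [oplus_zero, neg_neg]
    rwa [e] at h4
  have hn : Le h (neg c) := by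
    refine h₁.trans ((?_ : Le (diff f g) (neg g)).trans (neg_le_neg ?_))
    · exact neg_le_neg (le_oplus_left g (neg f))
    · rw [hc']; exact diff_le _ _
  rw [← oplus_diff_cancel hn, oplus_comm h c]
  exact diff_eq_zero_iff.2 hcc

/-- By residuation both hypotheses bound `h ⊖ j`, which therefore lies below the meet. -/
theorem oplus_le_inf {f g h j : A} (hf : Le h (oplus j f)) (hg : Le h (oplus j g)) :
    Le h (oplus j (inf f g)) :=
  diff_le_iff.1 (le_inf (diff_le_iff.2 hf) (diff_le_iff.2 hg))

/-- `f` and `g` are disjoint if only `0` lies below both. -/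
def Disj (f g : A) : Prop := ∀ h, Le h f → Le h g → h = zero

theorem Disj.symm {f g : A} (h : Disj f g) : Disj g f := fun k h₁ h₂ => h k h₂ h₁

/-- If `k` lies below `f` and below `g ⊕ g'`, then `k ⊖ g` lies below `f` and `g'`, so it vanishes,
which means `k ≤ g`. -/
theorem Disj.oplus {f g g' : A} (h : Disj f g) (h' : Disj f g') : Disj f (oplus g g') := by
  intro k hk hk'
  have h1 : diff k g = zero :=
    h' _ ((diff_le k g).trans hk) (diff_le_iff.2 hk')
  exact h k hk (diff_eq_zero_iff.1 h1)

theorem Disj.nfold {f g : A} (h : Disj f g) (k : ℕ) : Disj f (nfold k g) := by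
  induction k with
  | zero => exact fun _ _ h₂ => eq_zero_of_le h₂
  | succ k ih => exact ih.oplus h

theorem disj_diff (f g : A) : Disj (diff f g) (diff g f) := fun _ h₁ h₂ =>
  eq_zero_of_le_diff h₁ h₂

end Arithmetic

/-! ### Prime ideals and totally ordered quotients -/

section Ideals

variable {A : Type*} [MVAlgebra A]

/-- Ideals: down-closed sets containing `0` and closed under `⊕`. -/
structure IsIdeal (J : Set A) : Prop where
  zero_mem : zero ∈ J
  oplus_mem : ∀ {f g}, f ∈ J → g ∈ J → oplus f g ∈ J
  mem_of_le : ∀ {f g}, Le f g → g ∈ J → f ∈ J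

theorem nfold_add (j k : ℕ) (f : A) : nfold (j + k) f = oplus (nfold j f) (nfold k f) := by
  induction k with
  | zero => exact (oplus_zero _).symm
  | succ k ih =>
    rw [← Nat.add_assoc]
    change oplus (nfold (j + k) f) f = oplus (nfold j f) (oplus (nfold k f) f)
    rw [ih, oplus_assoc]

/-- The ideal generated by an ideal and one element. -/
theorem isIdeal_adjoin {J : Set A} (hJ : IsIdeal J) (x : A) :
    IsIdeal {f | ∃ j ∈ J, ∃ k, Le f (oplus j (nfold k x))} where
  zero_mem := ⟨zero, hJ.zero_mem, 0, zero_le _⟩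
  oplus_mem := by
    rintro f g ⟨j, hj, k, h⟩ ⟨j', hj', k', h'⟩
    refine ⟨oplus j j', hJ.oplus_mem hj hj', k + k', (oplus_le_oplus h h').trans ?_⟩
    rw [nfold_add, oplus_assoc, oplus_assoc, oplus_left_comm j']
    exact Le.refl _
  mem_of_le := by
    rintro f g hfg ⟨j, hj, k, h⟩
    exact ⟨j, hj, k, hfg.trans h⟩

/-- A nonzero element is omitted by some ideal that contains `f ⊖ g` or `g ⊖ f` for all
`f`, `g`. -/
theorem exists_prime_ideal {a : A} (ha : a ≠ zero) :
    ∃ J : Set A, IsIdeal J ∧ a ∉ J ∧ ∀ f g, diff f g ∈ J ∨ diff g f ∈ J := by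
  -- An ideal maximal among those that omit `a` will be prime.
  obtain ⟨J, -, hJ⟩ := zorn_subset_nonempty {J : Set A | IsIdeal J ∧ a ∉ J} (by
    intro c hc hchain hne
    obtain ⟨J₀, hJ₀⟩ := hne
    refine ⟨⋃₀ c, ⟨⟨⟨J₀, hJ₀, (hc hJ₀).1.zero_mem⟩, ?_, ?_⟩, ?_⟩,
      fun s hs => Set.subset_sUnion_of_mem hs⟩
    · rintro f g ⟨J₁, h₁, hf⟩ ⟨J₂, h₂, hg⟩
      rcases hchain.total h₁ h₂ with h | h
      · exact ⟨J₂, h₂, (hc h₂).1.oplus_mem (h hf) hg⟩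
      · exact ⟨J₁, h₁, (hc h₁).1.oplus_mem hf (h hg)⟩
    · rintro f g hfg ⟨J₁, h₁, hg⟩
      exact ⟨J₁, h₁, (hc h₁).1.mem_of_le hfg hg⟩
    · rintro ⟨J₁, h₁, h⟩
      exact (hc h₁).2 h) {zero}
    ⟨⟨rfl, by
      rintro f g rfl rfl
      exact oplus_zero _, by
      rintro f g hfg rfl
      exact eq_zero_of_le hfg⟩, ha⟩
  obtain ⟨⟨hI, haJ⟩, hmax⟩ := hJ
  have key : ∀ x, x ∉ J → ∃ j ∈ J, ∃ k, Le a (oplus j (nfold k x)) := by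
    intro x hx
    by_contra hcon
    have := hmax (y := {f | ∃ j ∈ J, ∃ k, Le f (oplus j (nfold k x))})
      ⟨isIdeal_adjoin hI x, hcon⟩
      (fun f hf => ⟨f, hf, 0, by simpa only [nfold, oplus_zero] using Le.refl f⟩)
    exact hx (this ⟨zero, hI.zero_mem, 1, by
      simpa only [nfold, zero_oplus] using Le.refl x⟩)
  refine ⟨J, hI, haJ, fun f g => ?_⟩
  -- If both differences were outside `J`, maximality would put `a` below an element of `J` plus a
  -- multiple of either difference. Multiples of the two differences are still disjoint, so `a`
  -- would lie below an element of `J`.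
  by_contra! hcon
  obtain ⟨j, hj, k, h⟩ := key _ hcon.1
  obtain ⟨j', hj', k', h'⟩ := key _ hcon.2
  have hd : Disj (nfold k (diff f g)) (nfold k' (diff g f)) :=
    (((disj_diff f g).nfold k').symm.nfold k).symm
  have h1 : Le a (oplus (oplus j j') (nfold k (diff f g))) :=
    h.trans (oplus_le_oplus (le_oplus_right _ _) (Le.refl _))
  have h2 : Le a (oplus (oplus j j') (nfold k' (diff g f))) :=
    h'.trans (oplus_le_oplus (le_oplus_left _ _) (Le.refl _))
  have h3 := oplus_le_inf h1 h2
  rw [hd _ (inf_le_left _ _) (inf_le_right _ _), oplus_zero] at h3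
  exact haJ (hI.mem_of_le h3 (hI.oplus_mem hj hj'))

/-- The congruence of an ideal. -/
def idealSetoid {J : Set A} (hJ : IsIdeal J) : Setoid A where
  r f g := diff f g ∈ J ∧ diff g f ∈ J
  iseqv := by
    have htr : ∀ f g h : A, Le (diff f h) (oplus (diff f g) (diff g h)) := by
      intro f g h
      refine diff_le_iff.2 ((le_oplus_diff f g).trans ?_)
      rw [oplus_left_comm, oplus_comm]
      exact oplus_le_oplus_left _ (le_oplus_diff g h)
    refine ⟨fun f => ?_, fun h => ⟨h.2, h.1⟩, fun {f g h} h₁ h₂ => ⟨?_, ?_⟩⟩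
    · rw [diff_eq_zero_iff.2 (Le.refl f)]
      exact ⟨hJ.zero_mem, hJ.zero_mem⟩
    · exact hJ.mem_of_le (htr f g h) (hJ.oplus_mem h₁.1 h₂.1)
    · exact hJ.mem_of_le (htr h g f) (hJ.oplus_mem h₂.2 h₁.2)

/-- The quotient by an ideal. -/
def IdealQuotient {J : Set A} (hJ : IsIdeal J) : Type _ := Quotient (idealSetoid hJ)

instance {J : Set A} (hJ : IsIdeal J) : MVAlgebra (IdealQuotient hJ) where
  oplus := Quotient.map₂ oplus fun f f' hf g g' hg => by
    have : ∀ f f' g g' : A,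
        Le (diff (oplus f g) (oplus f' g')) (oplus (diff f f') (diff g g')) := by
      intro f f' g g'
      refine diff_le_iff.2 ((oplus_le_oplus (le_oplus_diff f f') (le_oplus_diff g g')).trans ?_)
      rw [oplus_assoc, oplus_assoc, oplus_left_comm g']
      exact Le.refl _
    exact ⟨hJ.mem_of_le (this _ _ _ _) (hJ.oplus_mem hf.1 hg.1),
      hJ.mem_of_le (this _ _ _ _) (hJ.oplus_mem hf.2 hg.2)⟩
  neg := Quotient.map neg fun f g h => by
    have e : ∀ f g : A, diff (neg f) (neg g) = diff g f := by
      intro f g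
      unfold diff
      rw [neg_neg, oplus_comm]
    change diff _ _ ∈ J ∧ diff _ _ ∈ J
    rw [e, e]
    exact ⟨h.2, h.1⟩
  zero := Quotient.mk _ zero
  oplus_assoc := by
    rintro ⟨f⟩ ⟨g⟩ ⟨h⟩
    exact congrArg (Quotient.mk _) (oplus_assoc f g h)
  oplus_comm := by
    rintro ⟨f⟩ ⟨g⟩
    exact congrArg (Quotient.mk _) (oplus_comm f g)
  oplus_zero := by
    rintro ⟨f⟩
    exact congrArg (Quotient.mk _) (oplus_zero f)
  neg_neg := by
    rintro ⟨f⟩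
    exact congrArg (Quotient.mk _) (neg_neg f)
  oplus_neg_zero := by
    rintro ⟨f⟩
    exact congrArg (Quotient.mk _) (oplus_neg_zero f)
  lukasiewicz := by
    rintro ⟨f⟩ ⟨g⟩
    exact congrArg (Quotient.mk _) (lukasiewicz f g)

/-- The canonical projection onto the quotient by an ideal. -/
def IdealQuotient.proj {J : Set A} (hJ : IsIdeal J) : Hom A (IdealQuotient hJ) where
  toFun := Quotient.mk _
  map_oplus _ _ := rfl
  map_neg _ := rfl
  map_zero := rfl

/-- A nonzero element stays nonzero in some totally ordered quotient. -/
theorem exists_chain_quotient {A : Type u} [MVAlgebra A] {a : A} (ha : a ≠ zero) :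
    ∃ (C : Type u) (_ : MVAlgebra C) (φ : Hom A C),
      (∀ x y : C, Le x y ∨ Le y x) ∧ φ.toFun a ≠ zero := by
  obtain ⟨J, hJ, haJ, htot⟩ := exists_prime_ideal ha
  have hzero : ∀ f : A, (IdealQuotient.proj hJ).toFun f = zero ↔ f ∈ J := by
    intro f
    have e : diff f zero = f := by unfold diff; rw [oplus_zero, neg_neg]
    constructor
    · intro h
      have h' : diff f zero ∈ J ∧ diff zero f ∈ J := Quotient.exact h
      rw [e] at h'
      exact h'.1
    · intro h
      refine Quotient.sound (⟨?_, ?_⟩ : diff f zero ∈ J ∧ diff zero f ∈ J)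
      · rwa [e]
      · rw [diff_eq_zero_iff.2 (zero_le f)]
        exact hJ.zero_mem
  refine ⟨IdealQuotient hJ, inferInstance, IdealQuotient.proj hJ, ?_, fun h => haJ ((hzero a).1 h)⟩
  rintro ⟨f⟩ ⟨g⟩
  rcases htot f g with h | h
  · exact Or.inl (diff_eq_zero_iff.1 ((hzero _).2 h))
  · exact Or.inr (diff_eq_zero_iff.1 ((hzero _).2 h))

end Ideals

end MVAlgebra

/-! ### Finite parts of total preorders on ℤᵏ are given by real functionals -/

section FourierMotzkin

/-- With `N` read as the cone of nonnegative elements, `p ∈ N` and `-p ∉ N` say that `p` is strictly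
positive; positive multiples remain so. -/
theorem neg_nsmul_notMem {M : Type*} [AddCommGroup M] {N : AddSubmonoid M} {p : M} (hp : p ∈ N)
    (hp' : -p ∉ N) {m : ℤ} (hm : 0 < m) : m • p ∈ N ∧ -(m • p) ∉ N := by
  obtain ⟨j, rfl⟩ : ∃ j : ℕ, m = (j : ℤ) + 1 := ⟨(m - 1).toNat, by omega⟩
  have hj : (j : ℤ) • p ∈ N := by
    rw [natCast_zsmul]
    exact N.nsmul_mem hp j
  rw [add_smul, one_smul]
  exact ⟨N.add_mem hj hp, fun h => hp' (by simpa using N.add_mem h hj)⟩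

theorem zsmul_mem_of_nonneg {M : Type*} [AddCommGroup M] {N : AddSubmonoid M} {p : M} (hp : p ∈ N)
    {m : ℤ} (hm : 0 ≤ m) : m • p ∈ N := by
  lift m to ℕ using hm
  rw [natCast_zsmul]
  exact N.nsmul_mem hp m

theorem neg_add_notMem {M : Type*} [AddCommGroup M] {N : AddSubmonoid M} {p q : M} (hq : q ∈ N)
    (hp' : -p ∉ N) : -(p + q) ∉ N := fun h => hp' (by simpa using N.add_mem h hq)

/-- A total preorder of `ℤᵏ` that is compatible with addition agrees on a given finite set with
the preorder of a real linear functional. The proof is Fourier–Motzkin elimination. -/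
theorem exists_real_functional (k : ℕ) (N : AddSubmonoid (Fin k → ℤ))
    (htot : ∀ s, s ∈ N ∨ -s ∈ N) (S : Finset (Fin k → ℤ)) :
    ∃ φ : Fin k → ℝ, ∀ s ∈ S, s ∈ N ↔ 0 ≤ ∑ i, (s i : ℝ) * φ i := by
  classical
  induction k with
  | zero =>
    refine ⟨0, fun s _ => ?_⟩
    rw [Subsingleton.elim s 0]
    exact iff_of_true N.zero_mem (by simp)
  | succ k ih =>
    -- Up to sign, the forms in which the first variable occurs; normalised to a positive leading
    -- coefficient, each of them compares that variable with a threshold.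
    set T : Finset (Fin (k + 1) → ℤ) := (S ∪ S.image (fun s => -s)).filter (fun s => 0 < s 0)
      with hT
    let E : (Fin k → ℤ) →+ (Fin (k + 1) → ℤ) :=
      { toFun := fun s => Fin.cons 0 s
        map_zero' := by ext i; refine Fin.cases ?_ (fun i => ?_) i <;> simp
        map_add' := fun s t => by ext i; refine Fin.cases ?_ (fun i => ?_) i <;> simp }
    have hE : ∀ s : Fin (k + 1) → ℤ, s 0 = 0 → E (Fin.tail s) = s := by
      intro s hs
      change Fin.cons 0 (Fin.tail s) = s
      rw [← hs, Fin.cons_self_tail]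
    -- The positive combination of `t` and `-t'` that eliminates the first variable; the induction
    -- hypothesis is applied to `S` and to all these combinations.
    let D : (Fin (k + 1) → ℤ) → (Fin (k + 1) → ℤ) → (Fin (k + 1) → ℤ) :=
      fun t t' => t' 0 • t - t 0 • t'
    have hD0 : ∀ t t', D t t' 0 = 0 := fun t t' => by simp [D, mul_comm]
    obtain ⟨φ, hφ⟩ := ih (N.comap E) (fun s => by
        rcases htot (E s) with h | h
        · exact Or.inl h
        · refine Or.inr ?_
          rw [← map_neg] at h
          exact h)
      (S.image Fin.tail ∪ (T ×ˢ T).image (fun p => Fin.tail (D p.1 p.2)))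
    have hφ' : ∀ s : Fin (k + 1) → ℤ, s 0 = 0 → Fin.tail s ∈ S.image Fin.tail ∪
        (T ×ˢ T).image (fun p => Fin.tail (D p.1 p.2)) →
        (s ∈ N ↔ 0 ≤ ∑ i : Fin k, (s i.succ : ℝ) * φ i) := by
      intro s hs hmem
      have := hφ _ hmem
      rw [AddSubmonoid.mem_comap, hE s hs] at this
      exact this
    let L : (Fin (k + 1) → ℤ) → ℝ := fun s => ∑ i : Fin k, (s i.succ : ℝ) * φ i
    -- The form `s` is nonnegative at `(z, φ)` exactly when `θ s ≤ z`, provided that `s 0 > 0`.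
    let θ : (Fin (k + 1) → ℤ) → ℝ := fun s => -L s / s 0
    have hcmp : ∀ t ∈ T, ∀ t' ∈ T, (D t t' ∈ N ↔ θ t ≤ θ t') := by
      intro t ht t' ht'
      have h0 : (0 : ℝ) < t 0 := by exact_mod_cast (Finset.mem_filter.1 ht).2
      have h0' : (0 : ℝ) < t' 0 := by exact_mod_cast (Finset.mem_filter.1 ht').2
      rw [hφ' _ (hD0 t t') (Finset.mem_union_right _ (Finset.mem_image.2
        ⟨(t, t'), Finset.mem_product.2 ⟨ht, ht'⟩, rfl⟩))]
      have e : ∑ i : Fin k, ((D t t') i.succ : ℝ) * φ i = t' 0 * L t - t 0 * L t' := by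
        simp only [D, L, Finset.mul_sum, ← Finset.sum_sub_distrib]
        refine Finset.sum_congr rfl fun i _ => ?_
        simp only [Pi.sub_apply, Pi.smul_apply, smul_eq_mul]
        push_cast
        ring
      rw [e, div_le_div_iff₀ h0 h0']
      constructor <;> intro h <;> nlinarith
    have hle : ∀ t ∈ T, ∀ t' ∈ T, t ∈ N → -t' ∈ N → θ t ≤ θ t' := by
      intro t ht t' ht' h h'
      rw [← hcmp t ht t' ht']
      have := N.add_mem (zsmul_mem_of_nonneg h (Finset.mem_filter.1 ht').2.le)
        (zsmul_mem_of_nonneg h' (Finset.mem_filter.1 ht).2.le)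
      simpa [D, sub_eq_add_neg] using this
    have hlt : ∀ t ∈ T, ∀ t' ∈ T, t ∈ N → -t' ∈ N → (-t ∉ N ∨ t' ∉ N) → θ t < θ t' := by
      intro t ht t' ht' h h' h''
      rw [← not_le, ← hcmp t' ht' t ht]
      have e : D t' t = -(t' 0 • t + t 0 • (-t')) := by
        simp only [D, smul_neg]
        abel
      rw [e]
      rcases h'' with h'' | h''
      · exact neg_add_notMem (zsmul_mem_of_nonneg h' (Finset.mem_filter.1 ht).2.le)
          (neg_nsmul_notMem h h'' (Finset.mem_filter.1 ht').2).2
      · rw [add_comm (t' 0 • t)]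
        exact neg_add_notMem (zsmul_mem_of_nonneg h (Finset.mem_filter.1 ht').2.le)
          (neg_nsmul_notMem h' (by rwa [neg_neg]) (Finset.mem_filter.1 ht).2).2
    -- The number `z` has to separate the thresholds of the forms in `N` from those of the others.
    -- If some form and its negative are both in `N`, its threshold is the only choice; otherwise
    -- two finite sets are separated strictly.
    have hz : ∃ z : ℝ, ∀ t ∈ T, (t ∈ N ↔ θ t ≤ z) ∧ (-t ∈ N ↔ z ≤ θ t) := by
      by_cases hex : ∃ s ∈ T, s ∈ N ∧ -s ∈ N
      · obtain ⟨s, hs, hsN, hsN'⟩ := hex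
        refine ⟨θ s, fun t ht => ⟨⟨fun h => hle t ht s hs h hsN', fun h => ?_⟩,
          ⟨fun h => hle s hs t ht hsN h, fun h => ?_⟩⟩⟩
        · by_contra hn
          exact absurd (hlt s hs t ht hsN ((htot t).resolve_left hn) (Or.inr hn)) (not_lt.2 h)
        · by_contra hn
          exact absurd (hlt t ht s hs ((htot t).resolve_right hn) hsN' (Or.inl hn)) (not_lt.2 h)
      · push Not at hex
        obtain ⟨z, hz₁, hz₂⟩ := Order.exists_between_finsets
          ((T.filter (fun t => t ∈ N)).image θ) ((T.filter (fun t => t ∉ N)).image θ) (by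
            intro x hx y hy
            obtain ⟨t, ht, rfl⟩ := Finset.mem_image.1 hx
            obtain ⟨t', ht', rfl⟩ := Finset.mem_image.1 hy
            rw [Finset.mem_filter] at ht ht'
            exact hlt t ht.1 t' ht'.1 ht.2 ((htot t').resolve_left ht'.2) (Or.inr ht'.2))
        refine ⟨z, fun t ht => ?_⟩
        by_cases h : t ∈ N
        · have := hz₁ _ (Finset.mem_image_of_mem θ (Finset.mem_filter.2 ⟨ht, h⟩))
          simp only [h, hex t ht h, this.le, false_iff, not_le, this, and_self]
        · have := hz₂ _ (Finset.mem_image_of_mem θ (Finset.mem_filter.2 ⟨ht, h⟩))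
          simp only [h, (htot t).resolve_left h, this.le, false_iff, not_le, this,
            and_self]
    obtain ⟨z, hz⟩ := hz
    refine ⟨Fin.cons z φ, fun s hs => ?_⟩
    rw [Fin.sum_univ_succ]
    simp only [Fin.cons_zero, Fin.cons_succ]
    change s ∈ N ↔ 0 ≤ (s 0 : ℝ) * z + L s
    rcases lt_trichotomy (s 0) 0 with h | h | h
    · have hm : -s ∈ T := Finset.mem_filter.2
        ⟨Finset.mem_union_right _ (Finset.mem_image_of_mem _ hs), by simpa using h⟩
      have h0 : (0 : ℝ) < -(s 0 : ℝ) := by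
        have : (s 0 : ℝ) < 0 := by exact_mod_cast h
        linarith
      have h2 := (hz _ hm).2
      rw [neg_neg] at h2
      have e : θ (-s) = L s / -(s 0 : ℝ) := by
        simp [θ, L]
      rw [h2, e, le_div_iff₀ h0]
      constructor <;> intro h <;> linarith
    · rw [h, hφ' s h (Finset.mem_union_left _ (Finset.mem_image_of_mem _ hs))]
      simp [L]
    · have hm : s ∈ T := Finset.mem_filter.2 ⟨Finset.mem_union_left _ hs, h⟩
      have h0 : (0 : ℝ) < (s 0 : ℝ) := by exact_mod_cast h
      rw [(hz _ hm).1, div_le_iff₀ h0]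
      constructor <;> intro h <;> linarith

end FourierMotzkin

/-! ### Chang's group of an MV-chain -/

namespace MVAlgebra

section ChainGroup

variable {C : Type*} [MVAlgebra C]

theorem odot_comm (f g : C) : odot f g = odot g f := by
  unfold odot; rw [oplus_comm]

theorem odot_le_left (f g : C) : Le (odot f g) f := diff_le f (neg g)

theorem odot_left_comm (f g h : C) : odot f (odot g h) = odot g (odot f h) := by
  unfold odot
  rw [neg_neg, neg_neg, oplus_left_comm]

theorem odot_oplus_of_oplus_eq_one {f g : C} (h : oplus f g = one) :
    oplus (odot g f) (neg f) = g :=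
  diff_oplus_of_le (by unfold Le; rwa [neg_neg])

/-- When both sums overflow, `b ⊙ x` and `a ⊙ x` are `b + x - 1` and `a + x - 1`, so both sides
truncate `a + b + x - 1`. The proof writes `a` as `(a ⊙ x) ⊕ ¬x` and `b` likewise. -/
theorem oplus_odot_left_comm {a b x : C} (ha : oplus a x = one) (hb : oplus b x = one) :
    oplus a (odot b x) = oplus b (odot a x) := by
  rw [oplus_comm] at ha hb
  conv_lhs => rw [← odot_oplus_of_oplus_eq_one ha]
  conv_rhs => rw [← odot_oplus_of_oplus_eq_one hb]
  rw [oplus_assoc, oplus_comm, oplus_comm (neg x)]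

/-- The case without overflow is the negation of the case with overflow. -/
theorem odot_oplus_left_comm {a b x : C} (ha : Le x (neg a)) (hb : Le x (neg b)) :
    odot a (oplus b x) = odot b (oplus a x) := by
  have h := oplus_odot_left_comm (a := neg a) (b := neg b) (x := neg x)
    (by rw [oplus_comm]; exact ha) (by rw [oplus_comm]; exact hb)
  unfold odot at h ⊢
  rw [neg_neg, neg_neg, neg_neg] at h
  rw [h]

/-- Total order of an MV-chain. -/
class IsChain (C : Type*) [MVAlgebra C] : Prop where
  total : ∀ x y : C, Le x y ∨ Le y x
  zero_ne_one : (zero : C) ≠ one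

theorem le_neg_of_oplus_ne_one [IsChain C] {a x : C} (h : oplus a x ≠ one) : Le x (neg a) := by
  refine (IsChain.total x (neg a)).resolve_right fun h' => h ?_
  unfold Le at h'
  rwa [neg_neg] at h'

theorem odot_eq_zero_of_oplus_ne_one [IsChain C] {a x : C} (h : oplus a x ≠ one) :
    odot x a = zero := diff_eq_zero_iff.2 (le_neg_of_oplus_ne_one h)

/-- If `b + x` overflows and `a + x` does not. -/
theorem oplus_odot_eq_odot_oplus [IsChain C] {a b x : C} (ha : oplus a x ≠ one)
    (hb : oplus b x = one) : oplus a (odot b x) = odot b (oplus a x) := by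
  have e : oplus (oplus a (odot b x)) (neg b) = oplus a x := by
    rw [oplus_assoc, odot_comm b x, odot_oplus_of_oplus_eq_one hb]
  have h : Le (oplus a (odot b x)) (neg (neg b)) :=
    le_neg_of_oplus_ne_one (by rwa [oplus_comm, e])
  rw [odot_comm b (oplus a x), ← e]
  exact (oplus_diff_cancel h).symm

/-- The ordered group `ℤ × [0,1)` with carry of an MV-chain; its elements of integral part `0`,
together with `(1, 0)`, form a copy of the chain. -/
@[ext]
structure ChainGroup (C : Type*) [MVAlgebra C] where
  /-- The integral part. -/
  int : ℤ
  /-- The fractional part. -/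
  frac : C
  /-- The fractional part is less than one. -/
  frac_ne : frac ≠ one

namespace ChainGroup

theorem odot_ne_one {x y : C} (hx : x ≠ one) : odot x y ≠ one := fun h =>
  hx (eq_one_of_le (h ▸ odot_le_left x y))

open Classical in
/-- Addition with carry. -/
noncomputable instance : Add (ChainGroup C) where
  add p q := if h : oplus p.frac q.frac = one
    then ⟨p.int + q.int + 1, odot p.frac q.frac, odot_ne_one p.frac_ne⟩
    else ⟨p.int + q.int, oplus p.frac q.frac, h⟩

theorem add_of_eq {p q : ChainGroup C} (h : oplus p.frac q.frac = one) :
    p + q = ⟨p.int + q.int + 1, odot p.frac q.frac, odot_ne_one p.frac_ne⟩ := dif_pos h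

theorem add_of_ne {p q : ChainGroup C} (h : oplus p.frac q.frac ≠ one) :
    p + q = ⟨p.int + q.int, oplus p.frac q.frac, h⟩ := dif_neg h

theorem int_add_le (p q : ChainGroup C) : p.int + q.int ≤ (p + q).int := by
  by_cases h : oplus p.frac q.frac = one
  · rw [add_of_eq h]; simp
  · rw [add_of_ne h]

theorem add_comm' (p q : ChainGroup C) : p + q = q + p := by
  by_cases h : oplus p.frac q.frac = one
  · rw [add_of_eq h, add_of_eq (by rwa [oplus_comm])]
    simp only [odot_comm p.frac, add_comm p.int]
  · rw [add_of_ne h, add_of_ne (by rwa [oplus_comm])]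
    simp only [oplus_comm p.frac, add_comm p.int]

/-- Together with commutativity this gives associativity. The form is symmetric in `p` and `q`, so
the cases are whether `q + r` and `p + r` carry. -/
theorem add_left_comm' [IsChain C] (p q r : ChainGroup C) : p + (q + r) = q + (p + r) := by
  obtain ⟨k, a, ha⟩ := p
  obtain ⟨l, b, hb⟩ := q
  obtain ⟨m, x, hx⟩ := r
  by_cases h1 : oplus b x = one <;> by_cases h2 : oplus a x = one
  · rw [add_of_eq (p := ⟨l, b, hb⟩) h1, add_of_eq (p := ⟨k, a, ha⟩) (q := ⟨m, x, hx⟩) h2]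
    have e := oplus_odot_left_comm h2 h1
    by_cases h3 : oplus a (odot b x) = one
    · rw [add_of_eq h3, add_of_eq (by rwa [← e])]
      ext
      · simp only; ring
      · exact odot_left_comm _ _ _
    · rw [add_of_ne h3, add_of_ne (by rwa [← e])]
      ext
      · simp only; ring
      · exact e
  · rw [add_of_eq (p := ⟨l, b, hb⟩) h1, add_of_ne (p := ⟨k, a, ha⟩) (q := ⟨m, x, hx⟩) h2]
    have e := oplus_odot_eq_odot_oplus h2 h1
    rw [add_of_ne (by rw [e]; exact odot_ne_one hb),
      add_of_eq (by change oplus b (oplus a x) = one; rw [oplus_left_comm, h1, oplus_one])]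
    ext
    · simp only; ring
    · exact e
  · rw [add_of_ne (p := ⟨l, b, hb⟩) h1, add_of_eq (p := ⟨k, a, ha⟩) (q := ⟨m, x, hx⟩) h2]
    have e := oplus_odot_eq_odot_oplus h1 h2
    rw [add_of_eq (by change oplus a (oplus b x) = one; rw [oplus_left_comm, h2, oplus_one]),
      add_of_ne (by rw [e]; exact odot_ne_one ha)]
    ext
    · simp only; ring
    · exact e.symm
  · rw [add_of_ne (p := ⟨l, b, hb⟩) h1, add_of_ne (p := ⟨k, a, ha⟩) (q := ⟨m, x, hx⟩) h2]
    by_cases h3 : oplus a (oplus b x) = one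
    · rw [add_of_eq h3, add_of_eq (by rwa [oplus_left_comm] at h3)]
      ext
      · simp only; ring
      · exact odot_oplus_left_comm (le_neg_of_oplus_ne_one h2) (le_neg_of_oplus_ne_one h1)
    · rw [add_of_ne h3, add_of_ne (by rwa [oplus_left_comm] at h3)]
      ext
      · simp only; ring
      · exact oplus_left_comm _ _ _

instance [IsChain C] : Zero (ChainGroup C) := ⟨⟨0, zero, IsChain.zero_ne_one⟩⟩

open Classical in
noncomputable instance [IsChain C] : Neg (ChainGroup C) where
  neg p := if h : p.frac = zero then ⟨-p.int, zero, IsChain.zero_ne_one⟩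
    else ⟨-p.int - 1, neg p.frac, fun h' => h (by rw [← neg_neg p.frac, h', neg_one_eq])⟩

theorem neg_of_eq [IsChain C] {p : ChainGroup C} (h : p.frac = zero) :
    -p = ⟨-p.int, zero, IsChain.zero_ne_one⟩ := dif_pos h

theorem neg_of_ne [IsChain C] {p : ChainGroup C} (h : p.frac ≠ zero) :
    -p = ⟨-p.int - 1, neg p.frac, fun h' => h (by rw [← neg_neg p.frac, h', neg_one_eq])⟩ :=
  dif_neg h

noncomputable instance [IsChain C] : AddCommGroup (ChainGroup C) where
  add_assoc p q r := by
    rw [add_comm' (p + q) r, add_left_comm' r p q, add_comm' r q]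
  zero_add p := by
    have e : oplus (0 : ChainGroup C).frac p.frac = p.frac := zero_oplus _
    rw [add_of_ne (by rw [e]; exact p.frac_ne)]
    ext
    · exact zero_add _
    · exact e
  add_zero p := by
    have e : oplus p.frac (0 : ChainGroup C).frac = p.frac := oplus_zero _
    rw [add_of_ne (by rw [e]; exact p.frac_ne)]
    ext
    · exact add_zero _
    · exact e
  neg_add_cancel p := by
    by_cases h : p.frac = zero
    · rw [neg_of_eq h, add_of_ne (by rw [h, oplus_zero]; exact IsChain.zero_ne_one)]
      ext
      · exact neg_add_cancel p.int
      · exact (zero_oplus p.frac).trans h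
    · rw [neg_of_ne h, add_of_eq (neg_oplus_self _)]
      ext
      · change -p.int - 1 + p.int + 1 = 0
        ring
      · exact diff_eq_zero_iff.2 (Le.refl (neg p.frac))
  add_comm := add_comm'
  nsmul := nsmulRec
  zsmul := zsmulRec

open Classical in
/-- The embedding of an MV-chain into its group. -/
noncomputable def of [IsChain C] (x : C) : ChainGroup C :=
  if h : x = one then ⟨1, zero, IsChain.zero_ne_one⟩ else ⟨0, x, h⟩

theorem of_one [IsChain C] : of (one : C) = ⟨1, zero, IsChain.zero_ne_one⟩ := dif_pos rfl

theorem of_of_ne [IsChain C] {x : C} (h : x ≠ one) : of x = ⟨0, x, h⟩ := dif_neg h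

theorem of_zero [IsChain C] : of (zero : C) = 0 := of_of_ne IsChain.zero_ne_one

theorem int_of_nonneg [IsChain C] (x : C) : 0 ≤ (of x).int := by
  by_cases h : x = one
  · rw [h, of_one]; exact zero_le_one
  · rw [of_of_ne h]

theorem odot_one (x : C) : odot x one = x := by
  unfold odot
  rw [neg_one_eq, oplus_zero, neg_neg]

/-- What truncation cuts off from `x + y` is exactly `x ⊙ y`. This identity translates the
MV-operations into the group. -/
theorem of_add_of [IsChain C] (x y : C) : of x + of y = of (oplus x y) + of (odot x y) := by
  by_cases hx : x = one
  · rw [hx, one_oplus, odot_comm, odot_one]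
  by_cases hy : y = one
  · rw [hy, oplus_one, odot_one, add_comm]
  by_cases h : oplus x y = one
  · rw [h, of_one, of_of_ne hx, of_of_ne hy, of_of_ne (odot_ne_one hx), add_of_eq h,
      add_of_ne (by rw [zero_oplus]; exact odot_ne_one hx)]
    ext
    · rfl
    · exact (zero_oplus _).symm
  · rw [odot_comm, odot_eq_zero_of_oplus_ne_one h, of_zero, add_zero, of_of_ne h, of_of_ne hx,
      of_of_ne hy, add_of_ne h]
    rfl

theorem of_neg [IsChain C] (x : C) : of (neg x) = of one - of x := by
  have h := of_add_of x (neg x)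
  rw [oplus_neg_self, odot_comm, show odot (neg x) x = zero from diff_eq_zero_iff.2 (Le.refl _),
    of_zero, add_zero] at h
  rw [← h]
  abel

/-- The nonnegative elements of the group are those with nonnegative integral part, so this says
that nonzero elements of the chain are strictly positive. -/
theorem int_neg_of [IsChain C] {x : C} (h : x ≠ zero) : (-of x).int < 0 := by
  by_cases h' : x = one
  · rw [h', of_one, neg_of_eq rfl]; simp
  · rw [of_of_ne h', neg_of_ne h]; simp

theorem int_neg_nonneg [IsChain C] {p : ChainGroup C} (h : p.int < 0) : 0 ≤ (-p).int := by
  by_cases h' : p.frac = zero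
  · rw [neg_of_eq h']; simp only; omega
  · rw [neg_of_ne h']; simp only; omega

end ChainGroup

end ChainGroup

end MVAlgebra

/-! ### Truth values in the unit interval and Chang's completeness theorem -/

namespace MVAlgebra

theorem coe_oplus (a b : unitInterval) : ((oplus a b : unitInterval) : ℝ) = min 1 ((a : ℝ) + b) :=
  rfl

theorem coe_neg (a : unitInterval) : ((neg a : unitInterval) : ℝ) = 1 - a := rfl

theorem coe_one : ((one : unitInterval) : ℝ) = 1 := by
  change (1 : ℝ) - 0 = 1
  norm_num

theorem coe_odot (a b : unitInterval) :
    ((odot a b : unitInterval) : ℝ) = max 0 ((a : ℝ) + b - 1) := by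
  unfold odot
  rw [coe_neg, coe_oplus, coe_neg, coe_neg]
  rcases le_total 0 ((a : ℝ) + b - 1) with h | h
  · rw [max_eq_right h, min_eq_right (by linarith)]; ring
  · rw [max_eq_left h, min_eq_left (by linarith)]; ring

theorem coe_diff (a b : unitInterval) :
    ((diff a b : unitInterval) : ℝ) = max 0 ((a : ℝ) - b) := by
  unfold diff
  rw [coe_neg, coe_oplus, coe_neg]
  rcases le_total 0 ((a : ℝ) - b) with h | h
  · rw [max_eq_right h, min_eq_right (by linarith)]; ring
  · rw [max_eq_left h, min_eq_left (by linarith)]; ring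

theorem coe_sup (a b : unitInterval) : ((sup a b : unitInterval) : ℝ) = max (a : ℝ) b := by
  rw [sup_eq, coe_oplus, coe_diff]
  have := a.2.2
  have := b.2.2
  rcases le_total 0 ((a : ℝ) - b) with h | h
  · rw [max_eq_right h, max_eq_left (by linarith), min_eq_right (by linarith)]; ring
  · rw [max_eq_left h, max_eq_right (by linarith), min_eq_right (by linarith)]; ring

theorem coe_inf (a b : unitInterval) : ((inf a b : unitInterval) : ℝ) = min (a : ℝ) b := by
  unfold inf
  rw [coe_neg, coe_sup, coe_neg, coe_neg]
  rcases le_total (a : ℝ) b with h | h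
  · rw [max_eq_left (by linarith), min_eq_left h]; ring
  · rw [max_eq_right (by linarith), min_eq_right h]; ring

namespace Hom

variable {A B : Type*} [MVAlgebra A] [MVAlgebra B] (φ : Hom A B)

theorem map_one : φ.toFun one = one := by
  unfold one
  rw [φ.map_neg, φ.map_zero]

theorem map_diff (f g : A) : φ.toFun (diff f g) = diff (φ.toFun f) (φ.toFun g) := by
  unfold diff
  rw [φ.map_neg, φ.map_oplus, φ.map_neg]

theorem map_odot (f g : A) : φ.toFun (odot f g) = odot (φ.toFun f) (φ.toFun g) := by
  unfold odot
  rw [φ.map_neg, φ.map_oplus, φ.map_neg, φ.map_neg]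

theorem map_sup (f g : A) : φ.toFun (sup f g) = sup (φ.toFun f) (φ.toFun g) := by
  rw [sup_eq, sup_eq, φ.map_oplus, φ.map_diff]

theorem map_inf (f g : A) : φ.toFun (inf f g) = inf (φ.toFun f) (φ.toFun g) := by
  unfold inf
  rw [φ.map_neg, φ.map_sup, φ.map_neg, φ.map_neg]

theorem map_nfold (k : ℕ) (f : A) : φ.toFun (nfold k f) = nfold k (φ.toFun f) := by
  induction k with
  | zero => exact φ.map_zero
  | succ k ih =>
    change φ.toFun (oplus (nfold k f) f) = oplus (nfold k (φ.toFun f)) (φ.toFun f)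
    rw [φ.map_oplus, ih]

end Hom

section Completeness

variable {C : Type*} [MVAlgebra C] [IsChain C] {n : ℕ}

/-- The value of an integral combination of `1, v₁, …, vₙ` in the group of the chain. -/
noncomputable def combo (v : Fin n → C) : (Fin (n + 1) → ℤ) →+ ChainGroup C where
  toFun s := s 0 • ChainGroup.of one + ∑ i : Fin n, s i.succ • ChainGroup.of (v i)
  map_zero' := by simp
  map_add' s t := by
    simp only [Pi.add_apply, add_smul, Finset.sum_add_distrib]
    abel

/-- The combinations with nonnegative value. -/
noncomputable def nonnegCombos (v : Fin n → C) : AddSubmonoid (Fin (n + 1) → ℤ) where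
  carrier := {s | 0 ≤ (combo v s).int}
  zero_mem' := by
    simp only [Set.mem_ofPred_eq, map_zero]
    exact le_refl (0 : ℤ)
  add_mem' {s t} hs ht := by
    simp only [Set.mem_ofPred_eq, map_add] at hs ht ⊢
    exact (add_nonneg hs ht).trans (ChainGroup.int_add_le _ _)

theorem nonnegCombos_total (v : Fin n → C) (s : Fin (n + 1) → ℤ) :
    s ∈ nonnegCombos v ∨ -s ∈ nonnegCombos v := by
  rcases le_or_gt 0 (combo v s).int with h | h
  · exact Or.inl h
  · refine Or.inr ?_
    change 0 ≤ (combo v (-s)).int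
    rw [map_neg]
    exact ChainGroup.int_neg_nonneg h

theorem mem_nonnegCombos_of_eq {v : Fin n → C} {s : Fin (n + 1) → ℤ} {x : C}
    (h : combo v s = ChainGroup.of x) : s ∈ nonnegCombos v := by
  change 0 ≤ (combo v s).int
  rw [h]
  exact ChainGroup.int_of_nonneg x

theorem combo_single_zero (v : Fin n → C) :
    combo v (Pi.single 0 1) = ChainGroup.of one := by
  change (_ + _ : ChainGroup C) = _
  simp [Fin.succ_ne_zero]

theorem combo_single_succ (v : Fin n → C) (i : Fin n) :
    combo v (Pi.single i.succ 1) = ChainGroup.of (v i) := by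
  classical
  change (_ + _ : ChainGroup C) = _
  rw [Finset.sum_eq_single i]
  · simp [(Fin.succ_ne_zero i).symm]
  · intro j _ hj
    simp [hj]
  · simp

/-- The value of a linear form at a real vector. -/
noncomputable def linForm {k : ℕ} (φ : Fin k → ℝ) : (Fin k → ℤ) →+ ℝ where
  toFun s := ∑ i, (s i : ℝ) * φ i
  map_zero' := by simp
  map_add' s t := by simp [add_mul, Finset.sum_add_distrib]

theorem linForm_single {k : ℕ} (φ : Fin k → ℝ) (i : Fin k) : linForm φ (Pi.single i 1) = φ i := by
  change ∑ j, ((Pi.single i 1 : Fin k → ℤ) j : ℝ) * φ j = φ i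
  rw [Finset.sum_eq_single i]
  · simp
  · intro j _ hj
    simp [hj]
  · simp

/-- The value of a term at elements of a chain is an integral combination, and the same
combination gives its value at real numbers of the same order type. -/
theorem exists_combo_eval (v : Fin n → C) (t : MVTerm (Fin n)) :
    ∃ (S : Finset (Fin (n + 1) → ℤ)) (s : Fin (n + 1) → ℤ),
      combo v s = ChainGroup.of (t.eval v) ∧
      ∀ φ : Fin (n + 1) → ℝ, (∀ r ∈ S, r ∈ nonnegCombos v → 0 ≤ linForm φ r) → φ 0 = 1 →
        ∀ p : Fin n → unitInterval, (∀ i, (p i : ℝ) = φ i.succ) →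
          ((t.eval p : unitInterval) : ℝ) = linForm φ s := by
  classical
  induction t with
  | var i =>
    refine ⟨∅, Pi.single i.succ 1, combo_single_succ v i, fun φ _ _ p hp => ?_⟩
    rw [linForm_single]
    exact hp i
  | zero =>
    refine ⟨∅, 0, ?_, fun φ _ _ p hp => ?_⟩
    · rw [map_zero]; exact ChainGroup.of_zero.symm
    · rw [map_zero]; rfl
  | neg f ih =>
    obtain ⟨S, s, hs, h⟩ := ih
    refine ⟨S, Pi.single 0 1 - s, ?_, fun φ hφ h0 p hp => ?_⟩
    · rw [map_sub, combo_single_zero, hs]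
      exact (ChainGroup.of_neg _).symm
    · rw [map_sub, linForm_single, h0, ← h φ hφ h0 p hp]
      rfl
  | oplus f g ihf ihg =>
    obtain ⟨S, s, hs, h⟩ := ihf
    obtain ⟨S', s', hs', h'⟩ := ihg
    have key := ChainGroup.of_add_of (f.eval v) (g.eval v)
    -- The chain decides whether the sum is truncated. The form that is nonnegative for this reason
    -- is put into `S`, so that the real numbers truncate in the same way.
    by_cases h1 : oplus (f.eval v) (g.eval v) = one
    · refine ⟨insert (s + s' - Pi.single 0 1) (S ∪ S'), Pi.single 0 1, ?_,
        fun φ hφ h0 p hp => ?_⟩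
      · rw [combo_single_zero]
        exact congrArg _ h1.symm
      · have hN : s + s' - Pi.single 0 1 ∈ nonnegCombos v := by
          refine mem_nonnegCombos_of_eq (x := odot (f.eval v) (g.eval v)) ?_
          rw [map_sub, map_add, hs, hs', combo_single_zero, key, h1]
          abel
        have := hφ _ (Finset.mem_insert_self _ _) hN
        rw [map_sub, map_add, linForm_single, h0,
          ← h φ (fun r hr => hφ r (by simp [hr])) h0 p hp,
          ← h' φ (fun r hr => hφ r (by simp [hr])) h0 p hp] at this
        rw [linForm_single, h0]
        exact min_eq_left (by linarith)
    · refine ⟨insert (Pi.single 0 1 - (s + s')) (S ∪ S'), s + s', ?_, fun φ hφ h0 p hp => ?_⟩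
      · rw [map_add, hs, hs', key, odot_comm, odot_eq_zero_of_oplus_ne_one h1,
          ChainGroup.of_zero, add_zero]
        rfl
      · have hN : Pi.single 0 1 - (s + s') ∈ nonnegCombos v := by
          refine mem_nonnegCombos_of_eq (x := neg (oplus (f.eval v) (g.eval v))) ?_
          rw [map_sub, map_add, hs, hs', combo_single_zero, key, ChainGroup.of_neg, odot_comm,
            odot_eq_zero_of_oplus_ne_one h1, ChainGroup.of_zero, add_zero]
        have := hφ _ (Finset.mem_insert_self _ _) hN
        have e := h φ (fun r hr => hφ r (by simp [hr])) h0 p hp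
        have e' := h' φ (fun r hr => hφ r (by simp [hr])) h0 p hp
        rw [map_sub, map_add, linForm_single, h0, ← e, ← e'] at this
        rw [map_add, ← e, ← e']
        exact min_eq_right (by linarith)

/-- A term that does not vanish identically in a chain does not vanish identically in `[0,1]`. -/
theorem exists_eval_ne_zero (v : Fin n → C) (t : MVTerm (Fin n)) (ht : t.eval v ≠ zero) :
    ∃ p : Fin n → unitInterval, t.eval p ≠ zero := by
  classical
  obtain ⟨S, s, hs, h⟩ := exists_combo_eval v t
  -- Besides `S`, the finite set contains `-s` and `-1`, whose absence from the cone keeps the value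
  -- of the term and of the unit strictly positive, and the forms `vᵢ` and `1 - vᵢ`, which put the
  -- normalised point into the cube.
  obtain ⟨ψ, hψ⟩ := exists_real_functional (n + 1) (nonnegCombos v) (nonnegCombos_total v)
    (S ∪ ({-s, -Pi.single 0 1} ∪ (Finset.univ.image (fun i : Fin n => Pi.single i.succ 1) ∪
      Finset.univ.image (fun i : Fin n => Pi.single 0 1 - Pi.single i.succ 1))))
  have hψ' : ∀ r, r ∈ S ∪ ({-s, -Pi.single 0 1} ∪
      (Finset.univ.image (fun i : Fin n => Pi.single i.succ 1) ∪
      Finset.univ.image (fun i : Fin n => Pi.single 0 1 - Pi.single i.succ 1))) →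
      (r ∈ nonnegCombos v ↔ 0 ≤ linForm ψ r) := hψ
  have neg_notMem : ∀ (r : Fin (n + 1) → ℤ) (x : C), combo v r = ChainGroup.of x → x ≠ zero →
      -r ∉ nonnegCombos v := by
    intro r x hr hx hmem
    change 0 ≤ (combo v (-r)).int at hmem
    rw [map_neg, hr] at hmem
    exact absurd (ChainGroup.int_neg_of hx) (not_lt.2 hmem)
  have h0 : 0 < ψ 0 := by
    have := neg_notMem _ _ (combo_single_zero v) IsChain.zero_ne_one.symm
    rw [hψ' _ (by simp), map_neg, linForm_single] at this
    linarith
  have hs0 : 0 < linForm ψ s := by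
    have := neg_notMem _ _ hs ht
    rw [hψ' _ (by simp), map_neg] at this
    linarith
  have hi : ∀ i : Fin n, 0 ≤ ψ i.succ := by
    intro i
    have := mem_nonnegCombos_of_eq (combo_single_succ v i)
    rwa [hψ' _ (by simp), linForm_single] at this
  have hi' : ∀ i : Fin n, ψ i.succ ≤ ψ 0 := by
    intro i
    have : Pi.single 0 1 - Pi.single i.succ 1 ∈ nonnegCombos v := by
      refine mem_nonnegCombos_of_eq (x := neg (v i)) ?_
      rw [map_sub, combo_single_zero, combo_single_succ, ChainGroup.of_neg]
    rw [hψ' _ (by simp), map_sub, linForm_single, linForm_single] at this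
    linarith
  have hscale : ∀ r, linForm (fun i => ψ i / ψ 0) r = linForm ψ r / ψ 0 := by
    intro r
    change ∑ i, (r i : ℝ) * (ψ i / ψ 0) = (∑ i, (r i : ℝ) * ψ i) / ψ 0
    rw [Finset.sum_div]
    exact Finset.sum_congr rfl fun i _ => by ring
  refine ⟨fun i => ⟨ψ i.succ / ψ 0, div_nonneg (hi i) h0.le, (div_le_one h0).2 (hi' i)⟩,
    fun hz => ?_⟩
  have := h (fun i => ψ i / ψ 0) (fun r hr hrN => by
      rw [hscale]
      exact div_nonneg ((hψ' r (by simp [hr])).1 hrN) h0.le) (div_self h0.ne')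
    (fun i => ⟨ψ i.succ / ψ 0, div_nonneg (hi i) h0.le, (div_le_one h0).2 (hi' i)⟩)
    (fun i => rfl)
  rw [hz, hscale] at this
  have := div_pos hs0 h0
  have e : ((zero : unitInterval) : ℝ) = 0 := rfl
  linarith

end Completeness

end MVAlgebra

namespace FreeMV

open MVAlgebra

theorem exists_rho_ne_zero {n : ℕ} {f : FreeMV (Fin n)} (hf : f ≠ zero) :
    ∃ p, (rho n).toFun f p ≠ zero := by
  obtain ⟨C, hC, φ, htot, hφ⟩ := exists_chain_quotient hf
  have : IsChain C := ⟨htot, fun h => hφ (by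
    rw [← oplus_zero (φ.toFun f), h, oplus_one])⟩
  rw [eq_lift (fun i => φ.toFun (gen i)) φ (fun _ => rfl)] at hφ
  obtain ⟨t⟩ := f
  obtain ⟨p, hp⟩ := exists_eval_ne_zero _ t hφ
  refine ⟨p, fun h => hp ?_⟩
  rw [← h]
  clear h hp hφ hf
  induction t with
  | var i => rfl
  | zero => rfl
  | neg f ih => exact congrArg neg ih
  | oplus f g ihf ihg => exact congrArg₂ oplus ihf ihg

/-- Chang's completeness theorem: the free MV-algebra is an algebra of `[0,1]`-valued functions. -/
theorem rho_injective (n : ℕ) : Function.Injective (rho n).toFun := by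
  intro f g h
  have key : ∀ f g : FreeMV (Fin n), (rho n).toFun f = (rho n).toFun g → Le f g := by
    intro f g h
    rw [← diff_eq_zero_iff]
    by_contra hne
    obtain ⟨p, hp⟩ := exists_rho_ne_zero hne
    refine hp ?_
    rw [Hom.map_diff, h]
    exact congrFun (diff_eq_zero_iff.2 (Le.refl ((rho n).toFun g))) p
  exact (key f g h).antisymm (key g f h.symm)

end FreeMV

/-! ### Elements as functions on the cube; positivity of states -/

namespace FreeMV

open MVAlgebra

variable {n : ℕ}

@[elab_as_elim]
theorem induction {X : Type*} {P : FreeMV X → Prop} (f : FreeMV X) (gen : ∀ i, P (gen i))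
    (zero : P zero) (neg : ∀ f, P f → P (neg f))
    (oplus : ∀ f g, P f → P g → P (oplus f g)) : P f := by
  obtain ⟨t⟩ := f
  induction t with
  | var i => exact gen i
  | zero => exact zero
  | neg f ih => exact neg _ ih
  | oplus f g ihf ihg => exact oplus _ _ ihf ihg

/-- The real-valued function on the cube represented by an element of the free MV-algebra. -/
noncomputable def val (f : FreeMV (Fin n)) (x : Fin n → unitInterval) : ℝ := (rho n).toFun f x

theorem val_mem (f : FreeMV (Fin n)) (x : Fin n → unitInterval) : val f x ∈ Set.Icc (0 : ℝ) 1 :=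
  ((rho n).toFun f x).2

theorem val_nonneg (f : FreeMV (Fin n)) (x : Fin n → unitInterval) : 0 ≤ val f x := (val_mem f x).1

theorem val_le_one (f : FreeMV (Fin n)) (x : Fin n → unitInterval) : val f x ≤ 1 := (val_mem f x).2

theorem val_injective {f g : FreeMV (Fin n)} (h : ∀ x, val f x = val g x) : f = g :=
  rho_injective n (funext fun x => Subtype.ext (h x))

theorem continuous_val (f : FreeMV (Fin n)) : Continuous (val f) :=
  continuous_subtype_val.comp (continuous_rho n f)

theorem val_gen (i : Fin n) (x : Fin n → unitInterval) : val (gen i) x = x i := rfl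

theorem val_zero (x : Fin n → unitInterval) : val zero x = 0 := by
  unfold val
  rw [(rho n).map_zero]
  rfl

theorem val_one (x : Fin n → unitInterval) : val one x = 1 := by
  unfold val
  rw [(rho n).map_one]
  exact coe_one

theorem val_neg (f : FreeMV (Fin n)) (x : Fin n → unitInterval) : val (neg f) x = 1 - val f x := by
  unfold val
  rw [(rho n).map_neg]
  rfl

theorem val_oplus (f g : FreeMV (Fin n)) (x : Fin n → unitInterval) :
    val (oplus f g) x = min 1 (val f x + val g x) := by
  unfold val
  rw [(rho n).map_oplus]
  rfl

theorem val_odot (f g : FreeMV (Fin n)) (x : Fin n → unitInterval) :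
    val (odot f g) x = max 0 (val f x + val g x - 1) := by
  unfold val
  rw [(rho n).map_odot]
  exact coe_odot _ _

theorem val_diff (f g : FreeMV (Fin n)) (x : Fin n → unitInterval) :
    val (diff f g) x = max 0 (val f x - val g x) := by
  unfold val
  rw [(rho n).map_diff]
  exact coe_diff _ _

theorem val_sup (f g : FreeMV (Fin n)) (x : Fin n → unitInterval) :
    val (sup f g) x = max (val f x) (val g x) := by
  unfold val
  rw [(rho n).map_sup]
  exact coe_sup _ _

theorem val_inf (f g : FreeMV (Fin n)) (x : Fin n → unitInterval) :
    val (inf f g) x = min (val f x) (val g x) := by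
  unfold val
  rw [(rho n).map_inf]
  exact coe_inf _ _

theorem val_nfold (k : ℕ) (f : FreeMV (Fin n)) (x : Fin n → unitInterval) :
    val (nfold k f) x = min 1 (k * val f x) := by
  induction k with
  | zero => simp [nfold, val_zero]
  | succ k ih =>
    change val (oplus (nfold k f) f) x = _
    rw [val_oplus, ih]
    have := val_nonneg f x
    push_cast
    rcases le_total 1 (k * val f x) with h | h
    · rw [min_eq_left h, min_eq_left (by linarith), min_eq_left (by linarith)]
    · rw [min_eq_right h]
      congr 1
      ring

theorem eq_zero_iff_val {f : FreeMV (Fin n)} : f = zero ↔ ∀ x, val f x = 0 :=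
  ⟨fun h x => by rw [h, val_zero], fun h => val_injective fun x => by rw [h, val_zero]⟩

section State

variable {m : FreeMV (Fin n) → ℝ} (hm : IsState m)

include hm

/-- By completeness the hypothesis of additivity may be checked pointwise. -/
theorem state_oplus_of_le {f g : FreeMV (Fin n)} (h : ∀ x, val f x + val g x ≤ 1) :
    m (oplus f g) = m f + m g := by
  refine hm.map_oplus f g (eq_zero_iff_val.2 fun x => ?_)
  rw [val_neg, val_oplus, val_neg, val_neg, min_eq_left (by linarith [h x])]
  norm_num

theorem state_mono {f g : FreeMV (Fin n)} (h : ∀ x, val f x ≤ val g x) : m f ≤ m g := by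
  have e : g = oplus f (diff g f) := val_injective fun x => by
    rw [val_oplus, val_diff, max_eq_right (by linarith [h x])]
    rw [min_eq_right (by linarith [val_le_one g x])]
    ring
  rw [e, state_oplus_of_le hm fun x => by
    rw [val_diff, max_eq_right (by linarith [h x])]
    linarith [val_le_one g x]]
  linarith [(hm.mem_Icc (diff g f)).1]

/-- Split `g` into `f ⊙ g` and the rest: adding the rest to `f` already gives `f ⊕ g`, and without
truncation. -/
theorem state_oplus_add_odot (f g : FreeMV (Fin n)) :
    m (oplus f g) + m (odot f g) = m f + m g := by
  have e : oplus f g = oplus f (diff g (odot f g)) := val_injective fun x => by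
    have := val_mem f x
    have := val_mem g x
    rw [val_oplus, val_oplus, val_diff, val_odot]
    simp only [min_def, max_def, Set.mem_Icc] at *
    split_ifs <;> linarith
  have e' : g = oplus (diff g (odot f g)) (odot f g) := val_injective fun x => by
    have := val_mem f x
    have := val_mem g x
    rw [val_oplus, val_diff, val_odot]
    simp only [min_def, max_def, Set.mem_Icc] at *
    split_ifs <;> linarith
  have h1 : m (oplus f g) = m f + m (diff g (odot f g)) := by
    rw [e]
    refine state_oplus_of_le hm fun x => ?_
    have := val_mem f x
    have := val_mem g x
    rw [val_diff, val_odot]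
    simp only [max_def, Set.mem_Icc] at *
    split_ifs <;> linarith
  have h2 : m g = m (diff g (odot f g)) + m (odot f g) := by
    conv_lhs => rw [e']
    refine state_oplus_of_le hm fun x => ?_
    have := val_mem f x
    have := val_mem g x
    rw [val_diff, val_odot]
    simp only [max_def, Set.mem_Icc] at *
    split_ifs <;> linarith
  linarith

omit hm in
/-- The `k`-th layer of a finite sum: the truncation to `[0,1]` of the sum minus `k`. -/
def layer : List (FreeMV (Fin n)) → ℕ → FreeMV (Fin n)
  | [], _ => zero
  | f :: l, 0 => oplus (layer l 0) f
  | f :: l, k + 1 => oplus (layer l (k + 1)) (odot f (layer l k))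

omit hm in
theorem val_layer (l : List (FreeMV (Fin n))) (k : ℕ) (x : Fin n → unitInterval) :
    val (layer l k) x = max 0 (min 1 ((l.map fun f => val f x).sum - k)) := by
  induction l generalizing k with
  | nil =>
    simp only [layer, val_zero, List.map_nil, List.sum_nil, zero_sub]
    rw [max_eq_left]
    exact min_le_of_right_le (by simp)
  | cons f l ih =>
    have h0 : 0 ≤ (l.map fun f => val f x).sum :=
      List.sum_nonneg (by simpa using fun a _ => val_nonneg a x)
    have := val_mem f x
    cases k with
    | zero =>
      simp only [layer, val_oplus, ih, List.map_cons, List.sum_cons, Nat.cast_zero, sub_zero]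
      simp only [min_def, max_def, Set.mem_Icc] at *
      split_ifs <;> linarith
    | succ k =>
      simp only [layer, val_oplus, val_odot, ih, List.map_cons, List.sum_cons, Nat.cast_succ]
      generalize (l.map fun f => val f x).sum = z at *
      generalize hw : z - (k : ℝ) = w
      have e1 : z - ((k : ℝ) + 1) = w - 1 := by rw [← hw]; ring
      have e2 : val f x + z - ((k : ℝ) + 1) = val f x + w - 1 := by rw [← hw]; ring
      rw [e1, e2]
      simp only [min_def, max_def, Set.mem_Icc] at *
      split_ifs <;> linarith

/-- Adding `f` to the list changes layer `k + 1` by `f ⊙ layer l k`, with truncation loss `f ⊙ layer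
l (k + 1)`. The changes telescope to `m f` minus a last term, which vanishes since the sum has no
layer beyond its length. -/
theorem sum_state_layer (l : List (FreeMV (Fin n))) {N : ℕ} (hN : l.length ≤ N) :
    ∑ k ∈ Finset.range N, m (layer l k) = (l.map m).sum := by
  induction l generalizing N with
  | nil => simp [layer, hm.map_zero]
  | cons f l ih =>
    obtain ⟨N, rfl⟩ : ∃ M, N = M + 1 := ⟨N - 1, by simp at hN; omega⟩
    have hN' : l.length ≤ N := by simpa using hN
    have hstep : ∀ M, ∑ k ∈ Finset.range (M + 1), m (layer (f :: l) k) =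
        ∑ k ∈ Finset.range (M + 1), m (layer l k) + m f - m (odot f (layer l M)) := by
      intro M
      induction M with
      | zero =>
        simp only [Finset.range_one, Finset.sum_singleton, zero_add, layer]
        have h := state_oplus_add_odot hm (layer l 0) f
        rw [odot_comm] at h
        linarith
      | succ M ihM =>
        rw [Finset.sum_range_succ, ihM, Finset.sum_range_succ _ (M + 1)]
        have h := state_oplus_add_odot hm (layer l (M + 1)) (odot f (layer l M))
        have e : odot (layer l (M + 1)) (odot f (layer l M)) = odot f (layer l (M + 1)) := by
          refine val_injective fun x => ?_
          have := val_mem f x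
          rw [val_odot, val_odot, val_odot, val_layer, val_layer, Nat.cast_succ]
          generalize hw : (l.map fun f => val f x).sum - (M : ℝ) = w
          have e1 : (l.map fun f => val f x).sum - ((M : ℝ) + 1) = w - 1 := by rw [← hw]; ring
          rw [e1]
          simp only [min_def, max_def, Set.mem_Icc] at *
          split_ifs <;> linarith
        rw [e] at h
        simp only [layer]
        linarith
    rw [hstep, ih (hN'.trans N.le_succ)]
    have e : odot f (layer l N) = zero := eq_zero_iff_val.2 fun x => by
      have h1 : (l.map fun f => val f x).sum ≤ l.length := by
        have := List.sum_le_card_nsmul (l.map fun f => val f x) 1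
          (by simpa using fun a _ => val_le_one a x)
        simpa using this
      have h2 : (l.length : ℝ) ≤ N := by exact_mod_cast hN'
      rw [val_odot, val_layer, max_eq_left (min_le_of_right_le (by linarith))]
      exact max_eq_left (by linarith [val_le_one f x])
    rw [e, hm.map_zero, List.map_cons, List.sum_cons]
    ring

/-- Layers are monotone in the total sum, so an inequality between real sums, which need not be
represented, becomes inequalities between elements. -/
theorem sum_state_le (l l' : List (FreeMV (Fin n)))
    (h : ∀ x, (l.map fun f => val f x).sum ≤ (l'.map fun f => val f x).sum) :
    (l.map m).sum ≤ (l'.map m).sum := by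
  rw [← sum_state_layer hm l (le_max_left l.length l'.length),
    ← sum_state_layer hm l' (le_max_right l.length l'.length)]
  refine Finset.sum_le_sum fun k _ => state_mono hm fun x => ?_
  rw [val_layer, val_layer]
  exact max_le_max le_rfl (min_le_min le_rfl (by linarith [h x]))

/-- Positive and negative parts of the coefficients become repetitions in two lists. -/
theorem sum_state_nonneg_int (s : Finset (FreeMV (Fin n))) (c : FreeMV (Fin n) → ℤ)
    (h : ∀ x, 0 ≤ ∑ f ∈ s, c f * val f x) : 0 ≤ ∑ f ∈ s, c f * m f := by
  have hsum : ∀ (d : FreeMV (Fin n) → ℕ) (g : FreeMV (Fin n) → ℝ),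
      ((s.toList.flatMap fun f => List.replicate (d f) f).map g).sum = ∑ f ∈ s, d f * g f := by
    intro d g
    rw [← Finset.sum_map_toList]
    induction s.toList with
    | nil => simp
    | cons a l ih =>
      rw [List.flatMap_cons, List.map_append, List.sum_append, ih]
      simp
  have hc : ∀ (g : FreeMV (Fin n) → ℝ), ∑ f ∈ s, (c f : ℝ) * g f =
      ∑ f ∈ s, ((c f).toNat : ℝ) * g f - ∑ f ∈ s, ((-c f).toNat : ℝ) * g f := by
    intro g
    rw [← Finset.sum_sub_distrib]
    refine Finset.sum_congr rfl fun f _ => ?_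
    rw [← sub_mul]
    congr 1
    have : c f = ((c f).toNat : ℤ) - ((-c f).toNat : ℤ) := by omega
    exact_mod_cast congrArg (Int.cast : ℤ → ℝ) this
  have := sum_state_le hm (s.toList.flatMap fun f => List.replicate (-c f).toNat f)
    (s.toList.flatMap fun f => List.replicate (c f).toNat f) (fun x => by
      rw [hsum, hsum]
      linarith [h x, hc fun f => val f x])
  rw [hsum, hsum] at this
  linarith [hc m]

/-- Rounding `D * c` up to integers keeps the functions nonnegative and raises the value under `m`
by at most the number of terms; dividing by a large `D` removes this error. -/
theorem sum_state_nonneg (s : Finset (FreeMV (Fin n))) (c : FreeMV (Fin n) → ℝ)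
    (h : ∀ x, 0 ≤ ∑ f ∈ s, c f * val f x) : 0 ≤ ∑ f ∈ s, c f * m f := by
  have key : ∀ D : ℕ, 0 ≤ D * ∑ f ∈ s, c f * m f + s.card := by
    intro D
    have h1 : ∀ x, 0 ≤ ∑ f ∈ s, ((⌊D * c f⌋ + 1 : ℤ) : ℝ) * val f x := by
      intro x
      refine (mul_nonneg D.cast_nonneg (h x)).trans ?_
      rw [Finset.mul_sum]
      refine Finset.sum_le_sum fun f hf => ?_
      rw [← mul_assoc]
      refine mul_le_mul_of_nonneg_right ?_ (val_nonneg f x)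
      push_cast
      exact (Int.lt_floor_add_one _).le
    have h2 : ∑ f ∈ s, ((⌊D * c f⌋ + 1 : ℤ) : ℝ) * m f ≤ ∑ f ∈ s, (D * (c f * m f) + 1) := by
      refine Finset.sum_le_sum fun f hf => ?_
      push_cast
      have h4 := (hm.mem_Icc f).1
      have h5 := (hm.mem_Icc f).2
      have h6 := Int.floor_le (D * c f)
      nlinarith
    rw [Finset.sum_add_distrib, ← Finset.mul_sum] at h2
    simp only [Finset.sum_const, nsmul_eq_mul, mul_one] at h2
    exact (sum_state_nonneg_int hm _ _ h1).trans h2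
  by_contra! hneg
  obtain ⟨D, hD⟩ := exists_nat_gt ((s.card : ℝ) / -(∑ f ∈ s, c f * m f))
  rw [div_lt_iff₀ (by linarith)] at hD
  linarith [key D]

end State

end FreeMV

/-! ### Integral representation of states -/

namespace FreeMV

open MVAlgebra
open scoped CompactlySupported

variable {n : ℕ}

/-- The represented function as an element of the space of continuous functions on the cube. -/
noncomputable def valC (f : FreeMV (Fin n)) : C_c(Fin n → unitInterval, ℝ) where
  toFun := val f
  continuous_toFun := continuous_val f
  hasCompactSupport' := HasCompactSupport.of_compactSpace _

/-- A state is the integral with respect to a probability measure on the cube. -/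
theorem exists_measure_of_isState {m : FreeMV (Fin n) → ℝ} (hm : IsState m) :
    ∃ μ : Measure (Fin n → unitInterval), IsProbabilityMeasure μ ∧
      ∀ f, m f = ∫ x, val f x ∂μ := by
  let T : (FreeMV (Fin n) →₀ ℝ) →ₗ[ℝ] C_c(Fin n → unitInterval, ℝ) :=
    Finsupp.linearCombination ℝ valC
  let Λ₀ : (FreeMV (Fin n) →₀ ℝ) →ₗ[ℝ] ℝ := Finsupp.linearCombination ℝ m
  have hpos : ∀ c, (∀ x, 0 ≤ T c x) → 0 ≤ Λ₀ c := by
    intro c hc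
    refine sum_state_nonneg hm c.support c fun x => ?_
    refine (hc x).trans_eq ?_
    simp only [T, Finsupp.linearCombination_apply, Finsupp.sum]
    rw [CompactlySupportedContinuousMap.coe_sum, Finset.sum_apply]
    rfl
  -- Positivity for `c` and for `-c` shows that the value under `m` depends only on the represented
  -- function, so `m` descends to the span of these functions.
  have hker : LinearMap.ker T ≤ LinearMap.ker Λ₀ := by
    intro c hc
    rw [LinearMap.mem_ker] at hc ⊢
    have h1 := hpos c (fun x => by rw [hc]; exact le_rfl)
    have h2 := hpos (-c) (fun x => by rw [map_neg, hc, neg_zero]; exact le_rfl)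
    rw [map_neg] at h2
    linarith
  let Λ₁ : LinearMap.range T →ₗ[ℝ] ℝ :=
    ((LinearMap.ker T).liftQ Λ₀ hker).comp T.quotKerEquivRange.symm.toLinearMap
  have hΛ₁ : ∀ c, Λ₁ ⟨T c, LinearMap.mem_range_self T c⟩ = Λ₀ c := by
    intro c
    change (LinearMap.ker T).liftQ Λ₀ hker (T.quotKerEquivRange.symm _) = Λ₀ c
    rw [LinearMap.quotKerEquivRange_symm_apply_image]
    rfl
  let P : PointedCone ℝ C_c(Fin n → unitInterval, ℝ) :=
    { carrier := {g | ∀ x, 0 ≤ g x}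
      zero_mem' := fun _ => le_rfl
      add_mem' := fun ha hb x => add_nonneg (ha x) (hb x)
      smul_mem' := fun a g hg x => mul_nonneg a.2 (hg x) }
  -- The span contains the constants, which dominate every continuous function on the compact cube;
  -- so a positive functional on it extends.
  obtain ⟨Λ, hΛ, hΛpos⟩ := riesz_extension P ⟨LinearMap.range T, Λ₁⟩
    (by
      rintro ⟨_, c, rfl⟩ hy
      exact (hpos c hy).trans_eq (hΛ₁ c).symm) (fun y => by
      obtain ⟨B, hB⟩ := isCompact_univ.exists_bound_of_continuousOn y.continuous.continuousOn
      refine ⟨⟨T (Finsupp.single one B), LinearMap.mem_range_self _ _⟩, fun x => ?_⟩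
      change 0 ≤ T (Finsupp.single one B) x + y x
      have e : T (Finsupp.single one B) x = B := by
        simp only [T, Finsupp.linearCombination_single]
        change B * val one x = B
        rw [val_one, mul_one]
      rw [e]
      have : |y x| ≤ B := hB x trivial
      linarith [neg_abs_le (y x)])
  have hΛval : ∀ f, Λ (valC f) = m f := by
    intro f
    have e : T (Finsupp.single f 1) = valC f := by
      simp [T, Finsupp.linearCombination_single]
    have h := (hΛ ⟨_, LinearMap.mem_range_self T (Finsupp.single f 1)⟩).trans (hΛ₁ _)
    simpa [Λ₀, e, Finsupp.linearCombination_single] using h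
  let Λ' : C_c(Fin n → unitInterval, ℝ) →ₚ[ℝ] ℝ :=
    PositiveLinearMap.mk₀ Λ (fun g hg => hΛpos g hg)
  have hint : ∀ f, m f = ∫ x, val f x ∂(RealRMK.rieszMeasure Λ') := fun f =>
    (hΛval f).symm.trans (RealRMK.integral_rieszMeasure Λ' (valC f)).symm
  refine ⟨RealRMK.rieszMeasure Λ', ⟨?_⟩, hint⟩
  have h := hint one
  rw [hm.map_one] at h
  simp only [val_one, integral_const, smul_eq_mul, mul_one] at h
  exact (ENNReal.toReal_eq_one_iff _).1 h.symm

section Support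

variable (μ : Measure (Fin n → unitInterval)) [IsProbabilityMeasure μ]

theorem integrable_val (f : FreeMV (Fin n)) : Integrable (val f) μ :=
  (continuous_val f).integrable_of_hasCompactSupport (HasCompactSupport.of_compactSpace _)

/-- The set where the function represented by `f` is positive. -/
def posSet (f : FreeMV (Fin n)) : Set (Fin n → unitInterval) := {x | 0 < val f x}

theorem isOpen_posSet (f : FreeMV (Fin n)) : IsOpen (posSet f) :=
  isOpen_lt continuous_const (continuous_val f)

/-- The truncated multiples of `f` increase to the indicator of its positivity set. Thus (B2) says
that the positivity set of a weak unit has full measure, and `m` determines the measure of every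
positivity set. -/
theorem tendsto_integral_nfold (f : FreeMV (Fin n)) :
    Tendsto (fun k : ℕ => ∫ x, val (nfold k f) x ∂μ) atTop (𝓝 (μ.real (posSet f))) := by
  have e : μ.real (posSet f) = ∫ x, (posSet f).indicator 1 x ∂μ :=
    (integral_indicator_one (isOpen_posSet f).measurableSet).symm
  rw [e]
  refine tendsto_integral_of_dominated_convergence (fun _ => 1)
    (fun k => (continuous_val _).aestronglyMeasurable) (integrable_const _)
    (fun k => Eventually.of_forall fun x => ?_) (Eventually.of_forall fun x => ?_)
  · rw [Real.norm_eq_abs, abs_of_nonneg (val_nonneg _ _)]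
    exact val_le_one _ _
  · by_cases hx : 0 < val f x
    · rw [Set.indicator_of_mem (show x ∈ posSet f from hx)]
      refine tendsto_const_nhds.congr' ?_
      obtain ⟨K, hK⟩ := exists_nat_gt (1 / val f x)
      filter_upwards [eventually_ge_atTop K] with k hk
      rw [val_nfold, min_eq_left, Pi.one_apply]
      rw [div_lt_iff₀ hx] at hK
      have : (K : ℝ) ≤ k := by exact_mod_cast hk
      nlinarith
    · rw [Set.indicator_of_notMem (show x ∉ posSet f from hx)]
      have h0 : val f x = 0 := le_antisymm (not_lt.1 hx) (val_nonneg f x)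
      refine tendsto_const_nhds.congr fun k => ?_
      rw [val_nfold, h0, mul_zero, min_eq_right zero_le_one]

theorem isPiSystem_posSet : IsPiSystem (Set.range (posSet (n := n))) := by
  rintro _ ⟨f, rfl⟩ _ ⟨g, rfl⟩ -
  refine ⟨inf f g, ?_⟩
  ext x
  change 0 < val (inf f g) x ↔ 0 < val f x ∧ 0 < val g x
  rw [val_inf, lt_min_iff]

end Support

end FreeMV

/-! ### McNaughton functions and the maps dual to automorphisms -/

namespace FreeMV

open MVAlgebra

variable {n : ℕ}

/-- Bounded functions all of whose unit layers `min(1, max(0, F - k))` are represented by elements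
of the free MV-algebra. This is the lattice-ordered group of McNaughton functions. -/
structure IsMcNaughton (F : (Fin n → unitInterval) → ℝ) : Prop where
  bounded : ∃ N : ℕ, ∀ x, |F x| ≤ N
  layers : ∀ k : ℤ, ∃ e : FreeMV (Fin n), ∀ x, val e x = max 0 (min 1 (F x - k))

namespace IsMcNaughton

variable {F G : (Fin n → unitInterval) → ℝ}

theorem exists_val (hF : IsMcNaughton F) (h : ∀ x, F x ∈ Set.Icc (0 : ℝ) 1) :
    ∃ e : FreeMV (Fin n), ∀ x, val e x = F x := by
  obtain ⟨e, he⟩ := hF.layers 0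
  refine ⟨e, fun x => ?_⟩
  rw [he, Int.cast_zero, sub_zero, min_eq_right (h x).2, max_eq_right (h x).1]

theorem of_val (f : FreeMV (Fin n)) : IsMcNaughton (val f) where
  bounded := ⟨1, fun x => by
    rw [abs_of_nonneg (val_nonneg f x), Nat.cast_one]; exact val_le_one f x⟩
  layers k := by
    rcases lt_trichotomy k 0 with h | rfl | h
    · refine ⟨one, fun x => ?_⟩
      have h' : (k : ℝ) ≤ -1 := by exact_mod_cast (by omega : k ≤ -1)
      rw [val_one, min_eq_left (by linarith [val_nonneg f x]), max_eq_right zero_le_one]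
    · refine ⟨f, fun x => ?_⟩
      rw [Int.cast_zero, sub_zero, min_eq_right (val_le_one f x), max_eq_right (val_nonneg f x)]
    · refine ⟨zero, fun x => ?_⟩
      have h' : (1 : ℝ) ≤ k := by exact_mod_cast (by omega : 1 ≤ k)
      rw [val_zero, max_eq_left (min_le_of_right_le (by linarith [val_le_one f x]))]

theorem coord (i : Fin n) : IsMcNaughton fun x : Fin n → unitInterval => (x i : ℝ) :=
  of_val (gen i)

theorem congr (hF : IsMcNaughton F) (h : ∀ x, G x = F x) : IsMcNaughton G := by
  rwa [show G = F from funext h]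

theorem add_int (hF : IsMcNaughton F) (j : ℤ) : IsMcNaughton fun x => F x + j where
  bounded := by
    obtain ⟨N, hN⟩ := hF.bounded
    refine ⟨N + j.natAbs, fun x => (abs_add_le _ _).trans ?_⟩
    have : |(j : ℝ)| = j.natAbs := by rw [Nat.cast_natAbs, Int.cast_abs]
    push_cast [this]
    linarith [hN x]
  layers k := by
    obtain ⟨e, he⟩ := hF.layers (k - j)
    refine ⟨e, fun x => ?_⟩
    rw [he]
    push_cast
    congr 2
    ring

theorem neg (hF : IsMcNaughton F) : IsMcNaughton fun x => -F x where
  bounded := by simpa only [abs_neg] using hF.bounded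
  layers k := by
    -- Negation reverses the layers: truncating `-F - k` to the unit interval gives 1 minus the
    -- truncation of `F + k + 1`.
    obtain ⟨e, he⟩ := hF.layers (-k - 1)
    refine ⟨MVAlgebra.neg e, fun x => ?_⟩
    rw [val_neg, he]
    push_cast
    simp only [min_def, max_def]
    split_ifs <;> linarith

/-- Layer `k` of the sum is layer `k` of `F` together with the part of `h` that fits above it only
where layer `k - 1` is nearly full, namely `h ⊙` that layer. -/
theorem add_val (hF : IsMcNaughton F) (h : FreeMV (Fin n)) :
    IsMcNaughton fun x => F x + val h x where
  bounded := by
    obtain ⟨N, hN⟩ := hF.bounded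
    refine ⟨N + 1, fun x => (abs_add_le _ _).trans ?_⟩
    rw [abs_of_nonneg (val_nonneg h x)]
    push_cast
    linarith [hN x, val_le_one h x]
  layers k := by
    obtain ⟨e, he⟩ := hF.layers k
    obtain ⟨e', he'⟩ := hF.layers (k - 1)
    refine ⟨oplus e (odot h e'), fun x => ?_⟩
    have := val_mem h x
    rw [val_oplus, val_odot, he, he']
    generalize hw : F x - k = w
    have e1 : F x - ((k - 1 : ℤ) : ℝ) = w + 1 := by push_cast; linarith
    have e2 : F x + val h x - k = w + val h x := by linarith
    rw [e1, e2]
    simp only [min_def, max_def, Set.mem_Icc] at *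
    split_ifs <;> linarith

theorem sum_unit_layers {z : ℝ} (hz : 0 ≤ z) (M : ℕ) :
    ∑ i ∈ Finset.range M, max 0 (min 1 (z - i)) = min z M := by
  induction M with
  | zero => simp [hz]
  | succ M ih =>
    rw [Finset.sum_range_succ, ih]
    push_cast
    have : (0 : ℝ) ≤ M := M.cast_nonneg
    simp only [min_def, max_def]
    split_ifs <;> linarith

/-- After adding an integer bound, `G` is the finite sum of its unit layers, which are represented
and can be added to `F` one by one. -/
theorem add (hF : IsMcNaughton F) (hG : IsMcNaughton G) : IsMcNaughton fun x => F x + G x := by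
  obtain ⟨N, hN⟩ := hG.bounded
  choose e he using hG.layers
  have key : ∀ M : ℕ, IsMcNaughton fun x =>
      F x + ∑ i ∈ Finset.range M, val (e ((i : ℤ) - N)) x := by
    intro M
    induction M with
    | zero => simpa using hF
    | succ M ih =>
      refine (ih.add_val (e ((M : ℤ) - N))).congr fun x => ?_
      rw [Finset.sum_range_succ]
      ring
  refine ((key (N + N)).add_int (-N)).congr fun x => ?_
  have h := hN x
  rw [abs_le] at h
  have h2 : ∑ i ∈ Finset.range (N + N), val (e ((i : ℤ) - N)) x = G x + N := by
    have := sum_unit_layers (z := G x + N) (by linarith) (N + N)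
    rw [min_eq_left (by push_cast; linarith)] at this
    rw [← this]
    refine Finset.sum_congr rfl fun i _ => ?_
    rw [he]
    push_cast
    congr 2
    ring
  rw [h2]
  push_cast
  ring

theorem sub (hF : IsMcNaughton F) (hG : IsMcNaughton G) : IsMcNaughton fun x => F x - G x :=
  (hF.add hG.neg).congr fun _ => sub_eq_add_neg _ _

theorem int (j : ℤ) : IsMcNaughton fun _ : Fin n → unitInterval => (j : ℝ) :=
  ((of_val zero).add_int j).congr fun x => by rw [val_zero, zero_add]

theorem nat_mul (hF : IsMcNaughton F) (j : ℕ) : IsMcNaughton fun x => (j : ℝ) * F x := by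
  induction j with
  | zero => exact (int 0).congr fun x => by simp
  | succ j ih => exact (ih.add hF).congr fun x => by push_cast; ring

theorem int_mul (hF : IsMcNaughton F) (j : ℤ) : IsMcNaughton fun x => (j : ℝ) * F x := by
  obtain ⟨k, rfl | rfl⟩ := j.eq_nat_or_neg
  · exact hF.nat_mul k
  · exact (hF.nat_mul k).neg.congr fun x => by push_cast; ring

theorem sup (hF : IsMcNaughton F) (hG : IsMcNaughton G) :
    IsMcNaughton fun x => max (F x) (G x) where
  bounded := by
    obtain ⟨N, hN⟩ := hF.bounded
    obtain ⟨M, hM⟩ := hG.bounded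
    refine ⟨N + M, fun x => ?_⟩
    have h1 := (abs_nonneg _).trans (hN x)
    have h2 := (abs_nonneg _).trans (hM x)
    push_cast
    exact abs_max_le_max_abs_abs.trans (max_le (by linarith [hN x]) (by linarith [hM x]))
  layers k := by
    obtain ⟨e, he⟩ := hF.layers k
    obtain ⟨e', he'⟩ := hG.layers k
    refine ⟨MVAlgebra.sup e e', fun x => ?_⟩
    have hle : ∀ a b c : ℝ, a ≤ b → max 0 (min 1 (a - c)) ≤ max 0 (min 1 (b - c)) := fun a b c h =>
      max_le_max le_rfl (min_le_min le_rfl (by linarith))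
    rw [val_sup, he, he']
    rcases le_total (F x) (G x) with h | h
    · rw [max_eq_right h, max_eq_right (hle _ _ _ h)]
    · rw [max_eq_left h, max_eq_left (hle _ _ _ h)]

theorem inf (hF : IsMcNaughton F) (hG : IsMcNaughton G) :
    IsMcNaughton fun x => min (F x) (G x) :=
  (hF.neg.sup hG.neg).neg.congr fun x => by rw [max_neg_neg, _root_.neg_neg]

theorem abs (hF : IsMcNaughton F) : IsMcNaughton fun x => |F x| := hF.sup hF.neg

theorem sum {ι : Type*} (s : Finset ι) {F : ι → (Fin n → unitInterval) → ℝ}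
    (h : ∀ i ∈ s, IsMcNaughton (F i)) : IsMcNaughton fun x => ∑ i ∈ s, F i x := by
  classical
  induction s using Finset.induction_on with
  | empty => exact (int 0).congr fun x => by simp
  | insert a s ha ih =>
    refine ((h a (Finset.mem_insert_self a s)).add
      (ih fun i hi => h i (Finset.mem_insert_of_mem hi))).congr fun x => ?_
    rw [Finset.sum_insert ha]

/-- The set where a McNaughton function is positive is represented. -/
theorem exists_posSet (hF : IsMcNaughton F) :
    ∃ e : FreeMV (Fin n), posSet e = {x | 0 < F x} := by
  obtain ⟨e, he⟩ := hF.layers 0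
  refine ⟨e, Set.ext fun x => ?_⟩
  change 0 < val e x ↔ 0 < F x
  rw [he, Int.cast_zero, sub_zero]
  simp

end IsMcNaughton

section Invariance

/-- The self-map of the cube dual to an endomorphism. -/
noncomputable def pointMap (σ : Hom (FreeMV (Fin n)) (FreeMV (Fin n)))
    (x : Fin n → unitInterval) : Fin n → unitInterval :=
  fun i => (rho n).toFun (σ.toFun (gen i)) x

theorem val_hom (σ : Hom (FreeMV (Fin n)) (FreeMV (Fin n))) (f : FreeMV (Fin n))
    (x : Fin n → unitInterval) : val (σ.toFun f) x = val f (pointMap σ x) := by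
  induction f using FreeMV.induction with
  | gen i => rfl
  | zero => rw [σ.map_zero, val_zero, val_zero]
  | neg f ih => rw [σ.map_neg, val_neg, val_neg, ih]
  | oplus f g ihf ihg => rw [σ.map_oplus, val_oplus, val_oplus, ihf, ihg]

theorem continuous_pointMap (σ : Hom (FreeMV (Fin n)) (FreeMV (Fin n))) :
    Continuous (pointMap σ) := continuous_pi fun _ => continuous_rho n _

/-- The inverse of an automorphism. -/
theorem exists_inverse (σ : Aut (FreeMV (Fin n))) :
    ∃ τ : Aut (FreeMV (Fin n)), (∀ f, τ.toFun (σ.toFun f) = f) ∧ ∀ f, σ.toFun (τ.toFun f) = f := by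
  let E := Equiv.ofBijective σ.toFun σ.bijective
  have hE : ∀ f, σ.toFun (E.symm f) = f := E.apply_symm_apply
  refine ⟨⟨⟨E.symm, fun f g => σ.bijective.1 ?_, fun f => σ.bijective.1 ?_, σ.bijective.1 ?_⟩,
    E.symm.bijective⟩, E.symm_apply_apply, hE⟩
  · rw [σ.map_oplus, hE, hE, hE]
  · rw [σ.map_neg, hE, hE]
  · rw [σ.map_zero, hE]

theorem pointMap_comp {σ τ : Hom (FreeMV (Fin n)) (FreeMV (Fin n))}
    (h : ∀ f, τ.toFun (σ.toFun f) = f) (x : Fin n → unitInterval) :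
    pointMap σ (pointMap τ x) = x := by
  funext i
  apply Subtype.ext
  change val (σ.toFun (gen i)) (pointMap τ x) = x i
  rw [← val_hom, h]
  rfl

/-- A pair of mutually inverse self-maps of the cube with McNaughton coordinates comes from an
automorphism. -/
theorem exists_aut {G G' : (Fin n → unitInterval) → Fin n → unitInterval}
    (hG : ∀ i, IsMcNaughton fun x => (G x i : ℝ)) (hG' : ∀ i, IsMcNaughton fun x => (G' x i : ℝ))
    (h : ∀ x, G (G' x) = x) (h' : ∀ x, G' (G x) = x) :
    ∃ σ : Aut (FreeMV (Fin n)), pointMap σ.toHom = G := by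
  choose e he using fun i => (hG i).exists_val fun x => (G x i).2
  choose e' he' using fun i => (hG' i).exists_val fun x => (G' x i).2
  have hp : pointMap (lift e) = G := funext fun x => funext fun i => Subtype.ext (he i x)
  have hp' : pointMap (lift e') = G' := funext fun x => funext fun i => Subtype.ext (he' i x)
  refine ⟨⟨lift e, Function.bijective_iff_has_inverse.2 ⟨(lift e').toFun, fun f => ?_,
    fun f => ?_⟩⟩, hp⟩
  · refine val_injective fun x => ?_
    rw [val_hom, val_hom, hp, hp', h]
  · refine val_injective fun x => ?_
    rw [val_hom, val_hom, hp, hp', h']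

/-- The half-space where coordinate `i` exceeds a rational `q` is where `q.den * xᵢ - q.num` is
positive, and this function has integer coefficients. -/
theorem borel_eq_generateFrom_posSet :
    (inferInstance : MeasurableSpace (Fin n → unitInterval)) =
      MeasurableSpace.generateFrom (Set.range posSet) := by
  refine le_antisymm ?_ (MeasurableSpace.generateFrom_le ?_)
  · refine iSup_le fun i => ?_
    rw [← measurable_iff_comap_le]
    refine Measurable.subtype_mk (f := fun x : Fin n → unitInterval => (x i : ℝ)) ?_
    have hb : (inferInstance : MeasurableSpace ℝ) = _ := Real.borelSpace.measurable_eq.trans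
      Real.borel_eq_generateFrom_Ioi_rat
    refine @Measurable.mono _ _ _ _ _ _ _ (@measurable_generateFrom _ _
      (MeasurableSpace.generateFrom (Set.range posSet)) (⋃ a : ℚ, {Set.Ioi (a : ℝ)}) _ ?_)
      le_rfl hb.le
    intro t ht
    obtain ⟨q, rfl⟩ := Set.mem_iUnion.1 ht
    obtain ⟨e, he⟩ := (((IsMcNaughton.coord i).nat_mul q.den).add_int (-q.num)).exists_posSet
    have : (fun x : Fin n → unitInterval => (x i : ℝ)) ⁻¹' Set.Ioi (q : ℝ) = posSet e := by
      rw [he]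
      ext x
      change (q : ℝ) < x i ↔ 0 < (q.den : ℝ) * x i + ((-q.num : ℤ) : ℝ)
      have hd : (0 : ℝ) < q.den := by exact_mod_cast q.den_pos
      rw [Rat.cast_def, div_lt_iff₀ hd]
      push_cast
      constructor <;> intro h <;> linarith
    rw [this]
    exact MeasurableSpace.measurableSet_generateFrom ⟨e, rfl⟩
  · rintro _ ⟨f, rfl⟩
    exact (isOpen_posSet f).measurableSet

/-- The measure of a positivity set is the limit of `m` at multiples, which the automorphism
preserves, and the positivity sets form a generating π-system. -/
theorem measurePreserving_pointMap {m : FreeMV (Fin n) → ℝ} (hm : IsAutInvariant m)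
    (μ : Measure (Fin n → unitInterval)) [IsProbabilityMeasure μ]
    (hμ : ∀ f, m f = ∫ x, val f x ∂μ) (σ : Aut (FreeMV (Fin n))) :
    MeasurePreserving (pointMap σ.toHom) μ μ := by
  have hmeas := (continuous_pointMap σ.toHom).measurable
  refine ⟨hmeas, ?_⟩
  have := Measure.isProbabilityMeasure_map (μ := μ) hmeas.aemeasurable
  refine ext_of_generate_finite _ borel_eq_generateFrom_posSet isPiSystem_posSet ?_ (by simp)
  rintro _ ⟨f, rfl⟩
  rw [Measure.map_apply hmeas (isOpen_posSet f).measurableSet]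
  have e : pointMap σ.toHom ⁻¹' posSet f = posSet (σ.toFun f) := by
    ext x
    change 0 < val f (pointMap σ.toHom x) ↔ 0 < val (σ.toFun f) x
    rw [val_hom]
  rw [e, ← ENNReal.toReal_eq_toReal_iff' (measure_ne_top _ _) (measure_ne_top _ _)]
  refine tendsto_nhds_unique (tendsto_integral_nfold μ (σ.toFun f)) ?_
  refine (tendsto_integral_nfold μ f).congr fun k => ?_
  rw [← hμ, ← hμ, ← hm σ, σ.map_nfold]

theorem isWeakUnit_of_dense {f : FreeMV (Fin n)} (h : Dense (posSet f)) : IsWeakUnit f := by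
  intro g hg
  have h0 : ∀ x ∈ posSet f, val g x = 0 := by
    intro x hx
    have := eq_zero_iff_val.1 hg x
    rw [val_inf] at this
    rcases min_choice (val f x) (val g x) with e | e
    · exact absurd (e.symm.trans this) (ne_of_gt hx)
    · exact e.symm.trans this
  refine eq_zero_iff_val.2 fun x => ?_
  exact congrFun ((continuous_val g).ext_on h continuous_const h0) x

/-- Thin zero sets are null. -/
theorem measure_eq_zero_of_isMcNaughton {m : FreeMV (Fin n) → ℝ} (hm : TendsToOneOnWeakUnits m)
    (μ : Measure (Fin n → unitInterval)) [IsProbabilityMeasure μ]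
    (hμ : ∀ f, m f = ∫ x, val f x ∂μ) {F : (Fin n → unitInterval) → ℝ} (hF : IsMcNaughton F)
    (hd : Dense {x | F x ≠ 0}) : μ {x | F x = 0} = 0 := by
  obtain ⟨e, he⟩ := hF.abs.exists_posSet
  have he' : posSet e = {x | F x ≠ 0} := by
    rw [he]; ext x; exact (abs_pos : 0 < |F x| ↔ F x ≠ 0)
  have h1 := hm e (isWeakUnit_of_dense (by rwa [he']))
  simp only [hμ] at h1
  have h2 := tendsto_nhds_unique (tendsto_integral_nfold μ e) h1
  have h3 : μ (posSet e) = 1 := (ENNReal.toReal_eq_one_iff _).1 h2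
  have h4 := (prob_compl_eq_zero_iff (isOpen_posSet e).measurableSet).2 h3
  rw [he'] at h4
  convert h4 using 2
  ext x
  simp

end Invariance

end FreeMV

/-! ### Automorphisms preserve Lebesgue measure -/

namespace FreeMV

open MVAlgebra

variable {n : ℕ}

section Volume

/-- The inclusion of the cube into Euclidean space. -/
def cubeCoe (x : Fin n → unitInterval) : Fin n → ℝ := fun i => x i

theorem measurableEmbedding_cubeCoe : MeasurableEmbedding (cubeCoe (n := n)) :=
  (continuous_pi fun i => continuous_subtype_val.comp (continuous_apply i)).measurableEmbedding
    fun _ _ h => funext fun i => Subtype.ext (congrFun h i)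

theorem volume_image_cubeCoe (B : Set (Fin n → unitInterval)) :
    volume (cubeCoe '' B) = volume B := by
  have h1 : MeasurePreserving (cubeCoe (n := n)) volume
      (Measure.pi fun _ => (volume : Measure ℝ).restrict (Set.Icc 0 1)) :=
    measurePreserving_pi _ _ fun _ => measurePreserving_subtype_coe measurableSet_Icc
  rw [← Measure.restrict_pi_pi] at h1
  have h2 := h1.measure_preimage_emb measurableEmbedding_cubeCoe (cubeCoe '' B)
  rw [measurableEmbedding_cubeCoe.injective.preimage_image, Measure.restrict_eq_self] at h2
  · exact h2.symm
  · rintro _ ⟨x, -, rfl⟩ i -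
    exact (x i).2

theorem volume_affine_eq_zero {a : Fin n → ℝ} (ha : a ≠ 0) (b : ℝ) :
    volume {x : Fin n → unitInterval | ∑ i, a i * x i = b} = 0 := by
  let L : (Fin n → ℝ) →ₗ[ℝ] ℝ := ∑ i, a i • LinearMap.proj i
  have hL : ∀ y, L y = ∑ i, a i * y i := fun y => by simp [L]
  rw [← volume_image_cubeCoe]
  rcases Set.eq_empty_or_nonempty {x : Fin n → unitInterval | ∑ i, a i * x i = b} with h | ⟨x₀, h₀⟩
  · rw [h, Set.image_empty, measure_empty]
  refine measure_mono_null (t := (fun y => y - cubeCoe x₀) ⁻¹' (LinearMap.ker L : Set _)) ?_ ?_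
  · rintro _ ⟨x, hx, rfl⟩
    change L (cubeCoe x - cubeCoe x₀) = 0
    rw [map_sub, hL, hL, sub_eq_zero]
    exact Eq.trans hx (Eq.symm h₀)
  · simp only [sub_eq_add_neg]
    rw [measure_preimage_add_right]
    refine Measure.addHaar_submodule _ _ fun htop => ha ?_
    classical
    funext i
    have : Pi.single i 1 ∈ LinearMap.ker L := htop ▸ Submodule.mem_top
    rw [LinearMap.mem_ker, hL] at this
    simpa [Pi.single_apply] using this

/-- The represented functions are piecewise affine with integer coefficients. -/
theorem exists_affine_pieces (f : FreeMV (Fin n)) :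
    ∃ s : Finset ((Fin n → ℤ) × ℤ), ∀ x : Fin n → unitInterval, ∃ p ∈ s,
      val f x = ∑ i, (p.1 i : ℝ) * x i + p.2 := by
  classical
  induction f using FreeMV.induction with
  | gen i =>
    refine ⟨{(Pi.single i 1, 0)}, fun x => ⟨_, Finset.mem_singleton_self _, ?_⟩⟩
    simp only [Pi.single_apply, Int.cast_ite, Int.cast_one, Int.cast_zero, ite_mul, one_mul,
      zero_mul, Finset.sum_ite_eq', Finset.mem_univ, if_true, add_zero, val_gen]
  | zero =>
    refine ⟨{0}, fun x => ⟨_, Finset.mem_singleton_self _, ?_⟩⟩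
    simpa using val_zero x
  | neg f ih =>
    obtain ⟨s, hs⟩ := ih
    refine ⟨s.image fun p => (-p.1, 1 - p.2), fun x => ?_⟩
    obtain ⟨p, hp, h⟩ := hs x
    refine ⟨_, Finset.mem_image_of_mem _ hp, ?_⟩
    rw [val_neg, h]
    simp only [Pi.neg_apply, Int.cast_neg, neg_mul, Finset.sum_neg_distrib, Int.cast_sub,
      Int.cast_one]
    ring
  | oplus f g ihf ihg =>
    obtain ⟨s, hs⟩ := ihf
    obtain ⟨s', hs'⟩ := ihg
    refine ⟨insert (0, 1) ((s ×ˢ s').image fun p => p.1 + p.2), fun x => ?_⟩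
    obtain ⟨p, hp, h⟩ := hs x
    obtain ⟨p', hp', h'⟩ := hs' x
    rw [val_oplus]
    rcases le_total 1 (val f x + val g x) with hle | hle
    · refine ⟨(0, 1), Finset.mem_insert_self _ _, ?_⟩
      rw [min_eq_left hle]
      simp
    · refine ⟨p + p', Finset.mem_insert_of_mem (Finset.mem_image_of_mem _
        (Finset.mem_product.2 ⟨hp, hp'⟩ : (p, p') ∈ s ×ˢ s')), ?_⟩
      rw [min_eq_right hle, h, h']
      simp only [Prod.fst_add, Prod.snd_add, Pi.add_apply, Int.cast_add, add_mul,
        Finset.sum_add_distrib]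
      ring

/-- The set on which a self-map of the cube agrees with a given integral affine map. -/
def affineRegion (S : (Fin n → unitInterval) → Fin n → unitInterval)
    (p : Fin n → (Fin n → ℤ) × ℤ) : Set (Fin n → unitInterval) :=
  {x | ∀ i, (S x i : ℝ) = ∑ j, ((p i).1 j : ℝ) * x j + (p i).2}

/-- The matrix of the linear part of an integral affine map. -/
def linearPart (p : Fin n → (Fin n → ℤ) × ℤ) : Matrix (Fin n) (Fin n) ℤ :=
  Matrix.of fun i j => (p i).1 j

theorem volume_image_of_subset_affineRegion
    {S : (Fin n → unitInterval) → Fin n → unitInterval} {p : Fin n → (Fin n → ℤ) × ℤ}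
    {B : Set (Fin n → unitInterval)} (hB : B ⊆ affineRegion S p) :
    volume (S '' B) = ENNReal.ofReal |((linearPart p).det : ℝ)| * volume B := by
  let M : Matrix (Fin n) (Fin n) ℝ := (linearPart p).map (Int.cast : ℤ → ℝ)
  have e : cubeCoe '' (S '' B) =
      (fun y => y + fun i => ((p i).2 : ℝ)) '' (Matrix.toLin' M '' (cubeCoe '' B)) := by
    rw [Set.image_image, Set.image_image, Set.image_image]
    refine Set.image_congr fun x hx => funext fun i => ?_
    exact hB hx i
  rw [← volume_image_cubeCoe, e, Set.image_add_right, measure_preimage_add_right,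
    Measure.addHaar_image_linearMap, LinearMap.det_toLin', volume_image_cubeCoe]
  congr 3
  exact ((Int.castRingHom ℝ).map_det (linearPart p)).symm

/-- Automorphisms act by measure-preserving maps. -/
theorem measurePreserving_pointMap_volume (σ : Aut (FreeMV (Fin n))) :
    MeasurePreserving (pointMap σ.toHom) (volume : Measure (Fin n → unitInterval)) volume := by
  classical
  have cover : ∀ σ : Aut (FreeMV (Fin n)), ∃ P : Finset (Fin n → (Fin n → ℤ) × ℤ),
      ∀ x, ∃ p ∈ P, x ∈ affineRegion (pointMap σ.toHom) p := by
    intro σ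
    choose s hs using fun i => exists_affine_pieces (σ.toFun (gen i))
    refine ⟨Fintype.piFinset s, fun x => ?_⟩
    choose p hp h using fun i => hs i x
    exact ⟨p, Fintype.mem_piFinset.2 hp, h⟩
  have measRegion : ∀ (σ : Aut (FreeMV (Fin n))) p,
      MeasurableSet (affineRegion (pointMap σ.toHom) p) := by
    intro σ p
    have : affineRegion (pointMap σ.toHom) p = ⋂ i, {x | (pointMap σ.toHom x i : ℝ) =
        ∑ j, ((p i).1 j : ℝ) * x j + (p i).2} := by
      ext x; simp [affineRegion]
    rw [this]
    refine MeasurableSet.iInter fun i => (isClosed_eq ?_ ?_).measurableSet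
    · exact continuous_subtype_val.comp ((continuous_apply i).comp (continuous_pointMap _))
    · fun_prop
  have null_image : ∀ (σ : Aut (FreeMV (Fin n))) (B : Set (Fin n → unitInterval)),
      volume B = 0 → volume (pointMap σ.toHom '' B) = 0 := by
    intro σ B hB
    obtain ⟨P, hP⟩ := cover σ
    refine measure_mono_null (t := ⋃ p ∈ P, pointMap σ.toHom ''
      (B ∩ affineRegion (pointMap σ.toHom) p)) ?_ ?_
    · rintro _ ⟨x, hx, rfl⟩
      obtain ⟨p, hp, hxp⟩ := hP x
      exact Set.mem_biUnion hp ⟨x, ⟨hx, hxp⟩, rfl⟩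
    · refine (measure_biUnion_null_iff P.countable_toSet).2 fun p _ => ?_
      rw [volume_image_of_subset_affineRegion Set.inter_subset_right,
        measure_mono_null Set.inter_subset_left hB, mul_zero]
  obtain ⟨τ, hτσ, hστ⟩ := exists_inverse σ
  set S := pointMap τ.toHom with hS
  set T := pointMap σ.toHom with hT
  have hTS : ∀ x, T (S x) = x := pointMap_comp hτσ
  have hST : ∀ x, S (T x) = x := pointMap_comp hστ
  have himg : ∀ B, S '' B = T ⁻¹' B := fun B =>
    congrFun (Set.image_eq_preimage_of_inverse hTS hST) B
  have hTm : Measurable T := (continuous_pointMap σ.toHom).measurable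
  obtain ⟨P, hP⟩ := cover τ
  -- On a piece with nonzero determinant the inverse map `S` multiplies volume by a positive
  -- integer, so it does not shrink sets.
  have large : ∀ s : Finset (Fin n → (Fin n → ℤ) × ℤ), (∀ p ∈ s, (linearPart p).det ≠ 0) →
      ∀ B, MeasurableSet B → B ⊆ ⋃ p ∈ s, affineRegion S p → volume B ≤ volume (S '' B) := by
    intro s
    induction s using Finset.induction_on with
    | empty =>
      intro _ B _ hB
      simp only [Finset.notMem_empty, Set.iUnion_of_empty, Set.iUnion_empty,
        Set.subset_empty_iff] at hB
      simp [hB]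
    | insert p s _ ih =>
      intro hdet B hB hcov
      have hr : MeasurableSet (affineRegion S p) := measRegion τ p
      have h1 : volume (B ∩ affineRegion S p) ≤ volume (S '' (B ∩ affineRegion S p)) := by
        rw [volume_image_of_subset_affineRegion Set.inter_subset_right]
        refine le_mul_of_one_le_left' ?_
        rw [ENNReal.one_le_ofReal]
        exact_mod_cast Int.one_le_abs (hdet p (Finset.mem_insert_self p s))
      have h2 : volume (B \ affineRegion S p) ≤ volume (S '' (B \ affineRegion S p)) := by
        refine ih (fun q hq => hdet q (Finset.mem_insert_of_mem hq)) _ (hB.diff hr) ?_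
        rintro x ⟨hx, hxp⟩
        obtain ⟨q, hq, hxq⟩ := Set.mem_iUnion₂.1 (hcov hx)
        rcases Finset.mem_insert.1 hq with rfl | hq
        · exact absurd hxq hxp
        · exact Set.mem_biUnion hq hxq
      calc volume B = volume (B ∩ affineRegion S p) + volume (B \ affineRegion S p) :=
            (measure_inter_add_sdiff B hr).symm
        _ ≤ volume (S '' (B ∩ affineRegion S p)) + volume (S '' (B \ affineRegion S p)) :=
            add_le_add h1 h2
        _ = volume (S '' B) := by
            rw [himg, himg, himg, Set.preimage_inter, Set.preimage_sdiff]
            exact measure_inter_add_sdiff _ (hTm hr)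
  have hle : (volume : Measure (Fin n → unitInterval)) ≤ volume.map T := by
    refine Measure.le_iff.2 fun B hB => ?_
    rw [Measure.map_apply hTm hB, ← himg]
    set N : Set (Fin n → unitInterval) :=
      ⋃ p ∈ P.filter (fun p => (linearPart p).det = 0), affineRegion S p with hN
    have hNm : MeasurableSet N :=
      Finset.measurableSet_biUnion _ fun p _ => measRegion τ p
    have hSN : volume (S '' N) = 0 := by
      rw [hN, Set.image_iUnion₂]
      refine (measure_biUnion_null_iff (Finset.countable_toSet _)).2 fun p hp => ?_
      rw [volume_image_of_subset_affineRegion le_rfl, (Finset.mem_filter.1 hp).2]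
      simp
    -- The degenerate pieces have null image under `S`, and `T`, which is piecewise affine as well,
    -- carries null sets to null sets and brings this image back.
    have hN0 : volume N = 0 := by
      have := null_image σ _ hSN
      rw [Set.image_image] at this
      rwa [Set.image_congr (fun x _ => hTS x), Set.image_id'] at this
    calc volume B ≤ volume (B ∩ N) + volume (B \ N) := (measure_inter_add_sdiff B hNm).symm.le
      _ = volume (B \ N) := by rw [measure_mono_null Set.inter_subset_right hN0, zero_add]
      _ ≤ volume (S '' (B \ N)) := by
          refine large (P.filter fun p => (linearPart p).det ≠ 0)
            (fun p hp => (Finset.mem_filter.1 hp).2) _ (hB.diff hNm) ?_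
          rintro x ⟨-, hx⟩
          obtain ⟨p, hp, hxp⟩ := hP x
          refine Set.mem_biUnion (Finset.mem_filter.2 ⟨hp, fun h0 => hx ?_⟩) hxp
          exact Set.mem_biUnion (Finset.mem_filter.2 ⟨hp, h0⟩) hxp
      _ ≤ volume (S '' B) := measure_mono (Set.image_mono Set.sdiff_subset)
  -- An inequality between finite measures of equal total mass is an equality.
  refine ⟨hTm, (Measure.eq_of_le_of_measure_univ_eq hle ?_).symm⟩
  rw [Measure.map_apply hTm MeasurableSet.univ, Set.preimage_univ]

end Volume

/-! ### The average satisfies both conditions -/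

section Average

theorem average_eq (f : FreeMV (Fin n)) : average n f = ∫ x, val f x := rfl

theorem isState_average : IsState (average n) where
  mem_Icc f := by
    constructor
    · exact integral_nonneg (val_nonneg f)
    · refine (integral_mono (integrable_val volume f) (integrable_const 1) (val_le_one f)).trans ?_
      simp
  map_zero := by simp [average_eq, val_zero]
  map_one := by simp [average_eq, val_one]
  map_oplus f g h := by
    simp only [average_eq]
    rw [← integral_add (integrable_val volume f) (integrable_val volume g)]
    refine integral_congr_ae (Eventually.of_forall fun x => ?_)
    have := val_odot f g x
    rw [show odot f g = zero from h, val_zero] at this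
    have h2 := le_max_right 0 (val f x + val g x - 1)
    simp only [val_oplus]
    exact min_eq_right (by linarith)

theorem isAutInvariant_average : IsAutInvariant (average n) := by
  intro σ f
  simp only [average_eq, val_hom]
  have h := measurePreserving_pointMap_volume σ
  rw [← integral_map h.measurable.aemeasurable (by
    rw [h.map_eq]; exact (continuous_val f).aestronglyMeasurable), h.map_eq]

/-- Every neighbourhood contains the positivity set of an element that is positive at the point. -/
theorem exists_posSet_subset {O : Set (Fin n → unitInterval)} (hO : IsOpen O)
    {x : Fin n → unitInterval} (hx : x ∈ O) : ∃ e : FreeMV (Fin n), x ∈ posSet e ∧ posSet e ⊆ O := by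
  obtain ⟨r, hr, hball⟩ := Metric.isOpen_iff.1 hO x hx
  obtain ⟨N, hN⟩ := exists_nat_gt (((n : ℝ) + 2) / r)
  have hN0 : (0 : ℝ) < N := lt_of_le_of_lt (by positivity) hN
  rw [div_lt_iff₀ hr] at hN
  -- The function `n + 1 - ∑ |N yᵢ - ⌊N xᵢ⌋|` is at least 1 at `x`, since each summand is at most 1
  -- there. Where it is positive each summand is below `n + 1`, so `|yᵢ - xᵢ|` is below `(n + 2) /
  -- N`, hence below `r`.
  obtain ⟨e, he⟩ := ((IsMcNaughton.int (n := n) (n + 1)).sub (IsMcNaughton.sum Finset.univ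
    (F := fun i y => |(N : ℝ) * (y i : ℝ) + ((-⌊(N : ℝ) * (x i : ℝ)⌋ : ℤ) : ℝ)|)
    fun i _ => (((IsMcNaughton.coord i).nat_mul N).add_int _).abs)).exists_posSet
  have habs : ∀ i, |(N : ℝ) * (x i : ℝ) + ((-⌊(N : ℝ) * (x i : ℝ)⌋ : ℤ) : ℝ)| ≤ 1 := by
    intro i
    have h1 := Int.floor_le ((N : ℝ) * (x i : ℝ))
    have h2 := Int.lt_floor_add_one ((N : ℝ) * (x i : ℝ))
    rw [abs_le]
    push_cast
    constructor <;> linarith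
  refine ⟨e, ?_, fun y hy => hball ?_⟩
  · rw [he]
    rw [Set.mem_ofPred_eq]
    have : ∑ i, |(N : ℝ) * (x i : ℝ) + ((-⌊(N : ℝ) * (x i : ℝ)⌋ : ℤ) : ℝ)| ≤ n :=
      (Finset.sum_le_sum fun i _ => habs i).trans (by simp)
    push_cast at this ⊢
    linarith
  · rw [he] at hy
    have hy' : (0 : ℝ) < ((n + 1 : ℤ) : ℝ) -
      ∑ i, |(N : ℝ) * (y i : ℝ) + ((-⌊(N : ℝ) * (x i : ℝ)⌋ : ℤ) : ℝ)| := hy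
    rw [Metric.mem_ball, dist_pi_lt_iff hr]
    intro i
    have h1 := Finset.single_le_sum (f := fun i =>
      |(N : ℝ) * (y i : ℝ) + ((-⌊(N : ℝ) * (x i : ℝ)⌋ : ℤ) : ℝ)|)
      (fun j _ => abs_nonneg _) (Finset.mem_univ i)
    have h2 := habs i
    simp only [abs_le] at h2
    have h3 : |(N : ℝ) * (y i : ℝ) + ((-⌊(N : ℝ) * (x i : ℝ)⌋ : ℤ) : ℝ)| < n + 1 := by
      push_cast at hy' h1 ⊢
      linarith
    rw [abs_lt] at h3
    rw [Subtype.dist_eq, Real.dist_eq, abs_lt]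
    constructor <;> nlinarith

/-- Off the closed sets `N` and `Q` only the zero piece can represent `f`, so `f` vanishes on an
open set; a weak unit cannot vanish on a nonempty one. Hence every zero of `f` is a zero of a
nonzero affine piece, and such a piece is not constant. -/
theorem volume_posSet_of_isWeakUnit {f : FreeMV (Fin n)} (hf : IsWeakUnit f) :
    volume (posSet f)ᶜ = 0 := by
  obtain ⟨s, hs⟩ := exists_affine_pieces f
  set N : Set (Fin n → unitInterval) :=
    ⋃ p ∈ s.filter (fun p => p.1 ≠ 0), {x | ∑ i, (p.1 i : ℝ) * x i = -p.2} with hN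
  have hNclosed : IsClosed N := by
    refine Set.Finite.isClosed_biUnion (Finset.finite_toSet _) fun p _ => isClosed_eq ?_ ?_ <;>
    fun_prop
  have hN0 : volume N = 0 := by
    refine (measure_biUnion_null_iff (Finset.countable_toSet _)).2 fun p hp => ?_
    refine volume_affine_eq_zero (a := fun i => (p.1 i : ℝ)) (fun h => ?_) _
    refine (Finset.mem_filter.1 hp).2 (funext fun i => ?_)
    have hi : (p.1 i : ℝ) = 0 := congrFun h i
    exact_mod_cast hi
  set Q : Set (Fin n → unitInterval) :=
    ⋃ p ∈ s.filter (fun p => p ≠ 0), {x | val f x = ∑ i, (p.1 i : ℝ) * x i + p.2} with hQ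
  have hQclosed : IsClosed Q := by
    refine Set.Finite.isClosed_biUnion (Finset.finite_toSet _) fun p _ =>
      isClosed_eq (continuous_val f) ?_
    fun_prop
  have hsub : (N ∪ Q)ᶜ ⊆ (posSet f)ᶜ := by
    intro x hx hpos
    obtain ⟨p, hp, h⟩ := hs x
    have hp0 : p ≠ 0 := by
      rintro rfl
      have hpos' : 0 < val f x := hpos
      rw [h] at hpos'
      simp at hpos'
    exact hx (Or.inr (Set.mem_biUnion (Finset.mem_filter.2 ⟨hp, hp0⟩) h))
  have hempty : (N ∪ Q)ᶜ = ∅ := by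
    by_contra hne
    obtain ⟨x, hx⟩ := Set.nonempty_iff_ne_empty.2 hne
    obtain ⟨g, hxg, hg⟩ := exists_posSet_subset (hNclosed.union hQclosed).isOpen_compl hx
    have hinf : inf f g = zero := eq_zero_iff_val.2 fun y => by
      rw [val_inf]
      by_cases hy : y ∈ posSet g
      · have hfy : ¬ 0 < val f y := hsub (hg hy)
        rw [le_antisymm (not_lt.1 hfy) (val_nonneg f y)]
        exact min_eq_left (val_nonneg g y)
      · rw [le_antisymm (not_lt.1 hy) (val_nonneg g y)]
        exact min_eq_right (val_nonneg f y)
    have hxg' : 0 < val g x := hxg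
    rw [hf g hinf, val_zero] at hxg'
    exact lt_irrefl _ hxg'
  refine measure_mono_null (fun x hx => ?_) hN0
  have hf0 : val f x = 0 := le_antisymm (not_lt.1 hx) (val_nonneg f x)
  have hx' : x ∈ N ∪ Q := by
    by_contra h
    exact (Set.ext_iff.1 hempty x).1 h
  rcases hx' with h | h
  · exact h
  · obtain ⟨p, hp, hxp⟩ := Set.mem_iUnion₂.1 h
    have hxp' : val f x = ∑ i, (p.1 i : ℝ) * x i + p.2 := hxp
    rw [hf0] at hxp'
    refine Set.mem_biUnion (Finset.mem_filter.2 ⟨(Finset.mem_filter.1 hp).1, fun h0 => ?_⟩)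
      (show ∑ i, (p.1 i : ℝ) * x i = -p.2 by linarith)
    rw [h0] at hxp'
    have h2 : p.2 = 0 := by simpa using hxp'.symm
    exact (Finset.mem_filter.1 hp).2 (Prod.ext h0 h2)

theorem tendsToOneOnWeakUnits_average : TendsToOneOnWeakUnits (average n) := by
  intro f hf
  have h := tendsto_integral_nfold volume f
  have h1 : volume.real (posSet f) = 1 := by
    rw [measureReal_def, (prob_compl_eq_zero_iff (isOpen_posSet f).measurableSet).1
      (volume_posSet_of_isWeakUnit hf), ENNReal.toReal_one]
  rwa [h1] at h

end Average

end FreeMV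

/-! ### The twist of the triangle along its rings -/

namespace RingTwist

/-- The tent function of period `3`, with support `[-1, 1]` and peak `1` at `0`. -/
noncomputable def tent (θ : AddCircle (3 : ℝ)) : ℝ := max 0 (1 - ‖θ‖)

theorem continuous_tent : Continuous tent := continuous_const.max (continuous_const.sub continuous_norm)

theorem tent_neg (θ : AddCircle (3 : ℝ)) : tent (-θ) = tent θ := by
  unfold tent; rw [norm_neg]

theorem coe_add_three (r : ℝ) : ((r + 3 : ℝ) : AddCircle (3 : ℝ)) = r := AddCircle.coe_add_period 3 r

theorem coe_three : ((3 : ℝ) : AddCircle (3 : ℝ)) = 0 := AddCircle.coe_period 3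

/-- Beyond 3/2 the norm on the circle turns back to `3 - |r|`, but this is still at least 1, so both
sides vanish. -/
theorem tent_coe {r : ℝ} (h : |r| ≤ 2) : tent (r : AddCircle (3 : ℝ)) = max 0 (1 - |r|) := by
  have key : ∀ s : ℝ, |s| ≤ 3 / 2 → ‖(s : AddCircle (3 : ℝ))‖ = |s| := fun s hs =>
    (AddCircle.norm_coe_eq_abs_iff 3 three_ne_zero).2 (by
      rwa [abs_of_pos (three_pos : (0 : ℝ) < 3)])
  unfold tent
  rcases le_or_gt |r| (3 / 2) with h1 | h1
  · rw [key r h1]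
  · have h2 : ‖(r : AddCircle (3 : ℝ))‖ = 3 - |r| := by
      rcases le_total 0 r with h0 | h0
      · rw [abs_of_nonneg h0] at *
        have e : (r : AddCircle (3 : ℝ)) = ((r - 3 : ℝ) : AddCircle (3 : ℝ)) := by
          rw [← coe_add_three (r - 3)]; ring_nf
        rw [e, key _ (by rw [abs_le]; constructor <;> linarith), abs_of_nonpos (by linarith)]
        ring
      · rw [abs_of_nonpos h0] at *
        rw [← coe_add_three r, key _ (by rw [abs_le]; constructor <;> linarith),
          abs_of_nonneg (by linarith)]
        ring
    rw [h2, max_eq_left (by linarith), max_eq_left (by linarith)]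

/-- A barycentric coordinate on the ring at distance `t` from the boundary of the triangle, as a
function of the angle. -/
noncomputable def ringCoord (t : ℝ) (θ : AddCircle (3 : ℝ)) : ℝ := t + (1 - 3 * t) * tent θ

/-- The point with angle `θ` on the ring at distance `t` from the boundary of the triangle with
vertices `(1, 0)`, `(0, 1)`, `(0, 0)`. -/
noncomputable def ringPoint (t : ℝ) (θ : AddCircle (3 : ℝ)) : ℝ × ℝ :=
  (ringCoord t θ, ringCoord t (θ - (1 : ℝ)))

/-- Trichotomy of the position on a ring: each point lies on one of the three sides. -/
theorem ringCoord_cases (t : ℝ) (θ : AddCircle (3 : ℝ)) : ∃ r : ℝ, (r : AddCircle (3 : ℝ)) = θ ∧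
    ((0 ≤ r ∧ r ≤ 1 ∧ ringCoord t θ = t + (1 - 3 * t) * (1 - r) ∧
        ringCoord t (θ - (1 : ℝ)) = t + (1 - 3 * t) * r ∧ ringCoord t (θ - (2 : ℝ)) = t) ∨
      (1 ≤ r ∧ r ≤ 2 ∧ ringCoord t θ = t ∧
        ringCoord t (θ - (1 : ℝ)) = t + (1 - 3 * t) * (2 - r) ∧
        ringCoord t (θ - (2 : ℝ)) = t + (1 - 3 * t) * (r - 1)) ∨
      (2 ≤ r ∧ r ≤ 3 ∧ ringCoord t θ = t + (1 - 3 * t) * (r - 2) ∧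
        ringCoord t (θ - (1 : ℝ)) = t ∧
        ringCoord t (θ - (2 : ℝ)) = t + (1 - 3 * t) * (3 - r))) := by
  have : Fact ((0 : ℝ) < 3) := ⟨three_pos⟩
  obtain ⟨r, hr, rfl⟩ := AddCircle.eq_coe_Ico θ
  obtain ⟨h0, h3⟩ := hr
  refine ⟨r, rfl, ?_⟩
  have val : ∀ s : ℝ, |s| ≤ 2 → ringCoord t (s : AddCircle (3 : ℝ)) =
      t + (1 - 3 * t) * max 0 (1 - |s|) := fun s hs => by
    rw [ringCoord, tent_coe hs]
  have e1 : (r : AddCircle (3 : ℝ)) - (1 : ℝ) = ((r - 1 : ℝ) : AddCircle (3 : ℝ)) := rfl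
  have e2 : (r : AddCircle (3 : ℝ)) - (2 : ℝ) = ((r - 2 : ℝ) : AddCircle (3 : ℝ)) := rfl
  have e3 : (r : AddCircle (3 : ℝ)) = ((r - 3 : ℝ) : AddCircle (3 : ℝ)) := by
    rw [← coe_add_three (r - 3)]; ring_nf
  rcases le_total r 1 with h1 | h1
  · refine Or.inl ⟨h0, h1, ?_, ?_, ?_⟩
    · rw [val r (by rw [abs_le]; constructor <;> linarith), abs_of_nonneg h0,
        max_eq_right (by linarith)]
    · rw [e1, val _ (by rw [abs_le]; constructor <;> linarith), abs_of_nonpos (by linarith),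
        max_eq_right (by linarith)]
      ring
    · rw [e2, val _ (by rw [abs_le]; constructor <;> linarith), abs_of_nonpos (by linarith),
        max_eq_left (by linarith)]
      ring
  rcases le_total r 2 with h2 | h2
  · refine Or.inr (Or.inl ⟨h1, h2, ?_, ?_, ?_⟩)
    · rw [val r (by rw [abs_le]; constructor <;> linarith), abs_of_nonneg h0,
        max_eq_left (by linarith)]
      ring
    · rw [e1, val _ (by rw [abs_le]; constructor <;> linarith), abs_of_nonneg (by linarith),
        max_eq_right (by linarith)]
      ring
    · rw [e2, val _ (by rw [abs_le]; constructor <;> linarith), abs_of_nonpos (by linarith),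
        max_eq_right (by linarith)]
      ring
  · refine Or.inr (Or.inr ⟨h2, h3.le, ?_, ?_, ?_⟩)
    · rw [e3, val _ (by rw [abs_le]; constructor <;> linarith), abs_of_nonpos (by linarith),
        max_eq_right (by linarith)]
      ring
    · rw [e1, val _ (by rw [abs_le]; constructor <;> linarith), abs_of_nonneg (by linarith),
        max_eq_left (by linarith)]
      ring
    · rw [e2, val _ (by rw [abs_le]; constructor <;> linarith), abs_of_nonneg (by linarith),
        max_eq_right (by linarith)]
      ring

theorem ringCoord_sum (t : ℝ) (θ : AddCircle (3 : ℝ)) :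
    ringCoord t θ + ringCoord t (θ - (1 : ℝ)) + ringCoord t (θ - (2 : ℝ)) = 1 := by
  obtain ⟨r, -, h | h | h⟩ := ringCoord_cases t θ <;> obtain ⟨-, -, ha, hb, hc⟩ := h <;>
    rw [ha, hb, hc] <;> ring

/-- The first barycentric coordinate of the twisted point, as a function of the three barycentric
coordinates. The ring at distance `t` from the boundary is rotated by the length `min t l`, where
`l` is the length of its sides. -/
noncomputable def twist (a b c : ℝ) : ℝ :=
  let t := min a (min b c)
  let l := a + b + c - 3 * t
  let τ := min t l
  -- On the side `b = t` the two arguments are `l + c - τ` and `a + τ`: the coordinate rises and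
  -- falls again behind the vertex. On `c = t` the first argument is `max (a - τ) t` and gives the
  -- value; on `a = t` the second, `max (2t + τ - b) t`, does. Only integer multiples, sums, minima
  -- and maxima occur, so the map is McNaughton.
  min (max (l + c - τ - b + t) t + min b c - t) (max (a + τ - b + t) t + min a b - t)

/-- The angle of the twist. -/
noncomputable def angle (t : ℝ) : ℝ := min t (1 - 3 * t) / (1 - 3 * t)

/-- At the centre `t = 1 / 3` the quotient in `angle` divides by zero, but both sides vanish. -/
theorem angle_mul {t : ℝ} (h0 : 0 ≤ t) :
    (1 - 3 * t) * angle t = min t (1 - 3 * t) := by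
  unfold angle
  rcases eq_or_ne (1 - 3 * t) 0 with h' | h'
  · rw [h', zero_mul, min_eq_right h0]
  · field_simp

theorem angle_mem {t : ℝ} (h0 : 0 ≤ t) (h : t ≤ 1 / 3) : angle t ∈ Set.Icc (0 : ℝ) 1 := by
  have hl : 0 ≤ 1 - 3 * t := by linarith
  exact ⟨div_nonneg (le_min h0 hl) hl, div_le_one_of_le₀ (min_le_right _ _) hl⟩

theorem twist_eq_of_min {a b c t l τ : ℝ} (ht : min a (min b c) = t) (hl : a + b + c - 3 * t = l)
    (hτ : min t l = τ) : twist a b c =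
      min (max (l + c - τ - b + t) t + min b c - t) (max (a + τ - b + t) t + min a b - t) := by
  subst hτ hl ht
  rfl

/-- Each of the three sides is treated separately. With the products `l * r` and `l * angle t = τ`
taken as new variables, everything is piecewise linear and the rotation is checked by cases on the
minima and maxima. -/
theorem twist_ringCoord {t : ℝ} (h0 : 0 ≤ t) (h : t ≤ 1 / 3) (θ : AddCircle (3 : ℝ)) :
    twist (ringCoord t θ) (ringCoord t (θ - (1 : ℝ))) (ringCoord t (θ - (2 : ℝ))) =
      ringCoord t (θ + angle t) := by
  have hsum := ringCoord_sum t θ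
  obtain ⟨hα0, hα1⟩ := angle_mem h0 h
  have hlα := angle_mul h0
  have hτ0 : 0 ≤ min t (1 - 3 * t) := le_min h0 (by linarith)
  have hτl : min t (1 - 3 * t) ≤ 1 - 3 * t := min_le_right _ _
  have val : ∀ s : ℝ, |s| ≤ 2 → ringCoord t (s : AddCircle (3 : ℝ)) =
      t + (1 - 3 * t) * max 0 (1 - |s|) := fun s hs => by
    rw [ringCoord, tent_coe hs]
  obtain ⟨r, rfl, hc⟩ := ringCoord_cases t θ
  have e0 : (r : AddCircle (3 : ℝ)) + angle t = ((r + angle t : ℝ) : AddCircle (3 : ℝ)) := rfl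
  have e3 : (r : AddCircle (3 : ℝ)) + angle t = ((r + angle t - 3 : ℝ) : AddCircle (3 : ℝ)) := by
    rw [← coe_add_three (r + angle t - 3), e0]; ring_nf
  have hl0 : 0 ≤ 1 - 3 * t := by linarith
  generalize hl : 1 - 3 * t = l at *
  generalize hτ : min t l = τ at *
  generalize angle t = α at *
  rcases hc with ⟨hr0, hr1, ha, hb, hc⟩ | ⟨hr0, hr1, ha, hb, hc⟩ | ⟨hr0, hr1, ha, hb, hc⟩ <;>
    rw [ha, hb, hc] at hsum ⊢
  · have hlr : 0 ≤ l * r := mul_nonneg hl0 hr0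
    have hlr1 : l * r ≤ l := mul_le_of_le_one_right hl0 hr1
    have hv : ringCoord t ((r : AddCircle (3 : ℝ)) + α) = max t (t + l - l * r - τ) := by
      rw [e0, val _ (by rw [abs_le]; constructor <;> linarith), abs_of_nonneg (by linarith),
        mul_max_of_nonneg _ _ hl0, mul_zero, ← max_add_add_left, add_zero]
      congr 1
      rw [← hlα]; ring
    rw [hv, twist_eq_of_min (t := t) (l := l) (τ := τ) (by
      rw [min_eq_right (a := t + l * r) (by linarith), min_eq_right (by linarith)])
      (by linarith) hτ]
    generalize hu : l * r = u at *
    have e1 : t + l * (1 - r) = t + l - u := by rw [← hu]; ring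
    rw [e1]
    simp only [min_def, max_def]
    split_ifs <;> linarith
  · have hlr : l ≤ l * r := le_mul_of_one_le_right hl0 hr0
    have hlr1 : l * r ≤ 2 * l := by nlinarith
    have hv : ringCoord t ((r : AddCircle (3 : ℝ)) + α) = max t (t + l * r + τ - 2 * l) := by
      rw [e3, val _ (by rw [abs_le]; constructor <;> linarith), abs_of_nonpos (by linarith),
        mul_max_of_nonneg _ _ hl0, mul_zero, ← max_add_add_left, add_zero]
      congr 1
      rw [← hlα]; ring
    generalize hu : l * r = u at *
    have e1 : t + l * (2 - r) = t + 2 * l - u := by rw [← hu]; ring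
    have e2 : t + l * (r - 1) = t + u - l := by rw [← hu]; ring
    rw [e1, e2] at hsum ⊢
    rw [hv, twist_eq_of_min (t := t) (l := l) (τ := τ) (by
      rw [min_eq_left (le_min (by linarith) (by linarith))])
      (by linarith) hτ]
    have e3 : t + τ - (t + 2 * l - u) + t = t + u + τ - 2 * l := by ring
    have e4 : l + (t + u - l) - τ - (t + 2 * l - u) + t = t + 2 * u - 2 * l - τ := by ring
    rw [min_eq_left (a := t) (b := t + 2 * l - u) (by linarith), e3, e4, add_sub_cancel_right,
      max_comm t]
    refine min_eq_right (max_le ?_ ?_)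
    · rcases le_total (t + 2 * l - u) (t + u - l) with hbc | hbc
      · rw [min_eq_left hbc]
        linarith [le_max_left (t + 2 * u - 2 * l - τ) t]
      · rw [min_eq_right hbc]
        linarith [le_max_right (t + 2 * u - 2 * l - τ) t]
    · have := le_min (show t ≤ t + 2 * l - u by linarith) (show t ≤ t + u - l by linarith)
      linarith [le_max_right (t + 2 * u - 2 * l - τ) t]
  · have hlr : 2 * l ≤ l * r := by nlinarith
    have hlr1 : l * r ≤ 3 * l := by nlinarith
    have hv : ringCoord t ((r : AddCircle (3 : ℝ)) + α) =
        min (t + l * r + τ - 2 * l) (t + 4 * l - l * r - τ) := by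
      rw [e3, val _ (by rw [abs_le]; constructor <;> linarith)]
      have e : l * (r + α - 3) = l * r + τ - 3 * l := by rw [← hlα]; ring
      have h1 : |r + α - 3| ≤ 1 := by rw [abs_le]; constructor <;> linarith
      rw [max_eq_right (by linarith), mul_sub, mul_one, ← abs_of_nonneg hl0, ← abs_mul,
        abs_of_nonneg hl0, e, abs_eq_max_neg]
      simp only [min_def, max_def]
      split_ifs <;> linarith
    generalize hu : l * r = u at *
    have e1 : t + l * (r - 2) = t + u - 2 * l := by rw [← hu]; ring
    have e2 : t + l * (3 - r) = t + 3 * l - u := by rw [← hu]; ring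
    rw [e1, e2] at hsum ⊢
    rw [hv, twist_eq_of_min (t := t) (l := l) (τ := τ) (by
      rw [min_eq_left (a := t) (by linarith), min_eq_right (by linarith)])
      (by linarith) hτ]
    simp only [min_def, max_def]
    split_ifs <;> linarith

/-- Here `t = 0`, so nothing is rotated. This covers the points beyond the hypotenuse, where the
third coordinate is truncated to 0 and `a + b` may exceed 1. -/
theorem twist_zero_right {a b : ℝ} (ha : 0 ≤ a) (hb : 0 ≤ b) : twist a b 0 = a := by
  rw [twist_eq_of_min (t := 0) (l := a + b) (τ := 0) (by rw [min_eq_right hb, min_eq_right ha])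
    (by ring) (min_eq_left (by linarith))]
  simp only [min_def, max_def]
  split_ifs <;> linarith

theorem twist_zero_mid {a c : ℝ} (ha : 0 ≤ a) (hc : 0 ≤ c) : twist a 0 c = a := by
  rw [twist_eq_of_min (t := 0) (l := a + c) (τ := 0) (by rw [min_eq_left hc, min_eq_right ha])
    (by ring) (min_eq_left (by linarith))]
  simp only [min_def, max_def]
  split_ifs <;> linarith

/-- The third barycentric coordinate, truncated at `0`. -/
noncomputable def third (p : ℝ × ℝ) : ℝ := max 0 (1 - p.1 - p.2)

/-- The twist of the square: it rotates the rings of the triangle `x + y ≤ 1` and fixes the other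
points. -/
noncomputable def twistMap (p : ℝ × ℝ) : ℝ × ℝ :=
  (twist p.1 p.2 (third p), twist p.2 (third p) p.1)

/-- The inverse twist. -/
noncomputable def untwistMap (p : ℝ × ℝ) : ℝ × ℝ :=
  (twist p.1 (third p) p.2, twist p.2 p.1 (third p))

theorem ringCoord_nonneg {t : ℝ} (h0 : 0 ≤ t) (h : t ≤ 1 / 3) (θ : AddCircle (3 : ℝ)) :
    0 ≤ ringCoord t θ :=
  add_nonneg h0 (mul_nonneg (by linarith) (le_max_left _ _))

theorem third_ringPoint {t : ℝ} (h0 : 0 ≤ t) (h : t ≤ 1 / 3) (θ : AddCircle (3 : ℝ)) :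
    third (ringPoint t θ) = ringCoord t (θ - (2 : ℝ)) := by
  have h1 := ringCoord_sum t θ
  have h2 := ringCoord_nonneg h0 h (θ - (2 : ℝ))
  unfold third ringPoint
  rw [max_eq_right (by simp only; linarith)]
  simp only
  linarith

theorem sub_one_sub (θ : AddCircle (3 : ℝ)) : θ - (1 : ℝ) - (1 : ℝ) = θ - (2 : ℝ) := by
  rw [sub_sub, ← AddCircle.coe_add]; norm_num

theorem sub_one_sub_two (θ : AddCircle (3 : ℝ)) : θ - (1 : ℝ) - (2 : ℝ) = θ := by
  rw [sub_sub, ← AddCircle.coe_add, show (1 : ℝ) + 2 = 3 by norm_num, coe_three, sub_zero]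

theorem twistMap_ringPoint {t : ℝ} (h0 : 0 ≤ t) (h : t ≤ 1 / 3) (θ : AddCircle (3 : ℝ)) :
    twistMap (ringPoint t θ) = ringPoint t (θ + angle t) := by
  unfold twistMap
  rw [third_ringPoint h0 h]
  refine Prod.ext (twist_ringCoord h0 h θ) ?_
  have := twist_ringCoord h0 h (θ - (1 : ℝ))
  rw [sub_one_sub, sub_one_sub_two] at this
  refine this.trans ?_
  rw [sub_add_eq_add_sub]
  rfl

theorem ringCoord_neg (t : ℝ) (θ : AddCircle (3 : ℝ)) : ringCoord t (-θ) = ringCoord t θ := by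
  unfold ringCoord; rw [tent_neg]

/-- The reflection `θ ↦ -θ` exchanges the second and third barycentric coordinates and fixes the
first, so it conjugates the twist into its inverse. -/
theorem untwistMap_ringPoint {t : ℝ} (h0 : 0 ≤ t) (h : t ≤ 1 / 3) (θ : AddCircle (3 : ℝ)) :
    untwistMap (ringPoint t θ) = ringPoint t (θ - angle t) := by
  have rev : ∀ θ : AddCircle (3 : ℝ), twist (ringCoord t θ) (ringCoord t (θ - (2 : ℝ)))
      (ringCoord t (θ - (1 : ℝ))) = ringCoord t (θ - angle t) := by
    intro θ
    have := twist_ringCoord h0 h (-θ)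
    have e1 : -θ - (1 : ℝ) = -(θ - (2 : ℝ)) := by
      rw [← sub_one_sub_two (-(θ - (2 : ℝ)))]
      abel
    have e2 : -θ - (2 : ℝ) = -(θ - (1 : ℝ)) := by
      rw [← sub_one_sub_two (-(θ - (1 : ℝ)))]
      abel
    rw [e1, e2, ringCoord_neg, ringCoord_neg, ringCoord_neg] at this
    rw [this, ← ringCoord_neg]
    congr 1
    abel
  unfold untwistMap
  rw [third_ringPoint h0 h]
  refine Prod.ext (rev θ) ?_
  have := rev (θ - (1 : ℝ))
  rw [sub_one_sub, sub_one_sub_two] at this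
  refine this.trans ?_
  rw [sub_right_comm]
  rfl

theorem third_of_le {p : ℝ × ℝ} (h : 1 ≤ p.1 + p.2) : third p = 0 :=
  max_eq_left (by linarith)

theorem twistMap_of_le {p : ℝ × ℝ} (h1 : 0 ≤ p.1) (h2 : 0 ≤ p.2) (h : 1 ≤ p.1 + p.2) :
    twistMap p = p := by
  unfold twistMap
  rw [third_of_le h, twist_zero_right h1 h2, twist_zero_mid h2 h1]

theorem untwistMap_of_le {p : ℝ × ℝ} (h1 : 0 ≤ p.1) (h2 : 0 ≤ p.2) (h : 1 ≤ p.1 + p.2) :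
    untwistMap p = p := by
  unfold untwistMap
  rw [third_of_le h, twist_zero_right h2 h1, twist_zero_mid h1 h2]

/-- The distance from the boundary of the triangle: the least barycentric coordinate. -/
noncomputable def depth (p : ℝ × ℝ) : ℝ := min p.1 (min p.2 (1 - p.1 - p.2))

theorem depth_le (p : ℝ × ℝ) : depth p ≤ 1 / 3 := by
  have h1 : depth p ≤ p.1 := min_le_left _ _
  have h2 : depth p ≤ p.2 := (min_le_right _ _).trans (min_le_left _ _)
  have h3 : depth p ≤ 1 - p.1 - p.2 := (min_le_right _ _).trans (min_le_right _ _)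
  linarith

theorem depth_ringPoint {t : ℝ} (h : t ≤ 1 / 3) (θ : AddCircle (3 : ℝ)) :
    depth (ringPoint t θ) = t := by
  have hsum := ringCoord_sum t θ
  have hl : 0 ≤ 1 - 3 * t := by linarith
  have e : depth (ringPoint t θ) =
      min (ringCoord t θ) (min (ringCoord t (θ - (1 : ℝ))) (ringCoord t (θ - (2 : ℝ)))) := by
    unfold depth ringPoint
    congr 2
    simp only
    linarith
  rw [e]
  obtain ⟨r, -, h | h | h⟩ := ringCoord_cases t θ <;> obtain ⟨h1, h2, ha, hb, hc⟩ := h <;>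
    rw [ha, hb, hc]
  · have := mul_nonneg hl h1
    have := mul_nonneg hl (sub_nonneg.2 h2)
    rw [min_eq_right (a := t + (1 - 3 * t) * r) (by linarith), min_eq_right (by linarith)]
  · have := mul_nonneg hl (sub_nonneg.2 h1)
    have := mul_nonneg hl (sub_nonneg.2 h2)
    rw [min_eq_left (le_min (by linarith) (by linarith))]
  · have := mul_nonneg hl (sub_nonneg.2 h1)
    have := mul_nonneg hl (sub_nonneg.2 h2)
    rw [min_eq_left (a := t) (by linarith), min_eq_right (by linarith)]

/-- The angle of a point on its ring. -/
noncomputable def ringAngle (p : ℝ × ℝ) : AddCircle (3 : ℝ) :=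
  if p.2 ≤ p.1 ∧ p.2 ≤ 1 - p.1 - p.2 then ((2 + (p.1 - p.2) / (1 - 3 * p.2) : ℝ) : AddCircle (3 : ℝ))
  else if 1 - p.1 - p.2 ≤ p.1 ∧ 1 - p.1 - p.2 ≤ p.2 then
    (((p.2 - (1 - p.1 - p.2)) / (1 - 3 * (1 - p.1 - p.2)) : ℝ) : AddCircle (3 : ℝ))
  else ((1 + (1 - p.1 - p.2 - p.1) / (1 - 3 * p.1) : ℝ) : AddCircle (3 : ℝ))

theorem ringPoint_third (p : ℝ × ℝ) : ringPoint (1 / 3) (ringAngle p) = (1 / 3, 1 / 3) := by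
  unfold ringPoint ringCoord
  norm_num

theorem ringPoint_depth_ringAngle (p : ℝ × ℝ) : ringPoint (depth p) (ringAngle p) = p := by
  rcases eq_or_lt_of_le (depth_le p) with hd | hd
  · have h1 : depth p ≤ p.1 := min_le_left _ _
    have h2 : depth p ≤ p.2 := (min_le_right _ _).trans (min_le_left _ _)
    have h3 : depth p ≤ 1 - p.1 - p.2 := (min_le_right _ _).trans (min_le_right _ _)
    rw [hd, ringPoint_third]
    exact Prod.ext (by simp only; linarith) (by simp only; linarith)
  obtain ⟨x, y⟩ := p
  have val : ∀ t s : ℝ, |s| ≤ 2 → ringCoord t (s : AddCircle (3 : ℝ)) =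
      t + (1 - 3 * t) * max 0 (1 - |s|) := fun t s hs => by
    rw [ringCoord, tent_coe hs]
  unfold ringAngle
  simp only
  split_ifs with h1 h2
  · have ht : depth (x, y) = y := by
      unfold depth
      simp only
      rw [min_eq_left h1.2, min_eq_right h1.1]
    rw [ht] at hd ⊢
    have hl : 0 < 1 - 3 * y := by linarith
    obtain ⟨u, hu⟩ : ∃ u, u = (x - y) / (1 - 3 * y) := ⟨_, rfl⟩
    have hu0 : 0 ≤ u := hu ▸ div_nonneg (by linarith) hl.le
    have hu1 : u ≤ 1 := hu ▸ (div_le_one hl).2 (by linarith)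
    have hul : (1 - 3 * y) * u = x - y := by rw [hu]; field_simp
    rw [← hu]
    refine Prod.ext ?_ ?_
    · change ringCoord y ((2 + u : ℝ) : AddCircle (3 : ℝ)) = x
      have e : ((2 + u : ℝ) : AddCircle (3 : ℝ)) = ((u - 1 : ℝ) : AddCircle (3 : ℝ)) := by
        rw [← coe_add_three (u - 1)]; ring_nf
      rw [e, val _ _ (by rw [abs_le]; constructor <;> linarith),
        abs_of_nonpos (by linarith), max_eq_right (by linarith)]
      linarith
    · change ringCoord y ((2 + u - 1 : ℝ) : AddCircle (3 : ℝ)) = y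
      rw [val _ _ (by rw [abs_le]; constructor <;> linarith),
        abs_of_nonneg (by linarith), max_eq_left (by linarith)]
      ring
  · have ht : depth (x, y) = 1 - x - y := by
      unfold depth
      simp only
      rw [min_eq_right h2.2, min_eq_right h2.1]
    rw [ht] at hd ⊢
    generalize hz : 1 - x - y = z at *
    have hl : 0 < 1 - 3 * z := by linarith
    obtain ⟨u, hu⟩ : ∃ u, u = (y - z) / (1 - 3 * z) := ⟨_, rfl⟩
    have hu0 : 0 ≤ u := hu ▸ div_nonneg (by linarith) hl.le
    have hu1 : u ≤ 1 := hu ▸ (div_le_one hl).2 (by linarith)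
    have hul : (1 - 3 * z) * u = y - z := by rw [hu]; field_simp
    rw [← hu]
    refine Prod.ext ?_ ?_
    · change ringCoord z ((u : ℝ) : AddCircle (3 : ℝ)) = x
      rw [val _ _ (by rw [abs_le]; constructor <;> linarith),
        abs_of_nonneg (by linarith), max_eq_right (by linarith)]
      linarith
    · change ringCoord z ((u - 1 : ℝ) : AddCircle (3 : ℝ)) = y
      rw [val _ _ (by rw [abs_le]; constructor <;> linarith),
        abs_of_nonpos (by linarith), max_eq_right (by linarith)]
      linarith
  · have hxy : x ≤ y ∧ x ≤ 1 - x - y := by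
      rcases le_total x y with hxy | hxy
      · refine ⟨hxy, ?_⟩
        by_contra hcon
        exact h2 ⟨(not_le.1 hcon).le, (not_le.1 hcon).le.trans hxy⟩
      · exfalso
        have h3 : ¬ y ≤ 1 - x - y := fun h => h1 ⟨hxy, h⟩
        exact h2 ⟨(not_le.1 h3).le.trans hxy, (not_le.1 h3).le⟩
    have ht : depth (x, y) = x := by
      unfold depth
      simp only
      rw [min_eq_left (le_min hxy.1 hxy.2)]
    rw [ht] at hd ⊢
    have hl : 0 < 1 - 3 * x := by linarith
    obtain ⟨u, hu⟩ : ∃ u, u = (1 - x - y - x) / (1 - 3 * x) := ⟨_, rfl⟩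
    have hu0 : 0 ≤ u := hu ▸ div_nonneg (by linarith) hl.le
    have hu1 : u ≤ 1 := hu ▸ (div_le_one hl).2 (by linarith)
    have hul : (1 - 3 * x) * u = 1 - x - y - x := by rw [hu]; field_simp
    rw [← hu]
    refine Prod.ext ?_ ?_
    · change ringCoord x ((1 + u : ℝ) : AddCircle (3 : ℝ)) = x
      rw [val _ _ (by rw [abs_le]; constructor <;> linarith),
        abs_of_nonneg (by linarith), max_eq_left (by linarith)]
      ring
    · change ringCoord x ((1 + u - 1 : ℝ) : AddCircle (3 : ℝ)) = y
      rw [val _ _ (by rw [abs_le]; constructor <;> linarith),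
        abs_of_nonneg (by linarith), max_eq_right (by linarith)]
      linarith

theorem ringPoint_injective {t : ℝ} (h : t < 1 / 3) {θ θ' : AddCircle (3 : ℝ)}
    (e : ringPoint t θ = ringPoint t θ') : θ = θ' := by
  have hl : 0 < 1 - 3 * t := by linarith
  have h1 : ringCoord t θ = ringCoord t θ' := congrArg Prod.fst e
  have h2 : ringCoord t (θ - (1 : ℝ)) = ringCoord t (θ' - (1 : ℝ)) := congrArg Prod.snd e
  have h3 : ringCoord t (θ - (2 : ℝ)) = ringCoord t (θ' - (2 : ℝ)) := by
    linarith [ringCoord_sum t θ, ringCoord_sum t θ']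
  obtain ⟨r, rfl, hr⟩ := ringCoord_cases t θ
  obtain ⟨r', rfl, hr'⟩ := ringCoord_cases t θ'
  have cancel : ∀ {u v : ℝ}, t + (1 - 3 * t) * u = t + (1 - 3 * t) * v → u = v := fun huv =>
    mul_left_cancel₀ hl.ne' (add_left_cancel huv)
  have cancel0 : ∀ {v : ℝ}, t = t + (1 - 3 * t) * v → v = 0 := fun {v} huv =>
    (cancel (u := 0) (v := v) (by rwa [mul_zero, add_zero])).symm
  have hrr : r = r' ∨ r = r' + 3 ∨ r' = r + 3 := by
    rcases hr with ⟨_, _, ha, hb, hc⟩ | ⟨_, _, ha, hb, hc⟩ | ⟨_, _, ha, hb, hc⟩ <;>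
    rcases hr' with ⟨_, _, ha', hb', hc'⟩ | ⟨_, _, ha', hb', hc'⟩ | ⟨_, _, ha', hb', hc'⟩ <;>
    rw [ha, ha'] at h1 <;> rw [hb, hb'] at h2 <;> rw [hc, hc'] at h3
    · exact Or.inl (cancel h2)
    · have := cancel0 h1.symm; have := cancel0 h3; left; linarith
    · have := cancel0 h2.symm; have := cancel0 h3; right; right; linarith
    · have := cancel0 h1; have := cancel0 h3.symm; left; linarith
    · have := cancel h2; left; linarith
    · have := cancel0 h1; have := cancel0 h2.symm; left; linarith
    · have := cancel0 h2; have := cancel0 h3.symm; right; left; linarith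
    · have := cancel0 h1.symm; have := cancel0 h2; left; linarith
    · have := cancel h1; left; linarith
  rcases hrr with h | h | h
  · rw [h]
  · rw [h, coe_add_three]
  · rw [h, coe_add_three]

theorem ringAngle_ringPoint {t : ℝ} (h : t < 1 / 3) (θ : AddCircle (3 : ℝ)) :
    ringAngle (ringPoint t θ) = θ := by
  refine ringPoint_injective h ?_
  have := ringPoint_depth_ringAngle (ringPoint t θ)
  rwa [depth_ringPoint h.le] at this

end RingTwist

/-! ### Invariance under arbitrary rotations of the rings -/

namespace RingTwist

theorem continuous_ringPoint : Continuous fun z : ℝ × AddCircle (3 : ℝ) => ringPoint z.1 z.2 := by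
  unfold ringPoint ringCoord
  have := continuous_tent
  fun_prop

theorem continuous_depth : Continuous depth := by
  unfold depth
  fun_prop

theorem measurable_ringAngle : Measurable ringAngle := by
  unfold ringAngle
  refine Measurable.ite ?_ ?_ (Measurable.ite ?_ ?_ ?_)
  · exact (measurableSet_le measurable_snd measurable_fst).inter
      (measurableSet_le measurable_snd (by fun_prop))
  · exact AddCircle.measurable_mk'.comp (by fun_prop)
  · exact (measurableSet_le (by fun_prop) measurable_fst).inter
      (measurableSet_le (by fun_prop) measurable_snd)
  · exact AddCircle.measurable_mk'.comp (by fun_prop)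
  · exact AddCircle.measurable_mk'.comp (by fun_prop)

/-- The map of the triangle `x + y ≤ 1` that rotates the ring at distance `t` from the boundary by
the angle `g t`. -/
noncomputable def rot (g : ℝ → AddCircle (3 : ℝ)) (p : ℝ × ℝ) : ℝ × ℝ :=
  if 0 ≤ depth p then ringPoint (depth p) (ringAngle p + g (depth p)) else p

theorem measurable_rot {g : ℝ → AddCircle (3 : ℝ)} (hg : Measurable g) : Measurable (rot g) := by
  unfold rot
  have hd := continuous_depth.measurable
  refine Measurable.ite (measurableSet_le measurable_const hd) ?_ measurable_id
  exact continuous_ringPoint.measurable.comp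
    (hd.prodMk (measurable_ringAngle.add (hg.comp hd)))

theorem depth_rot (g : ℝ → AddCircle (3 : ℝ)) (p : ℝ × ℝ) : depth (rot g p) = depth p := by
  unfold rot
  split_ifs with h
  · exact depth_ringPoint (depth_le p) _
  · rfl

theorem rot_ringPoint (g : ℝ → AddCircle (3 : ℝ)) {t : ℝ} (h0 : 0 ≤ t) (h : t < 1 / 3)
    (θ : AddCircle (3 : ℝ)) : rot g (ringPoint t θ) = ringPoint t (θ + g t) := by
  unfold rot
  rw [depth_ringPoint h.le, if_pos h0, ringAngle_ringPoint h]

theorem ringPoint_one_third (θ θ' : AddCircle (3 : ℝ)) :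
    ringPoint (1 / 3) θ = ringPoint (1 / 3) θ' := by
  unfold ringPoint ringCoord
  norm_num

/-- Rotations of one ring add up. At the centre the angle is not determined by the point, but the
ring there is a single point. -/
theorem rot_rot (g g' : ℝ → AddCircle (3 : ℝ)) (p : ℝ × ℝ) :
    rot g (rot g' p) = rot (fun t => g' t + g t) p := by
  by_cases h : 0 ≤ depth p
  · rcases eq_or_lt_of_le (depth_le p) with hd | hd
    · unfold rot
      rw [if_pos h, depth_ringPoint (depth_le p), if_pos h, if_pos h, hd]
      exact ringPoint_one_third _ _
    · have e : rot g' p = ringPoint (depth p) (ringAngle p + g' (depth p)) := if_pos h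
      rw [e, rot_ringPoint g h hd]
      unfold rot
      rw [if_pos h, add_assoc]
  · have e : ∀ g'' : ℝ → AddCircle (3 : ℝ), rot g'' p = p := fun g'' => if_neg h
    rw [e, e, e]

theorem rot_of_eq_zero {g : ℝ → AddCircle (3 : ℝ)} {p : ℝ × ℝ} (h : g (depth p) = 0) :
    rot g p = p := by
  unfold rot
  rw [h, add_zero, ringPoint_depth_ringAngle, ite_self]

theorem rot_congr {g g' : ℝ → AddCircle (3 : ℝ)} {p : ℝ × ℝ} (h : g (depth p) = g' (depth p)) :
    rot g p = rot g' p := by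
  unfold rot
  rw [h]

/-- The unit square. -/
def square : Set (ℝ × ℝ) := Set.Icc 0 1 ×ˢ Set.Icc 0 1

theorem twistMap_eq_rot {p : ℝ × ℝ} (hp : p ∈ square) :
    twistMap p = rot (fun t => (angle t : AddCircle (3 : ℝ))) p := by
  obtain ⟨⟨h1, -⟩, h2, -⟩ := hp
  unfold rot
  split_ifs with h
  · conv_lhs => rw [← ringPoint_depth_ringAngle p]
    rw [twistMap_ringPoint h (depth_le p)]
  · refine twistMap_of_le h1 h2 ?_
    by_contra hcon
    exact h (le_min h1 (le_min h2 (by linarith)))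

theorem untwistMap_eq_rot {p : ℝ × ℝ} (hp : p ∈ square) :
    untwistMap p = rot (fun t => -(angle t : AddCircle (3 : ℝ))) p := by
  obtain ⟨⟨h1, -⟩, h2, -⟩ := hp
  unfold rot
  split_ifs with h
  · conv_lhs => rw [← ringPoint_depth_ringAngle p]
    rw [untwistMap_ringPoint h (depth_le p), sub_eq_add_neg]
  · refine untwistMap_of_le h1 h2 ?_
    by_contra hcon
    exact h (le_min h1 (le_min h2 (by linarith)))

/-- The reflection of the square in the first coordinate. -/
def flipFst (p : ℝ × ℝ) : ℝ × ℝ := (1 - p.1, p.2)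

/-- The reflection of the square in the second coordinate. -/
def flipSnd (p : ℝ × ℝ) : ℝ × ℝ := (p.1, 1 - p.2)

/-- A measure on the square that is invariant under the twist and the reflections, and vanishes on
the lines with integral coefficients. -/
structure TwistInvariant (ν : Measure (ℝ × ℝ)) : Prop where
  compl_square : ν squareᶜ = 0
  twist : MeasurePreserving twistMap ν ν
  untwist : MeasurePreserving untwistMap ν ν
  flip_fst : MeasurePreserving flipFst ν ν
  flip_snd : MeasurePreserving flipSnd ν ν
  line : ∀ a b c : ℤ, a ≠ 0 ∨ b ≠ 0 → ν {p | a * p.1 + b * p.2 = c} = 0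

theorem measurable_angle : Measurable angle := by
  unfold angle
  fun_prop

theorem measurable_coe_angle : Measurable fun t => (angle t : AddCircle (3 : ℝ)) :=
  AddCircle.measurable_mk'.comp measurable_angle

theorem measurable_zsmul_angle (k : ℤ) : Measurable fun t => k • (angle t : AddCircle (3 : ℝ)) :=
  (continuous_zsmul k).measurable.comp measurable_coe_angle

namespace TwistInvariant

variable {ν : Measure (ℝ × ℝ)}

theorem ae_mem_square (hν : TwistInvariant ν) : ∀ᵐ p ∂ν, p ∈ square := by
  rw [ae_iff]
  exact hν.compl_square

theorem rot_zsmul_angle (hν : TwistInvariant ν) (k : ℤ) :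
    MeasurePreserving (rot fun t => k • (angle t : AddCircle (3 : ℝ))) ν ν := by
  have h1 : MeasurePreserving (rot fun t => (angle t : AddCircle (3 : ℝ))) ν ν :=
    ⟨measurable_rot measurable_coe_angle, by
      rw [← hν.twist.map_eq]
      conv_lhs => rw [hν.twist.map_eq]
      exact Measure.map_congr (hν.ae_mem_square.mono fun p hp => (twistMap_eq_rot hp).symm)⟩
  have h2 : MeasurePreserving (rot fun t => -(angle t : AddCircle (3 : ℝ))) ν ν :=
    ⟨measurable_rot measurable_coe_angle.neg, by
      rw [← hν.untwist.map_eq]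
      conv_lhs => rw [hν.untwist.map_eq]
      exact Measure.map_congr (hν.ae_mem_square.mono fun p hp => (untwistMap_eq_rot hp).symm)⟩
  induction k using Int.induction_on with
  | zero =>
    have : (rot fun t => (0 : ℤ) • (angle t : AddCircle (3 : ℝ))) = id :=
      funext fun p => rot_of_eq_zero (zero_smul _ _)
    rw [this]
    exact MeasurePreserving.id ν
  | succ k ih =>
    have : (rot fun t => ((k : ℤ) + 1) • (angle t : AddCircle (3 : ℝ))) =
        (rot fun t => (angle t : AddCircle (3 : ℝ))) ∘
          rot fun t => (k : ℤ) • (angle t : AddCircle (3 : ℝ)) := by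
      funext p
      rw [Function.comp_apply, rot_rot]
      exact rot_congr (by rw [add_smul, one_smul])
    rw [this]
    exact h1.comp ih
  | pred k ih =>
    have : (rot fun t => (-(k : ℤ) - 1) • (angle t : AddCircle (3 : ℝ))) =
        (rot fun t => -(angle t : AddCircle (3 : ℝ))) ∘
          rot fun t => (-(k : ℤ)) • (angle t : AddCircle (3 : ℝ)) := by
      funext p
      rw [Function.comp_apply, rot_rot]
      exact rot_congr (by rw [sub_smul, one_smul, sub_eq_add_neg])
    rw [this]
    exact h2.comp ih

/-- Rotations preserve the depth, so the plane splits into the countably many sets on which `κ ∘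
depth` is constant, and on each of them the map is a fixed power of the twist. -/
theorem rot_measurable_zsmul_angle (hν : TwistInvariant ν) {κ : ℝ → ℤ} (hκ : Measurable κ) :
    MeasurePreserving (rot fun t => κ t • (angle t : AddCircle (3 : ℝ))) ν ν := by
  have hm : Measurable (rot fun t => κ t • (angle t : AddCircle (3 : ℝ))) :=
    measurable_rot ((measurable_from_prod_countable_left (f := fun z : AddCircle (3 : ℝ) × ℤ =>
      z.2 • z.1) fun k => (continuous_zsmul k).measurable).comp (measurable_coe_angle.prodMk hκ))
  refine ⟨hm, Measure.ext fun B hB => ?_⟩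
  rw [Measure.map_apply hm hB]
  have hκd : Measurable fun p => κ (depth p) := hκ.comp continuous_depth.measurable
  have split : ∀ A, MeasurableSet A → ν A = ∑' k : ℤ, ν ((fun p => κ (depth p)) ⁻¹' {k} ∩ A) := by
    intro A hA
    have := tsum_measure_preimage_singleton (μ := ν.restrict A) (Set.countable_univ (α := ℤ))
      (f := fun p => κ (depth p)) fun k _ => hκd (measurableSet_singleton k)
    rw [Set.preimage_univ, Measure.restrict_apply_univ, tsum_univ
      (fun k => ν.restrict A ((fun p => κ (depth p)) ⁻¹' {k}))] at this
    rw [← this]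
    exact tsum_congr fun k => Measure.restrict_apply (hκd (measurableSet_singleton k))
  rw [split _ (hm hB), split B hB]
  refine tsum_congr fun k => ?_
  have hk := hκd (measurableSet_singleton k)
  rw [← (hν.rot_zsmul_angle k).measure_preimage (hk.inter hB).nullMeasurableSet]
  congr 1
  ext p
  simp only [Set.mem_inter_iff, Set.mem_preimage, Set.mem_singleton_iff, depth_rot]
  refine and_congr_right fun h => ?_
  rw [rot_congr (g' := fun t => k • (angle t : AddCircle (3 : ℝ))) (by rw [h])]

theorem line_rat (hν : TwistInvariant ν) {a b : ℤ} (h : a ≠ 0 ∨ b ≠ 0) (q : ℚ) :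
    ν {p | a * p.1 + b * p.2 = (q : ℝ)} = 0 := by
  have hq : (q.den : ℤ) ≠ 0 := Int.natCast_ne_zero.2 q.den_nz
  refine measure_mono_null (fun p hp => ?_) (hν.line (q.den * a) (q.den * b) q.num
    (h.imp (mul_ne_zero hq) (mul_ne_zero hq)))
  rw [Set.mem_ofPred_eq] at hp ⊢
  have e : (q.den : ℝ) * q = q.num := by exact_mod_cast Rat.den_mul_eq_num q
  push_cast
  rw [← e, ← hp]
  ring

/-- A rational depth puts the point on one of countably many null lines parallel to the sides of the
triangle. -/
theorem ae_irrational_depth (hν : TwistInvariant ν) : ∀ᵐ p ∂ν, Irrational (depth p) := by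
  have h : ∀ q : ℚ, ∀ᵐ p ∂ν, depth p ≠ q := by
    intro q
    have h1 := measure_eq_zero_iff_ae_notMem.1 (hν.line_rat (a := 1) (b := 0) (Or.inl one_ne_zero) q)
    have h2 := measure_eq_zero_iff_ae_notMem.1 (hν.line_rat (a := 0) (b := 1) (Or.inr one_ne_zero) q)
    have h3 := measure_eq_zero_iff_ae_notMem.1 (hν.line_rat (a := 1) (b := 1) (Or.inr one_ne_zero)
      (1 - q))
    filter_upwards [h1, h2, h3] with p h1 h2 h3 hd
    push_cast at h1 h2 h3
    unfold depth at hd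
    rcases min_choice p.1 (min p.2 (1 - p.1 - p.2)) with e | e
    · exact h1 (by linarith)
    · rcases min_choice p.2 (1 - p.1 - p.2) with e' | e'
      · exact h2 (by linarith)
      · exact h3 (by linarith)
  filter_upwards [ae_all_iff.2 h] with p hp
  rintro ⟨q, hq⟩
  exact hp q hq.symm

end TwistInvariant

/-- The bound 1/4 is where `t = 1 - 3 * t`. Below it the angle is `t / (1 - 3 * t)`, and a rational
value could be solved for a rational `t`. The division by 3 compares the angle with the period. -/
theorem irrational_angle {t : ℝ} (h0 : 0 < t) (h1 : t < 1 / 4) (ht : Irrational t) :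
    Irrational (angle t / 3) := by
  rintro ⟨q, hq⟩
  have hl : 0 < 1 - 3 * t := by linarith
  have ha : angle t = t / (1 - 3 * t) := by
    unfold angle
    rw [min_eq_left (by linarith)]
  rw [ha] at hq
  have hq0 : (0 : ℝ) < q := by rw [hq]; positivity
  refine ht ⟨3 * q / (1 + 9 * q), ?_⟩
  push_cast
  rw [eq_div_iff three_ne_zero, eq_div_iff hl.ne'] at hq
  rw [div_eq_iff (by positivity)]
  linarith

/-- A measurable choice of multiples of `angle t` that approximate `g t`. -/
theorem exists_measurable_approx {g : ℝ → AddCircle (3 : ℝ)} (hg : Measurable g)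
    (hsupp : ∀ t, t ∉ Set.Ioo (0 : ℝ) (1 / 4) → g t = 0) {ε : ℝ} (hε : 0 < ε) :
    ∃ κ : ℝ → ℤ, Measurable κ ∧ ∀ t, Irrational t →
      ‖κ t • (angle t : AddCircle (3 : ℝ)) - g t‖ < ε := by
  classical
  let U : Set ℝ := Set.Ioo (0 : ℝ) (1 / 4) ∩ (Set.range ((↑) : ℚ → ℝ))ᶜ
  have hU : MeasurableSet U := measurableSet_Ioo.inter (Set.countable_range _).measurableSet.compl
  let e := Equiv.intEquivNat.symm
  have hex : ∀ t, ∃ j : ℕ, t ∉ U ∨ ‖e j • (angle t : AddCircle (3 : ℝ)) - g t‖ < ε := by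
    intro t
    by_cases ht : t ∈ U
    · have hd : DenseRange (· • (angle t : AddCircle (3 : ℝ)) : ℤ → AddCircle (3 : ℝ)) :=
        AddCircle.denseRange_zsmul_coe_iff.2 (irrational_angle ht.1.1 ht.1.2 ht.2)
      obtain ⟨k, hk⟩ := hd.exists_dist_lt (g t) hε
      refine ⟨e.symm k, Or.inr ?_⟩
      rw [Equiv.apply_symm_apply, ← dist_eq_norm, dist_comm]
      exact hk
    · exact ⟨0, Or.inl ht⟩
  -- Taking the first suitable integer in an enumeration makes the choice measurable.
  have hfind : Measurable fun t => Nat.find (hex t) := by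
    refine measurable_find hex fun j => ?_
    exact hU.compl.union (measurableSet_lt
      (((measurable_zsmul_angle (e j)).sub hg).norm) measurable_const)
  refine ⟨fun t => if t ∈ U then e (Nat.find (hex t)) else 0,
    Measurable.ite hU (measurable_from_nat.comp hfind) measurable_const, fun t ht => ?_⟩
  by_cases htU : t ∈ U
  · simp only [if_pos htU]
    exact (Nat.find_spec (hex t)).resolve_left (not_not.2 htU)
  · simp only [if_neg htU]
    rwa [hsupp t fun h => htU ⟨h, ht⟩, zero_smul, sub_zero, norm_zero]

/-- Measurably chosen multiples of the twist converge almost everywhere to the rotation by `g`;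
dominated convergence passes the invariance of integrals of bounded continuous functions to the
limit. -/
theorem TwistInvariant.measurePreserving_rot {ν : Measure (ℝ × ℝ)} [IsFiniteMeasure ν]
    (hν : TwistInvariant ν) {g : ℝ → AddCircle (3 : ℝ)} (hg : Measurable g)
    (hsupp : ∀ t, t ∉ Set.Ioo (0 : ℝ) (1 / 4) → g t = 0) : MeasurePreserving (rot g) ν ν := by
  have hm := measurable_rot hg
  refine ⟨hm, ext_of_forall_integral_eq_of_IsFiniteMeasure fun φ => ?_⟩
  choose κ hκ hκg using fun N : ℕ =>
    exists_measurable_approx hg hsupp (ε := 1 / ((N : ℝ) + 1)) (by positivity)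
  have hconst : ∀ N, ∫ p, φ (rot (fun t => κ N t • (angle t : AddCircle (3 : ℝ))) p) ∂ν =
      ∫ p, φ p ∂ν := by
    intro N
    have := hν.rot_measurable_zsmul_angle (hκ N)
    conv_rhs => rw [← this.map_eq]
    rw [integral_map this.measurable.aemeasurable φ.continuous.aestronglyMeasurable]
  rw [integral_map hm.aemeasurable φ.continuous.aestronglyMeasurable]
  have hlim : Tendsto (fun N : ℕ => ∫ p, φ (rot (fun t => κ N t • (angle t : AddCircle (3 : ℝ))) p)
      ∂ν) atTop (𝓝 (∫ p, φ (rot g p) ∂ν)) := by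
    refine tendsto_integral_of_dominated_convergence (fun _ => ‖φ‖) (fun N => ?_)
      (integrable_const _) (fun N => ae_of_all _ fun p => φ.norm_coe_le_norm _) ?_
    · exact φ.continuous.aestronglyMeasurable.comp_measurable
        (hν.rot_measurable_zsmul_angle (hκ N)).measurable
    · filter_upwards [hν.ae_irrational_depth] with p hp
      have h1 : Tendsto (fun N => κ N (depth p) • (angle (depth p) : AddCircle (3 : ℝ))) atTop
          (𝓝 (g (depth p))) := by
        rw [tendsto_iff_norm_sub_tendsto_zero]
        exact squeeze_zero (fun _ => norm_nonneg _) (fun N => (hκg N _ hp).le)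
          tendsto_one_div_add_atTop_nhds_zero_nat
      refine (φ.continuous.tendsto _).comp ?_
      unfold rot
      split_ifs with h
      · exact ((continuous_ringPoint.comp (continuous_const.prodMk
          (continuous_const.add continuous_id))).tendsto (g (depth p))).comp h1
      · exact tendsto_const_nhds
  rw [tendsto_congr hconst] at hlim
  exact tendsto_nhds_unique hlim tendsto_const_nhds

end RingTwist

/-! ### Translations of a small parallelogram and Haar measure on a torus -/

namespace RingTwist

theorem ringPoint_bottom (t : ℝ) {u : ℝ} (hu : u ∈ Set.Icc (0 : ℝ) 1) :
    ringPoint t ((2 + u : ℝ) : AddCircle (3 : ℝ)) = (t + (1 - 3 * t) * u, t) := by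
  obtain ⟨hu0, hu1⟩ := hu
  have e : ((2 + u : ℝ) : AddCircle (3 : ℝ)) = ((u - 1 : ℝ) : AddCircle (3 : ℝ)) := by
    rw [← coe_add_three (u - 1)]; ring_nf
  refine Prod.ext ?_ ?_
  · change ringCoord t ((2 + u : ℝ) : AddCircle (3 : ℝ)) = t + (1 - 3 * t) * u
    rw [e, ringCoord, tent_coe (by rw [abs_le]; constructor <;> linarith),
      abs_of_nonpos (by linarith), max_eq_right (by linarith)]
    ring
  · change ringCoord t ((2 + u - 1 : ℝ) : AddCircle (3 : ℝ)) = t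
    rw [ringCoord, tent_coe (by rw [abs_le]; constructor <;> linarith),
      abs_of_nonneg (by linarith), max_eq_left (by linarith)]
    ring

theorem ringPoint_hypotenuse (t : ℝ) {u : ℝ} (hu : u ∈ Set.Icc (0 : ℝ) 1) :
    ringPoint t (u : AddCircle (3 : ℝ)) = (t + (1 - 3 * t) * (1 - u), t + (1 - 3 * t) * u) := by
  obtain ⟨hu0, hu1⟩ := hu
  refine Prod.ext ?_ ?_
  · change ringCoord t (u : AddCircle (3 : ℝ)) = t + (1 - 3 * t) * (1 - u)
    rw [ringCoord, tent_coe (by rw [abs_le]; constructor <;> linarith),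
      abs_of_nonneg (by linarith), max_eq_right (by linarith)]
  · change ringCoord t ((u - 1 : ℝ) : AddCircle (3 : ℝ)) = t + (1 - 3 * t) * u
    rw [ringCoord, tent_coe (by rw [abs_le]; constructor <;> linarith),
      abs_of_nonpos (by linarith), max_eq_right (by linarith)]
    ring

open Classical in
/-- The restriction of `g` to the depths less than `1 / 4`, extended by `0`. -/
noncomputable def trunc (g : ℝ → AddCircle (3 : ℝ)) (t : ℝ) : AddCircle (3 : ℝ) :=
  if t ∈ Set.Ioo (0 : ℝ) (1 / 4) then g t else 0

theorem measurable_trunc {g : ℝ → AddCircle (3 : ℝ)} (hg : Measurable g) : Measurable (trunc g) :=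
  Measurable.ite measurableSet_Ioo hg measurable_const

theorem rot_trunc_neg (g : ℝ → AddCircle (3 : ℝ)) (p : ℝ × ℝ) :
    rot (trunc fun t => -g t) (rot (trunc g) p) = p := by
  rw [rot_rot]
  refine rot_of_eq_zero ?_
  unfold trunc
  split_ifs
  · exact add_neg_cancel _
  · exact add_zero _

theorem TwistInvariant.measurePreserving_rot_trunc {ν : Measure (ℝ × ℝ)} [IsFiniteMeasure ν]
    (hν : TwistInvariant ν) {g : ℝ → AddCircle (3 : ℝ)} (hg : Measurable g) :
    MeasurePreserving (rot (trunc g)) ν ν :=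
  hν.measurePreserving_rot (measurable_trunc hg) fun _ ht => if_neg ht

theorem rot_trunc_ringPoint (g : ℝ → AddCircle (3 : ℝ)) {t : ℝ} (ht : t ∈ Set.Ioo (0 : ℝ) (1 / 4))
    (θ : AddCircle (3 : ℝ)) : rot (trunc g) (ringPoint t θ) = ringPoint t (θ + g t) := by
  rw [rot_ringPoint _ ht.1.le (by linarith [ht.2])]
  unfold trunc
  rw [if_pos ht]

/-- The rotation of the rings by the length `c`. -/
noncomputable def flow (c : ℝ) : ℝ × ℝ → ℝ × ℝ :=
  rot (trunc fun t => ((c / (1 - 3 * t) : ℝ) : AddCircle (3 : ℝ)))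

theorem flow_neg (c : ℝ) (p : ℝ × ℝ) : flow (-c) (flow c p) = p := by
  have := rot_trunc_neg (fun t => ((c / (1 - 3 * t) : ℝ) : AddCircle (3 : ℝ))) p
  simp only [← AddCircle.coe_neg, ← neg_div] at this
  exact this

theorem TwistInvariant.flow {ν : Measure (ℝ × ℝ)} [IsFiniteMeasure ν]
    (hν : TwistInvariant ν) (c : ℝ) : MeasurePreserving (flow c) ν ν :=
  hν.measurePreserving_rot_trunc (AddCircle.measurable_mk'.comp (by fun_prop))

theorem flow_bottom {s r c : ℝ} (hs : s ∈ Set.Ioo (0 : ℝ) (1 / 4))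
    (hr : r ∈ Set.Icc 0 (1 - 3 * s)) (hrc : r + c ∈ Set.Icc 0 (1 - 3 * s)) :
    flow c (s + r, s) = (s + (r + c), s) := by
  have hl : 0 < 1 - 3 * s := by linarith [hs.2]
  have key : ∀ v ∈ Set.Icc 0 (1 - 3 * s),
      (s + v, s) = ringPoint s ((2 + v / (1 - 3 * s) : ℝ) : AddCircle (3 : ℝ)) := fun v hv => by
    rw [ringPoint_bottom s ⟨div_nonneg hv.1 hl.le, (div_le_one hl).2 hv.2⟩, mul_div_cancel₀ _ hl.ne']
  rw [key r hr, key _ hrc, flow, rot_trunc_ringPoint _ hs, ← AddCircle.coe_add]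
  congr 2
  ring

theorem flow_hypotenuse {s r c : ℝ} (hs : s ∈ Set.Ioo (0 : ℝ) (1 / 4))
    (hr : r ∈ Set.Icc 0 (1 - 3 * s)) (hrc : r + c ∈ Set.Icc 0 (1 - 3 * s)) :
    flow c (1 - 2 * s - r, s + r) = (1 - 2 * s - (r + c), s + (r + c)) := by
  have hl : 0 < 1 - 3 * s := by linarith [hs.2]
  have key : ∀ v ∈ Set.Icc 0 (1 - 3 * s),
      (1 - 2 * s - v, s + v) = ringPoint s ((v / (1 - 3 * s) : ℝ) : AddCircle (3 : ℝ)) := fun v hv => by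
    rw [ringPoint_hypotenuse s ⟨div_nonneg hv.1 hl.le, (div_le_one hl).2 hv.2⟩, mul_one_sub,
      mul_div_cancel₀ _ hl.ne']
    refine Prod.ext ?_ rfl
    simp only
    ring
  rw [key r hr, key _ hrc, flow, rot_trunc_ringPoint _ hs, ← AddCircle.coe_add]
  congr 2
  ring

theorem flipFst_flipFst (p : ℝ × ℝ) : flipFst (flipFst p) = p :=
  Prod.ext (sub_sub_cancel _ _) rfl

theorem flipSnd_flipSnd (p : ℝ × ℝ) : flipSnd (flipSnd p) = p :=
  Prod.ext rfl (sub_sub_cancel _ _)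

/-- The conjugate of the flow by a reflection. -/
noncomputable def slide (c : ℝ) (p : ℝ × ℝ) : ℝ × ℝ := flipFst (flow c (flipFst p))

theorem slide_neg (c : ℝ) (p : ℝ × ℝ) : slide (-c) (slide c p) = p := by
  unfold slide
  rw [flipFst_flipFst, flow_neg, flipFst_flipFst]

theorem TwistInvariant.slide {ν : Measure (ℝ × ℝ)} [IsFiniteMeasure ν]
    (hν : TwistInvariant ν) (c : ℝ) : MeasurePreserving (slide c) ν ν :=
  hν.flip_fst.comp ((hν.flow c).comp hν.flip_fst)

/-- The reflection turns the side of a ring along the hypotenuse into a segment parallel to the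
diagonal. The conjugated flow translates along it, in a direction independent of that of
`flow_bottom`. -/
theorem slide_bottom {s r c : ℝ} (hr : r ∈ Set.Ioo (0 : ℝ) (1 / 4))
    (hs : s ∈ Set.Icc r (1 - 2 * r)) (hsc : s + c ∈ Set.Icc r (1 - 2 * r)) :
    slide c (s + r, s) = (s + c + r, s + c) := by
  have e : flipFst (s + r, s) = (1 - 2 * r - (s - r), r + (s - r)) :=
    Prod.ext (by simp only [flipFst]; ring) (by simp only [flipFst]; ring)
  obtain ⟨h1, h2⟩ := hs
  obtain ⟨h3, h4⟩ := hsc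
  unfold slide
  rw [e, flow_hypotenuse hr ⟨by linarith, by linarith⟩ ⟨by linarith, by linarith⟩]
  exact Prod.ext (by simp only [flipFst]; ring) (by simp only [flipFst]; ring)

/-- A measure that is invariant under those translations of subsets of a strip that stay in the
strip is invariant under translations that wrap around the strip. -/
theorem measure_wrap {X : Type*} [MeasurableSpace X] (w : Measure X) {τ : ℝ → X → X}
    (hadd : ∀ c d p, τ c (τ d p) = τ (c + d) p)
    {x : X → ℝ} (hx : Measurable x) (hxτ : ∀ c p, x (τ c p) = x p + c)
    {Q₀ : Set X} (hQ₀ : MeasurableSet Q₀) (hQτ : ∀ c p, τ c p ∈ Q₀ ↔ p ∈ Q₀) {a L : ℝ}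
    (hinv : ∀ c B, MeasurableSet B → B ⊆ x ⁻¹' Set.Ioc a (a + L) ∩ Q₀ →
      τ c ⁻¹' B ⊆ x ⁻¹' Set.Ioc a (a + L) ∩ Q₀ → w (τ c ⁻¹' B) = w B)
    {E : Set X} (hE : MeasurableSet E) (hEτ : ∀ p, τ L p ∈ E ↔ p ∈ E)
    {c : ℝ} (hc : 0 ≤ c) (hcL : c ≤ L) :
    w (x ⁻¹' Set.Ioc a (a + L) ∩ Q₀ ∩ τ c ⁻¹' E) = w (x ⁻¹' Set.Ioc a (a + L) ∩ Q₀ ∩ E) := by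
  have hEτ' : ∀ p, τ (c - L) p ∈ E ↔ τ c p ∈ E := fun p => by
    rw [← hEτ, hadd, add_sub_cancel]
  have mem : ∀ p, p ∈ x ⁻¹' Set.Ioc a (a + L) ∩ Q₀ ∩ E ↔
    ((a < x p ∧ x p ≤ a + L) ∧ p ∈ Q₀) ∧ p ∈ E := fun p => Iff.rfl
  have hs1 : MeasurableSet (x ⁻¹' Set.Iic (a + L - c)) := hx measurableSet_Iic
  have hs2 : MeasurableSet (x ⁻¹' Set.Ioi (a + c)) := hx measurableSet_Ioi
  have hQE : MeasurableSet (x ⁻¹' Set.Ioc a (a + L) ∩ Q₀ ∩ E) :=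
    ((hx measurableSet_Ioc).inter hQ₀).inter hE
  -- The part that stays in the strip under the translation by `c`; the remaining part leaves the
  -- strip and is moved by `c - L` instead.
  have h1 : x ⁻¹' Set.Ioc a (a + L) ∩ Q₀ ∩ τ c ⁻¹' E ∩ x ⁻¹' Set.Iic (a + L - c) =
      τ c ⁻¹' (x ⁻¹' Set.Ioc a (a + L) ∩ Q₀ ∩ E ∩ x ⁻¹' Set.Ioi (a + c)) := by
    ext p
    simp only [Set.mem_inter_iff, Set.mem_preimage, Set.mem_Ioc, Set.mem_Iic, Set.mem_Ioi, hxτ,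
      hQτ]
    constructor
    · rintro ⟨⟨⟨⟨h1, h2⟩, h3⟩, h4⟩, h5⟩
      exact ⟨⟨⟨⟨by linarith, by linarith⟩, h3⟩, h4⟩, by linarith⟩
    · rintro ⟨⟨⟨⟨h1, h2⟩, h3⟩, h4⟩, h5⟩
      exact ⟨⟨⟨⟨by linarith, by linarith⟩, h3⟩, h4⟩, by linarith⟩
  have h2 : (x ⁻¹' Set.Ioc a (a + L) ∩ Q₀ ∩ τ c ⁻¹' E) \ x ⁻¹' Set.Iic (a + L - c) =
      τ (c - L) ⁻¹' ((x ⁻¹' Set.Ioc a (a + L) ∩ Q₀ ∩ E) \ x ⁻¹' Set.Ioi (a + c)) := by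
    ext p
    simp only [Set.mem_inter_iff, Set.mem_preimage, Set.mem_Ioc, Set.mem_Iic, Set.mem_Ioi, hxτ,
      hQτ, Set.mem_sdiff, hEτ', not_le, not_lt]
    constructor
    · rintro ⟨⟨⟨⟨h1, h2⟩, h3⟩, h4⟩, h5⟩
      exact ⟨⟨⟨⟨by linarith, by linarith⟩, h3⟩, h4⟩, by linarith⟩
    · rintro ⟨⟨⟨⟨h1, h2⟩, h3⟩, h4⟩, h5⟩
      exact ⟨⟨⟨⟨by linarith, by linarith⟩, h3⟩, h4⟩, by linarith⟩
  rw [← measure_inter_add_sdiff (x ⁻¹' Set.Ioc a (a + L) ∩ Q₀ ∩ τ c ⁻¹' E) hs1,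
    ← measure_inter_add_sdiff (x ⁻¹' Set.Ioc a (a + L) ∩ Q₀ ∩ E) hs2]
  congr 1
  · rw [h1]
    refine hinv c _ (hQE.inter hs2) (fun p hp => hp.1.1) ?_
    rw [← h1]
    exact fun p hp => hp.1.1
  · rw [h2]
    refine hinv (c - L) _ (hQE.diff hs2) (fun p hp => hp.1.1) ?_
    rw [← h2]
    exact fun p hp => hp.1.1

/-- Since `Φ` is known to be `τ` only where point and image lie in `Q`, other points might enter `B`
under `Φ`; the agreement of the inverses excludes this. -/
theorem measure_preimage_of_eqOn {X : Type*} [MeasurableSpace X] {ν : Measure X}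
    {τ τ' Φ Φ' : X → X} (hΦ : MeasurePreserving Φ ν ν) (hΦ' : ∀ p, Φ' (Φ p) = p) {Q : Set X}
    (h : ∀ p ∈ Q, τ p ∈ Q → Φ p = τ p) (h' : ∀ p ∈ Q, τ' p ∈ Q → Φ' p = τ' p)
    (hτ : ∀ p, τ (τ' p) = p) {B : Set X} (hB : MeasurableSet B) (hBQ : B ⊆ Q)
    (hτB : τ ⁻¹' B ⊆ Q) : ν (τ ⁻¹' B) = ν B := by
  have e : τ ⁻¹' B = Φ ⁻¹' B := by
    ext p
    constructor
    · intro hp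
      change Φ p ∈ B
      rw [h p (hτB hp) (hBQ hp)]
      exact hp
    · intro (hp : Φ p ∈ B)
      have h1 : τ' (Φ p) ∈ τ ⁻¹' B := by
        change τ (τ' (Φ p)) ∈ B
        rwa [hτ]
      have h2 := h' _ (hBQ hp) (hτB h1)
      rw [hΦ'] at h2
      rwa [← h2] at h1
  rw [e, hΦ.measure_preimage hB.nullMeasurableSet]

/-- A small parallelogram near the bottom side of the triangle. -/
def patch : Set (ℝ × ℝ) :=
  -- On this set `p.2` is the depth of the point and `p.1 - p.2` the depth of its reflection. Both
  -- are below 1/4 and the point is on one side of each ring, so `flow` and `slide` act by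
  -- translations as long as the image stays in the set.
  (fun p => p.1 - p.2) ⁻¹' Set.Ioc (1 / 16) (1 / 16 + 1 / 16) ∩
    Prod.snd ⁻¹' Set.Ioc (1 / 8) (1 / 8 + 1 / 16)

theorem measurableSet_patch : MeasurableSet patch :=
  ((measurable_fst.sub measurable_snd) measurableSet_Ioc).inter (measurable_snd measurableSet_Ioc)

theorem flow_of_mem_patch {c : ℝ} {p : ℝ × ℝ} (hp : p ∈ patch) (hpc : (p.1 + c, p.2) ∈ patch) :
    flow c p = (p.1 + c, p.2) := by
  obtain ⟨⟨h1, h2⟩, h3, h4⟩ := hp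
  obtain ⟨⟨h5, h6⟩, -, -⟩ := hpc
  simp only at h1 h2 h5 h6
  have := flow_bottom (s := p.2) (r := p.1 - p.2) (c := c) ⟨by linarith, by linarith⟩
    ⟨by linarith, by linarith⟩ ⟨by linarith, by linarith⟩
  rw [add_sub_cancel] at this
  refine this.trans (Prod.ext ?_ rfl)
  simp only
  ring

theorem slide_of_mem_patch {c : ℝ} {p : ℝ × ℝ} (hp : p ∈ patch)
    (hpc : (p.1 + c, p.2 + c) ∈ patch) : slide c p = (p.1 + c, p.2 + c) := by
  obtain ⟨⟨h1, h2⟩, h3, h4⟩ := hp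
  obtain ⟨-, h5, h6⟩ := hpc
  simp only at h1 h2 h5 h6
  have := slide_bottom (s := p.2) (r := p.1 - p.2) (c := c) ⟨by linarith, by linarith⟩
    ⟨by linarith, by linarith⟩ ⟨by linarith, by linarith⟩
  rw [add_sub_cancel] at this
  refine this.trans (Prod.ext ?_ rfl)
  simp only
  ring

instance fact_one_div_sixteen : Fact ((0 : ℝ) < 1 / 16) := ⟨by norm_num⟩

/-- The parallelogram wrapped to a torus. -/
noncomputable def toTorus (p : ℝ × ℝ) : AddCircle (1 / 16 : ℝ) × AddCircle (1 / 16 : ℝ) :=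
  (((p.1 - p.2 : ℝ) : AddCircle (1 / 16 : ℝ)), (p.2 : AddCircle (1 / 16 : ℝ)))

theorem measurable_toTorus : Measurable toTorus :=
  (AddCircle.measurable_mk'.comp (measurable_fst.sub measurable_snd)).prodMk
    (AddCircle.measurable_mk'.comp measurable_snd)

/-- The inverse of `toTorus` with values in the parallelogram. -/
noncomputable def ofTorus (z : AddCircle (1 / 16 : ℝ) × AddCircle (1 / 16 : ℝ)) : ℝ × ℝ :=
  ((AddCircle.equivIoc (1 / 16 : ℝ) (1 / 8) z.2 : ℝ) +
    (AddCircle.equivIoc (1 / 16 : ℝ) (1 / 16) z.1 : ℝ),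
    (AddCircle.equivIoc (1 / 16 : ℝ) (1 / 8) z.2 : ℝ))

theorem measurable_ofTorus : Measurable ofTorus := by
  have h : ∀ a : ℝ, Measurable fun z : AddCircle (1 / 16 : ℝ) =>
      (AddCircle.equivIoc (1 / 16 : ℝ) a z : ℝ) := fun a =>
    measurable_subtype_coe.comp (AddCircle.measurableEquivIoc (1 / 16 : ℝ) a).measurable
  exact (((h _).comp measurable_snd).add ((h _).comp measurable_fst)).prodMk
    ((h _).comp measurable_snd)

theorem ofTorus_toTorus {p : ℝ × ℝ} (hp : p ∈ patch) : ofTorus (toTorus p) = p := by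
  obtain ⟨h1, h2⟩ := hp
  unfold ofTorus toTorus
  simp only
  rw [AddCircle.equivIoc_coe_eq h1, AddCircle.equivIoc_coe_eq h2]
  exact Prod.ext (add_sub_cancel _ _) rfl

/-- The flow translates the torus coordinate `p.1 - p.2` and fixes `p.2`; the slide does the
opposite. By `measure_wrap` the translations inside the parallelogram give all translations of the
torus. -/
theorem map_toTorus_invariant {ν : Measure (ℝ × ℝ)} [IsFiniteMeasure ν] (hν : TwistInvariant ν) :
    ((ν.restrict patch).map toTorus).IsAddLeftInvariant := by
  have period : ∀ r : ℝ, ((r + 1 / 16 : ℝ) : AddCircle (1 / 16 : ℝ)) = r := fun r =>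
    AddCircle.coe_add_period _ r
  have hQ : ∀ {F : Set (AddCircle (1 / 16 : ℝ) × AddCircle (1 / 16 : ℝ))}, MeasurableSet F →
      (ν.restrict patch).map toTorus F = ν (patch ∩ toTorus ⁻¹' F) := fun hF => by
    rw [Measure.map_apply measurable_toTorus hF,
      Measure.restrict_apply (measurable_toTorus hF), Set.inter_comm]
  have inv1 : ∀ g : AddCircle (1 / 16 : ℝ), ∀ F, MeasurableSet F →
      (ν.restrict patch).map toTorus ((fun z => (g, 0) + z) ⁻¹' F) =
        (ν.restrict patch).map toTorus F := by
    intro g F hF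
    obtain ⟨c, ⟨hc, hcL⟩, rfl⟩ := AddCircle.eq_coe_Ico g
    have hF' := measurable_const_add ((c : AddCircle (1 / 16 : ℝ)), (0 : AddCircle (1 / 16 : ℝ))) hF
    rw [hQ hF, hQ hF']
    refine Eq.trans ?_ (measure_wrap ν (τ := fun c p => (p.1 + c, p.2)) (x := fun p => p.1 - p.2)
      (Q₀ := Prod.snd ⁻¹' Set.Ioc (1 / 8) (1 / 8 + 1 / 16))
      (fun c d p => Prod.ext (by simp only; ring) rfl)
      (measurable_fst.sub measurable_snd) (fun c p => by simp only; ring)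
      (measurable_snd measurableSet_Ioc) (fun c p => Iff.rfl) (fun c B hB h1 h2 =>
        measure_preimage_of_eqOn (τ' := fun p => (p.1 + -c, p.2)) (hν.flow c) (flow_neg c)
        (fun p => flow_of_mem_patch) (fun p => flow_of_mem_patch)
        (fun p => Prod.ext (neg_add_cancel_right _ _) rfl) hB h1 h2)
      (measurable_toTorus hF) (fun p => ?_) hc hcL.le)
    · congr 2
      ext p
      change ((c : AddCircle (1 / 16 : ℝ)), (0 : AddCircle (1 / 16 : ℝ))) + toTorus p ∈ F ↔ toTorus (p.1 + c, p.2) ∈ F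
      have : toTorus (p.1 + c, p.2) =
          ((c : AddCircle (1 / 16 : ℝ)), (0 : AddCircle (1 / 16 : ℝ))) + toTorus p := by
        refine Prod.ext ?_ (zero_add _).symm
        change ((p.1 + c - p.2 : ℝ) : AddCircle (1 / 16 : ℝ)) = (c : AddCircle (1 / 16 : ℝ)) +
          (p.1 - p.2 : ℝ)
        rw [← AddCircle.coe_add]
        congr 1
        ring
      rw [this]
    · change toTorus (p.1 + 1 / 16, p.2) ∈ F ↔ toTorus p ∈ F
      have : toTorus (p.1 + 1 / 16, p.2) = toTorus p := by
        refine Prod.ext ?_ rfl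
        change ((p.1 + 1 / 16 - p.2 : ℝ) : AddCircle (1 / 16 : ℝ)) = (p.1 - p.2 : ℝ)
        rw [← period (p.1 - p.2)]
        congr 1
        ring
      rw [this]
  have inv2 : ∀ g : AddCircle (1 / 16 : ℝ), ∀ F, MeasurableSet F →
      (ν.restrict patch).map toTorus ((fun z => (0, g) + z) ⁻¹' F) =
        (ν.restrict patch).map toTorus F := by
    intro g F hF
    obtain ⟨c, ⟨hc, hcL⟩, rfl⟩ := AddCircle.eq_coe_Ico g
    have hF' := measurable_const_add ((0 : AddCircle (1 / 16 : ℝ)), (c : AddCircle (1 / 16 : ℝ))) hF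
    rw [hQ hF, hQ hF']
    have hw := measure_wrap ν (τ := fun c p => (p.1 + c, p.2 + c)) (x := Prod.snd)
      (Q₀ := (fun p : ℝ × ℝ => p.1 - p.2) ⁻¹' Set.Ioc (1 / 16) (1 / 16 + 1 / 16))
      (a := 1 / 8) (L := 1 / 16) (E := toTorus ⁻¹' F) (c := c)
      (fun c d p => Prod.ext (by simp only; ring) (by simp only; ring))
      measurable_snd (fun c p => rfl)
      ((measurable_fst.sub measurable_snd) measurableSet_Ioc)
      (fun c p => by simp only [Set.mem_preimage, add_sub_add_right_eq_sub])
      (fun c B hB h1 h2 => by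
        rw [Set.inter_comm] at h1 h2
        exact measure_preimage_of_eqOn (τ' := fun p => (p.1 + -c, p.2 + -c)) (hν.slide c)
          (slide_neg c) (fun p => slide_of_mem_patch) (fun p => slide_of_mem_patch)
          (fun p => Prod.ext (neg_add_cancel_right _ _) (neg_add_cancel_right _ _)) hB h1 h2)
      (measurable_toTorus hF) (fun p => ?_) hc hcL.le
    · rw [Set.inter_comm (Prod.snd ⁻¹' _)] at hw
      refine Eq.trans ?_ hw
      congr 2
      ext p
      change ((0 : AddCircle (1 / 16 : ℝ)), (c : AddCircle (1 / 16 : ℝ))) + toTorus p ∈ F ↔ toTorus (p.1 + c, p.2 + c) ∈ F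
      have : toTorus (p.1 + c, p.2 + c) =
          ((0 : AddCircle (1 / 16 : ℝ)), (c : AddCircle (1 / 16 : ℝ))) + toTorus p := by
        refine Prod.ext ?_ ?_
        · change ((p.1 + c - (p.2 + c) : ℝ) : AddCircle (1 / 16 : ℝ)) = 0 + (p.1 - p.2 : ℝ)
          rw [zero_add, add_sub_add_right_eq_sub]
        · change ((p.2 + c : ℝ) : AddCircle (1 / 16 : ℝ)) = c + (p.2 : ℝ)
          rw [← AddCircle.coe_add, add_comm]
      rw [this]
    · change toTorus (p.1 + 1 / 16, p.2 + 1 / 16) ∈ F ↔ toTorus p ∈ F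
      have : toTorus (p.1 + 1 / 16, p.2 + 1 / 16) = toTorus p := by
        refine Prod.ext ?_ (period _)
        change ((p.1 + 1 / 16 - (p.2 + 1 / 16) : ℝ) : AddCircle (1 / 16 : ℝ)) = (p.1 - p.2 : ℝ)
        rw [add_sub_add_right_eq_sub]
      rw [this]
  refine ⟨fun g => Measure.ext fun F hF => ?_⟩
  rw [Measure.map_apply (measurable_const_add g) hF]
  have e : (fun z => g + z) ⁻¹' F =
      (fun z => ((0 : AddCircle (1 / 16 : ℝ)), g.2) + z) ⁻¹'
        ((fun z => (g.1, (0 : AddCircle (1 / 16 : ℝ))) + z) ⁻¹' F) := by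
    ext z
    simp only [Set.mem_preimage]
    rw [← add_assoc]
    have : g = (g.1, (0 : AddCircle (1 / 16 : ℝ))) + (0, g.2) :=
      Prod.ext (add_zero _).symm (zero_add _).symm
    rw [← this]
  rw [e, inv2 _ _ (measurable_const_add _ hF), inv1 _ _ hF]

/-- On the parallelogram, all twist-invariant measures are proportional. -/
theorem exists_restrict_patch_eq : ∃ M : Measure (ℝ × ℝ), ∀ (ν : Measure (ℝ × ℝ))
    [IsFiniteMeasure ν], TwistInvariant ν → ∃ κ : NNReal, ν.restrict patch = κ • M := by
  let H : Measure (AddCircle (1 / 16 : ℝ) × AddCircle (1 / 16 : ℝ)) := Measure.addHaar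
  refine ⟨H.map ofTorus, fun ν _ hν => ?_⟩
  have := map_toTorus_invariant hν
  refine ⟨Measure.addHaarScalarFactor ((ν.restrict patch).map toTorus) H, ?_⟩
  -- Uniqueness of Haar measure on the torus, transported back to the parallelogram.
  rw [← Measure.map_smul, ← Measure.isAddLeftInvariant_eq_smul, Measure.map_map
    measurable_ofTorus measurable_toTorus]
  conv_lhs => rw [← Measure.map_id (μ := ν.restrict patch)]
  refine Measure.map_congr ?_
  filter_upwards [ae_restrict_mem measurableSet_patch] with p hp
  exact (ofTorus_toTorus hp).symm

end RingTwist

/-! ### From the parallelogram to the square -/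

namespace RingTwist

theorem TwistInvariant.smul {ν : Measure (ℝ × ℝ)} (hν : TwistInvariant ν) (κ : NNReal) :
    TwistInvariant (κ • ν) where
  compl_square := by rw [Measure.smul_apply, hν.compl_square, smul_zero]
  twist := hν.twist.smul_measure κ
  untwist := hν.untwist.smul_measure κ
  flip_fst := hν.flip_fst.smul_measure κ
  flip_snd := hν.flip_snd.smul_measure κ
  line a b c h := by rw [Measure.smul_apply, hν.line a b c h, smul_zero]

/-- On the preimage of `A` both measures are carried by `Φ` to the same measure on `A`, and `Ψ`
undoes `Φ`. -/
theorem restrict_preimage_congr {X : Type*} [MeasurableSpace X] {ν ν' : Measure X} {Φ Ψ : X → X}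
    (h : MeasurePreserving Φ ν ν) (h' : MeasurePreserving Φ ν' ν') (hΨ : Measurable Ψ)
    (hΨΦ : ∀ p, Ψ (Φ p) = p) {A : Set X} (hA : MeasurableSet A)
    (e : ν.restrict A = ν'.restrict A) :
    ν.restrict (Φ ⁻¹' A) = ν'.restrict (Φ ⁻¹' A) := by
  have e1 := (h.restrict_preimage hA).map_eq
  have e2 := (h'.restrict_preimage hA).map_eq
  have e3 := congrArg (Measure.map Ψ) (e1.trans (e.trans e2.symm))
  have hid : Ψ ∘ Φ = id := funext hΨΦ
  rwa [Measure.map_map hΨ h.measurable, Measure.map_map hΨ h.measurable, hid, Measure.map_id,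
    Measure.map_id] at e3

/-- When `A` contains an arc of each ring with depth in `I`, countably many rational rotations of
`A` cover these rings. -/
theorem TwistInvariant.restrict_depth_congr {ν ν' : Measure (ℝ × ℝ)} [IsFiniteMeasure ν]
    [IsFiniteMeasure ν'] (hν : TwistInvariant ν) (hν' : TwistInvariant ν') {A : Set (ℝ × ℝ)}
    (hA : MeasurableSet A) (e : ν.restrict A = ν'.restrict A) {I : Set ℝ}
    (hI : I ⊆ Set.Ioo 0 (1 / 4)) (hex : ∀ t ∈ I, ∃ u v : ℝ, u < v ∧ ∀ w ∈ Set.Ioo u v,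
      ringPoint t (w : AddCircle (3 : ℝ)) ∈ A) :
    ν.restrict (depth ⁻¹' I) = ν'.restrict (depth ⁻¹' I) := by
  let g : ℚ → ℝ → AddCircle (3 : ℝ) := fun q _ => ((q : ℝ) : AddCircle (3 : ℝ))
  have hg : ∀ q, Measurable (g q) := fun q => measurable_const
  have h : ν.restrict (⋃ q : ℚ, rot (trunc (g q)) ⁻¹' A) =
      ν'.restrict (⋃ q : ℚ, rot (trunc (g q)) ⁻¹' A) :=
    Measure.restrict_iUnion_congr.2 fun q =>
      restrict_preimage_congr (hν.measurePreserving_rot_trunc (hg q))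
        (hν'.measurePreserving_rot_trunc (hg q)) (measurable_rot (measurable_trunc (hg q).neg))
        (rot_trunc_neg _) hA e
  refine Measure.restrict_congr_mono (fun p hp => ?_) h
  obtain ⟨u, v, huv, hw⟩ := hex _ hp
  obtain ⟨a, ha⟩ := QuotientAddGroup.mk_surjective (ringAngle p)
  obtain ⟨q, hq1, hq2⟩ := exists_rat_btwn (sub_lt_sub_right huv a)
  refine Set.mem_iUnion.2 ⟨q, ?_⟩
  have := hw (a + q) ⟨by linarith, by linarith⟩
  rw [Set.mem_preimage]
  rw [← ringPoint_depth_ringAngle p, rot_trunc_ringPoint _ (hI hp), ← ha]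
  exact this

/-- The parallelogram contains an arc of every ring of depth between 1/8 and 3/16, so the measures
agree on these rings. The reflection of their union contains an arc, on the hypotenuse side, of
every ring of depth below 1/4, so a second step reaches all of those. -/
theorem TwistInvariant.restrict_ring_congr {ν ν' : Measure (ℝ × ℝ)} [IsFiniteMeasure ν]
    [IsFiniteMeasure ν'] (hν : TwistInvariant ν) (hν' : TwistInvariant ν')
    (e : ν.restrict patch = ν'.restrict patch) :
    ν.restrict (depth ⁻¹' Set.Ioo 0 (1 / 4)) = ν'.restrict (depth ⁻¹' Set.Ioo 0 (1 / 4)) := by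
  have e1 : ν.restrict (depth ⁻¹' Set.Ioo (1 / 8) (3 / 16)) =
      ν'.restrict (depth ⁻¹' Set.Ioo (1 / 8) (3 / 16)) := by
    refine hν.restrict_depth_congr hν' measurableSet_patch e
      (Set.Ioo_subset_Ioo (by norm_num) (by norm_num)) fun t ht => ?_
    obtain ⟨ht1, ht2⟩ := ht
    have hl : 0 < 1 - 3 * t := by linarith
    refine ⟨2 + 1 / 16 / (1 - 3 * t), 2 + 1 / 8 / (1 - 3 * t), by gcongr; norm_num, ?_⟩
    rintro w ⟨hw1, hw2⟩
    have h1 : 1 / 16 < (1 - 3 * t) * (w - 2) := by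
      rw [mul_comm, ← div_lt_iff₀ hl]; linarith
    have h2 : (1 - 3 * t) * (w - 2) < 1 / 8 := by
      rw [mul_comm, ← lt_div_iff₀ hl]; linarith
    have h3 : 0 ≤ w - 2 := by
      have : (0 : ℝ) < 1 / 16 / (1 - 3 * t) := by positivity
      linarith
    have h4 : w - 2 ≤ 1 := by
      have : 1 / 8 / (1 - 3 * t) ≤ 1 := (div_le_one hl).2 (by linarith)
      linarith
    have := ringPoint_bottom t ⟨h3, h4⟩
    rw [add_sub_cancel] at this
    rw [this]
    refine ⟨⟨?_, ?_⟩, ?_, ?_⟩ <;> simp only <;> linarith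
  have e2 := restrict_preimage_congr hν.flip_fst hν'.flip_fst hν.flip_fst.measurable flipFst_flipFst
    (continuous_depth.measurable measurableSet_Ioo) e1
  refine hν.restrict_depth_congr hν' (hν.flip_fst.measurable
    (continuous_depth.measurable measurableSet_Ioo)) e2 subset_rfl fun t ht => ?_
  obtain ⟨ht1, ht2⟩ := ht
  have hl : 0 < 1 - 3 * t := by linarith
  -- The reflected point at angle `w` has depth `1 - 3t - 2w(1 - 3t)`; the endpoints are where this
  -- equals 3/16 and 1/8.
  refine ⟨(1 - 3 * t - 3 / 16) / 2 / (1 - 3 * t), (1 - 3 * t - 1 / 8) / 2 / (1 - 3 * t),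
    by gcongr ?_ / _ / _; norm_num, ?_⟩
  rintro w ⟨hw1, hw2⟩
  rw [div_lt_iff₀ hl] at hw1
  rw [lt_div_iff₀ hl] at hw2
  have h3 : 0 ≤ w := by
    by_contra h
    nlinarith
  have h4 : w ≤ 1 := by
    by_contra h
    nlinarith
  rw [ringPoint_hypotenuse t ⟨h3, h4⟩]
  have hd : depth (flipFst (t + (1 - 3 * t) * (1 - w), t + (1 - 3 * t) * w)) =
      1 - 3 * t - 2 * (w * (1 - 3 * t)) := by
    have e : flipFst (t + (1 - 3 * t) * (1 - w), t + (1 - 3 * t) * w) =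
        (2 * t + w * (1 - 3 * t), t + w * (1 - 3 * t)) :=
      Prod.ext (by simp only [flipFst]; ring) (by simp only [flipFst]; ring)
    rw [e]
    unfold depth
    simp only
    rw [min_eq_right (a := t + w * (1 - 3 * t)) (by linarith), min_eq_right (by linarith)]
    ring
  rw [Set.mem_preimage, Set.mem_preimage, hd]
  exact ⟨by linarith, by linarith⟩

/-- Off the excluded lines a point of the square is interior to two of the four reflected triangles.
If its depth were at least 1/4 in both, it would be one of four points such as (1/2, 1/4), and these
lie on the excluded lines `x - y = ±1/4`. -/
theorem TwistInvariant.ae_depth {ν : Measure (ℝ × ℝ)} (hν : TwistInvariant ν) :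
    ∀ᵐ p ∂ν, (p ∈ depth ⁻¹' Set.Ioo 0 (1 / 4) ∨ p ∈ flipFst ⁻¹' (depth ⁻¹' Set.Ioo 0 (1 / 4))) ∨
      (p ∈ flipSnd ⁻¹' (depth ⁻¹' Set.Ioo 0 (1 / 4)) ∨
      p ∈ (flipSnd ∘ flipFst) ⁻¹' (depth ⁻¹' Set.Ioo 0 (1 / 4))) := by
  have ne : ∀ a b c : ℤ, (a ≠ 0 ∨ b ≠ 0) → ∀ᵐ p ∂ν, ¬ ((a : ℝ) * p.1 + b * p.2 = c) :=
    fun a b c h => measure_eq_zero_iff_ae_notMem.1 (hν.line a b c h)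
  filter_upwards [hν.ae_mem_square, ne 1 0 0 (by norm_num), ne 1 0 1 (by norm_num),
    ne 0 1 0 (by norm_num), ne 0 1 1 (by norm_num), ne 1 1 1 (by norm_num),
    ne 1 (-1) 0 (by norm_num), ne 4 (-4) 1 (by norm_num), ne 4 (-4) (-1) (by norm_num)]
  rintro ⟨x, y⟩ ⟨⟨hx0, hx1⟩, hy0, hy1⟩ n1 n2 n3 n4 n5 n6 n7 n8
  push_cast at n1 n2 n3 n4 n5 n6 n7 n8
  simp only at hx0 hx1 hy0 hy1 n1 n2 n3 n4 n5 n6 n7 n8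
  have hx0 : 0 < x := lt_of_le_of_ne hx0 fun h => n1 (by linarith)
  have hx1 : x < 1 := lt_of_le_of_ne hx1 fun h => n2 (by linarith)
  have hy0 : 0 < y := lt_of_le_of_ne hy0 fun h => n3 (by linarith)
  have hy1 : y < 1 := lt_of_le_of_ne hy1 fun h => n4 (by linarith)
  have mem : ∀ a b : ℝ, depth (a, b) ∈ Set.Ioo (0 : ℝ) (1 / 4) ↔
      (0 < a ∧ 0 < b ∧ 0 < 1 - a - b) ∧ (a < 1 / 4 ∨ b < 1 / 4 ∨ 1 - a - b < 1 / 4) := by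
    intro a b
    unfold depth
    rw [Set.mem_Ioo, lt_min_iff, lt_min_iff, min_lt_iff, min_lt_iff]
  simp only [Set.mem_preimage, flipFst, flipSnd, Function.comp_apply, mem]
  have hfst : y < x → 0 < 1 - x ∧ 0 < y ∧ 0 < 1 - (1 - x) - y := fun h =>
    ⟨by linarith, hy0, by linarith⟩
  have hsnd : x < y → 0 < x ∧ 0 < 1 - y ∧ 0 < 1 - x - (1 - y) := fun h =>
    ⟨hx0, by linarith, by linarith⟩
  have h7 : ¬ x - y = 1 / 4 := fun h => n7 (by linarith)
  have h8 : ¬ y - x = 1 / 4 := fun h => n8 (by linarith)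
  by_contra! hcon
  obtain ⟨⟨c1, c2⟩, c3, c4⟩ := hcon
  have hyx : ∀ {P : Prop}, (y < x → P) → (x < y → P) → P := fun h1 h2 => by
    rcases lt_trichotomy x y with h | h | h
    · exact h2 h
    · exact absurd (by linarith) n6
    · exact h1 h
  rcases lt_trichotomy (x + y) 1 with h | h | h
  · obtain ⟨d1, d2, d3⟩ := c1 ⟨hx0, hy0, by linarith⟩
    refine hyx (fun hl => ?_) fun hl => ?_
    · obtain ⟨-, -, d6⟩ := c2 (hfst hl)
      exact h7 (by linarith)
    · obtain ⟨-, -, d6⟩ := c3 (hsnd hl)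
      exact h8 (by linarith)
  · exact n5 (by linarith)
  · obtain ⟨d1, d2, d3⟩ := c4 ⟨by linarith, by linarith, by linarith⟩
    refine hyx (fun hl => ?_) fun hl => ?_
    · obtain ⟨-, -, d6⟩ := c2 (hfst hl)
      exact h7 (by linarith)
    · obtain ⟨-, -, d6⟩ := c3 (hsnd hl)
      exact h8 (by linarith)

theorem TwistInvariant.eq_of_restrict_patch_eq {ν ν' : Measure (ℝ × ℝ)} [IsFiniteMeasure ν]
    [IsFiniteMeasure ν'] (hν : TwistInvariant ν) (hν' : TwistInvariant ν')
    (e : ν.restrict patch = ν'.restrict patch) : ν = ν' := by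
  have hm : MeasurableSet (depth ⁻¹' Set.Ioo 0 (1 / 4)) :=
    continuous_depth.measurable measurableSet_Ioo
  have h0 := hν.restrict_ring_congr hν' e
  have h1 := restrict_preimage_congr hν.flip_fst hν'.flip_fst hν.flip_fst.measurable flipFst_flipFst
    hm h0
  have h2 := restrict_preimage_congr hν.flip_snd hν'.flip_snd hν.flip_snd.measurable flipSnd_flipSnd
    hm h0
  have h3 := restrict_preimage_congr (hν.flip_snd.comp hν.flip_fst) (hν'.flip_snd.comp hν'.flip_fst)
    (hν.flip_snd.comp hν.flip_fst).measurable (fun p => Prod.ext (sub_sub_cancel _ _)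
      (sub_sub_cancel _ _)) hm h0
  have h := Measure.restrict_union_congr.2
    ⟨Measure.restrict_union_congr.2 ⟨h0, h1⟩, Measure.restrict_union_congr.2 ⟨h2, h3⟩⟩
  have a := fun ρ (hρ : TwistInvariant ρ) => Measure.restrict_eq_self_of_ae_mem (μ := ρ)
    (s := (depth ⁻¹' Set.Ioo 0 (1 / 4) ∪ flipFst ⁻¹' (depth ⁻¹' Set.Ioo 0 (1 / 4))) ∪
      (flipSnd ⁻¹' (depth ⁻¹' Set.Ioo 0 (1 / 4)) ∪
        (flipSnd ∘ flipFst) ⁻¹' (depth ⁻¹' Set.Ioo 0 (1 / 4)))) hρ.ae_depth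
  rwa [a ν hν, a ν' hν'] at h

/-- Twist-invariant measures are proportional. -/
theorem TwistInvariant.exists_eq_smul {ν ν' : Measure (ℝ × ℝ)} [IsFiniteMeasure ν]
    [IsFiniteMeasure ν'] (hν : TwistInvariant ν) (hν' : TwistInvariant ν') (h : ν' patch ≠ 0) :
    ∃ κ : NNReal, ν = κ • ν' := by
  obtain ⟨M, hM⟩ := exists_restrict_patch_eq
  obtain ⟨κ, hκ⟩ := hM ν hν
  obtain ⟨κ', hκ'⟩ := hM ν' hν'
  have h0 : κ' ≠ 0 := by
    rintro rfl
    rw [zero_smul, Measure.restrict_eq_zero] at hκ'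
    exact h hκ'
  refine ⟨κ / κ', hν.eq_of_restrict_patch_eq (hν'.smul _) ?_⟩
  rw [Measure.restrict_smul, hκ, hκ', smul_smul, div_mul_cancel₀ _ h0]

end RingTwist

/-! ### Uniqueness of the invariant state -/

namespace FreeMV

open MVAlgebra RingTwist

variable {n : ℕ}

theorem IsMcNaughton.twist {a b c : (Fin n → unitInterval) → ℝ} (ha : IsMcNaughton a)
    (hb : IsMcNaughton b) (hc : IsMcNaughton c) :
    IsMcNaughton fun x => twist (a x) (b x) (c x) := by
  have ht := ha.inf (hb.inf hc)
  have hl := ((ha.add hb).add hc).sub (ht.int_mul 3)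
  have hτ := ht.inf hl
  refine (((((((hl.add hc).sub hτ).sub hb).add ht).sup ht).add (hb.inf hc)).sub ht |>.inf
    (((((ha.add hτ).sub hb).add ht).sup ht |>.add (ha.inf hb)).sub ht)).congr fun x => ?_
  simp only [RingTwist.twist, Int.cast_ofNat]

theorem IsMcNaughton.third {F G : (Fin n → unitInterval) → ℝ} (hF : IsMcNaughton F)
    (hG : IsMcNaughton G) : IsMcNaughton fun x => third (F x, G x) := by
  refine ((IsMcNaughton.int 0).sup (((IsMcNaughton.int 1).sub hF).sub hG)).congr fun x => ?_
  simp only [RingTwist.third, Int.cast_zero, Int.cast_one]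

/-- The projection of the cube to two coordinates. -/
def pairCoord (i j : Fin n) (x : Fin n → unitInterval) : ℝ × ℝ := (x i, x j)

theorem continuous_pairCoord (i j : Fin n) : Continuous (pairCoord i j) :=
  (continuous_subtype_val.comp (continuous_apply i)).prodMk
    (continuous_subtype_val.comp (continuous_apply j))

theorem pairCoord_mem_square (i j : Fin n) (x : Fin n → unitInterval) :
    pairCoord i j x ∈ square := ⟨(x i).2, (x j).2⟩

/-- Mutually inverse self-maps of the square that act on any two coordinates of a cube by
McNaughton functions. -/
structure IsMcNaughtonPair (n : ℕ) (T T' : ℝ × ℝ → ℝ × ℝ) : Prop where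
  mem : ∀ p ∈ square, T p ∈ square
  mem' : ∀ p ∈ square, T' p ∈ square
  inv : ∀ p ∈ square, T (T' p) = p
  inv' : ∀ p ∈ square, T' (T p) = p
  fst : ∀ i j : Fin n, IsMcNaughton fun x => (T (pairCoord i j x)).1
  snd : ∀ i j : Fin n, IsMcNaughton fun x => (T (pairCoord i j x)).2
  fst' : ∀ i j : Fin n, IsMcNaughton fun x => (T' (pairCoord i j x)).1
  snd' : ∀ i j : Fin n, IsMcNaughton fun x => (T' (pairCoord i j x)).2

theorem IsMcNaughtonPair.symm {T T' : ℝ × ℝ → ℝ × ℝ} (h : IsMcNaughtonPair n T T') :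
    IsMcNaughtonPair n T' T :=
  ⟨h.mem', h.mem, h.inv', h.inv, h.fst', h.snd', h.fst, h.snd⟩

theorem rot_mem_square {p : ℝ × ℝ} (hp : p ∈ square) (g : ℝ → AddCircle (3 : ℝ)) :
    rot g p ∈ square := by
  unfold rot
  split_ifs with h
  · generalize ringAngle p + g (depth p) = θ
    have hs := ringCoord_sum (depth p) θ
    have h1 := ringCoord_nonneg h (depth_le p) θ
    have h2 := ringCoord_nonneg h (depth_le p) (θ - (1 : ℝ))
    have h3 := ringCoord_nonneg h (depth_le p) (θ - (2 : ℝ))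
    exact ⟨⟨h1, by unfold ringPoint; linarith⟩, h2, by unfold ringPoint; linarith⟩
  · exact hp

theorem isMcNaughtonPair_twist : IsMcNaughtonPair n twistMap untwistMap where
  mem p hp := by rw [twistMap_eq_rot hp]; exact rot_mem_square hp _
  mem' p hp := by rw [untwistMap_eq_rot hp]; exact rot_mem_square hp _
  inv p hp := by
    rw [untwistMap_eq_rot hp, twistMap_eq_rot (rot_mem_square hp _), rot_rot]
    exact rot_of_eq_zero (neg_add_cancel _)
  inv' p hp := by
    rw [twistMap_eq_rot hp, untwistMap_eq_rot (rot_mem_square hp _), rot_rot]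
    exact rot_of_eq_zero (add_neg_cancel _)
  fst i j := (IsMcNaughton.coord i).twist (.coord j) ((IsMcNaughton.coord i).third (.coord j))
  snd i j := (IsMcNaughton.coord j).twist ((IsMcNaughton.coord i).third (.coord j)) (.coord i)
  fst' i j := (IsMcNaughton.coord i).twist ((IsMcNaughton.coord i).third (.coord j)) (.coord j)
  snd' i j := (IsMcNaughton.coord j).twist (.coord i) ((IsMcNaughton.coord i).third (.coord j))

theorem isMcNaughton_one_sub_coord (i : Fin n) :
    IsMcNaughton fun x : Fin n → unitInterval => 1 - (x i : ℝ) :=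
  ((IsMcNaughton.int 1).sub (.coord i)).congr fun x => by rw [Int.cast_one]

theorem isMcNaughtonPair_flipFst : IsMcNaughtonPair n flipFst flipFst := by
  have h : ∀ p ∈ square, flipFst p ∈ square := fun p hp =>
    ⟨⟨sub_nonneg.2 hp.1.2, sub_le_self _ hp.1.1⟩, hp.2⟩
  exact ⟨h, h, fun p _ => flipFst_flipFst p, fun p _ => flipFst_flipFst p,
    fun i _ => isMcNaughton_one_sub_coord i, fun _ j => .coord j,
    fun i _ => isMcNaughton_one_sub_coord i, fun _ j => .coord j⟩

theorem isMcNaughtonPair_flipSnd : IsMcNaughtonPair n flipSnd flipSnd := by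
  have h : ∀ p ∈ square, flipSnd p ∈ square := fun p hp =>
    ⟨hp.1, sub_nonneg.2 hp.2.2, sub_le_self _ hp.2.1⟩
  exact ⟨h, h, fun p _ => flipSnd_flipSnd p, fun p _ => flipSnd_flipSnd p,
    fun i _ => .coord i, fun _ j => isMcNaughton_one_sub_coord j,
    fun i _ => .coord i, fun _ j => isMcNaughton_one_sub_coord j⟩

/-- The self-map of the cube that acts on two coordinates. -/
def actPair (i j : Fin n) {T : ℝ × ℝ → ℝ × ℝ} (hT : ∀ p ∈ square, T p ∈ square)
    (x : Fin n → unitInterval) : Fin n → unitInterval := fun k =>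
  if k = i then ⟨(T (pairCoord i j x)).1, (hT _ (pairCoord_mem_square i j x)).1⟩
  else if k = j then ⟨(T (pairCoord i j x)).2, (hT _ (pairCoord_mem_square i j x)).2⟩
  else x k

theorem pairCoord_actPair {i j : Fin n} (hij : i ≠ j) {T : ℝ × ℝ → ℝ × ℝ}
    (hT : ∀ p ∈ square, T p ∈ square) (x : Fin n → unitInterval) :
    pairCoord i j (actPair i j hT x) = T (pairCoord i j x) := by
  unfold pairCoord actPair
  rw [if_pos rfl, if_neg hij.symm, if_pos rfl]
  rfl

theorem actPair_actPair {i j : Fin n} (hij : i ≠ j) {T T' : ℝ × ℝ → ℝ × ℝ}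
    (hT : ∀ p ∈ square, T p ∈ square) (hT' : ∀ p ∈ square, T' p ∈ square)
    (h : ∀ p ∈ square, T (T' p) = p) (x : Fin n → unitInterval) :
    actPair i j hT (actPair i j hT' x) = x := by
  have e : T (pairCoord i j (actPair i j hT' x)) = pairCoord i j x := by
    rw [pairCoord_actPair hij, h _ (pairCoord_mem_square i j x)]
  funext k
  apply Subtype.ext
  by_cases hki : k = i
  · subst hki
    conv_lhs => unfold actPair
    rw [if_pos rfl]
    exact congrArg Prod.fst e
  · by_cases hkj : k = j
    · subst hkj
      conv_lhs => unfold actPair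
      rw [if_neg hki, if_pos rfl]
      exact congrArg Prod.snd e
    · unfold actPair
      simp only [if_neg hki, if_neg hkj]

theorem isMcNaughton_actPair (i j : Fin n) {T : ℝ × ℝ → ℝ × ℝ}
    (hT : ∀ p ∈ square, T p ∈ square)
    (h1 : IsMcNaughton fun x => (T (pairCoord i j x)).1)
    (h2 : IsMcNaughton fun x => (T (pairCoord i j x)).2) (k : Fin n) :
    IsMcNaughton fun x => (actPair i j hT x k : ℝ) := by
  unfold actPair
  by_cases hki : k = i
  · simpa only [if_pos hki] using h1
  · by_cases hkj : k = j
    · simpa only [if_neg hki, if_pos hkj] using h2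
    · simpa only [if_neg hki, if_neg hkj] using IsMcNaughton.coord k

theorem IsMcNaughtonPair.exists_aut {T T' : ℝ × ℝ → ℝ × ℝ} (h : IsMcNaughtonPair n T T')
    {i j : Fin n} (hij : i ≠ j) : ∃ σ : Aut (FreeMV (Fin n)),
      pointMap σ.toHom = actPair i j h.mem :=
  FreeMV.exists_aut (isMcNaughton_actPair i j h.mem (h.fst i j) (h.snd i j))
    (isMcNaughton_actPair i j h.mem' (h.fst' i j) (h.snd' i j))
    (actPair_actPair hij h.mem h.mem' h.inv) (actPair_actPair hij h.mem' h.mem h.inv')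

section Uniqueness

variable {m : FreeMV (Fin n) → ℝ} {μ : Measure (Fin n → unitInterval)} [IsProbabilityMeasure μ]

/-- The set `C` depends only on the other coordinates, so an automorphism acting on the pair
preserves it and may be restricted to it. -/
theorem measurePreserving_pair (hm : IsAutInvariant m) (hμ : ∀ f, m f = ∫ x, val f x ∂μ)
    {i j : Fin n} (hij : i ≠ j) {C : Set (Fin n → unitInterval)} (hC : MeasurableSet C)
    (hCij : ∀ x y : Fin n → unitInterval, (∀ k, k ≠ i → k ≠ j → x k = y k) → (x ∈ C ↔ y ∈ C))
    {T T' : ℝ × ℝ → ℝ × ℝ} (hT : IsMcNaughtonPair n T T') (hTm : Measurable T) :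
    MeasurePreserving T ((μ.restrict C).map (pairCoord i j)) ((μ.restrict C).map (pairCoord i j)) := by
  obtain ⟨σ, hσ⟩ := hT.exists_aut hij
  have h1 := measurePreserving_pointMap hm μ hμ σ
  rw [hσ] at h1
  have h2 : actPair i j hT.mem ⁻¹' C = C := by
    ext x
    refine hCij _ _ fun k hki hkj => ?_
    unfold actPair
    rw [if_neg hki, if_neg hkj]
  have h3 := h1.restrict_preimage hC
  rw [h2] at h3
  have hp := (continuous_pairCoord i j).measurable
  refine ⟨hTm, ?_⟩
  rw [Measure.map_map hTm hp]
  have e : T ∘ pairCoord i j = pairCoord i j ∘ actPair i j hT.mem :=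
    funext fun x => (pairCoord_actPair hij hT.mem x).symm
  rw [e, ← Measure.map_map hp h3.measurable, h3.map_eq]

/-- A point is moved off the hyperplane by changing a coordinate with nonzero coefficient
arbitrarily little. -/
theorem dense_affine_ne {i j : Fin n} (hij : i ≠ j) {a b : ℝ} (hab : a ≠ 0 ∨ b ≠ 0) (c : ℝ) :
    Dense {x : Fin n → unitInterval | a * x i + b * x j - c ≠ 0} := by
  have key : ∀ (k : Fin n) (r : ℝ), r ≠ 0 → (∀ (x : Fin n → unitInterval) (t : unitInterval),
      a * (Function.update x k t i) + b * (Function.update x k t j) =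
        a * x i + b * x j + r * ((t : ℝ) - x k)) →
      Dense {x : Fin n → unitInterval | a * x i + b * x j - c ≠ 0} := by
    intro k r hr hk x
    by_cases hx : a * x i + b * x j - c = 0
    · have h1 : x k ∈ closure ({x k}ᶜ : Set unitInterval) := dense_compl_singleton (x k) (x k)
      have h2 := map_mem_closure (f := fun t => Function.update x k t)
        (continuous_const.update k continuous_id) h1
        (t := {x : Fin n → unitInterval | a * x i + b * x j - c ≠ 0}) (fun t ht h0 => ?_)
      · rwa [Function.update_eq_self] at h2
      · rw [hk] at h0
        have h3 : r * ((t : ℝ) - x k) = 0 := by linarith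
        exact ht (Subtype.ext (sub_eq_zero.1 ((mul_eq_zero.1 h3).resolve_left hr)))
    · exact subset_closure hx
  rcases hab with h | h
  · refine key i a h fun x t => ?_
    rw [Function.update_self, Function.update_of_ne hij.symm]
    ring
  · refine key j b h fun x t => ?_
    rw [Function.update_self, Function.update_of_ne hij]
    ring

theorem continuous_third : Continuous third := by
  unfold RingTwist.third
  fun_prop

theorem continuous_twist {X : Type*} [TopologicalSpace X] {a b c : X → ℝ} (ha : Continuous a)
    (hb : Continuous b) (hc : Continuous c) : Continuous fun x => twist (a x) (b x) (c x) := by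
  unfold RingTwist.twist
  fun_prop

theorem twistInvariant_map_pairCoord (hm : IsAutInvariant m) (hw : TendsToOneOnWeakUnits m)
    (hμ : ∀ f, m f = ∫ x, val f x ∂μ) {i j : Fin n} (hij : i ≠ j)
    {C : Set (Fin n → unitInterval)} (hC : MeasurableSet C)
    (hCij : ∀ x y : Fin n → unitInterval, (∀ k, k ≠ i → k ≠ j → x k = y k) → (x ∈ C ↔ y ∈ C)) :
    TwistInvariant ((μ.restrict C).map (pairCoord i j)) where
  compl_square := by
    have hs : MeasurableSet square := measurableSet_Icc.prod measurableSet_Icc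
    rw [Measure.map_apply (continuous_pairCoord i j).measurable hs.compl]
    convert measure_empty (μ := μ.restrict C)
    exact Set.eq_empty_of_forall_notMem fun x hx => hx (pairCoord_mem_square i j x)
  twist := measurePreserving_pair hm hμ hij hC hCij isMcNaughtonPair_twist
    ((continuous_twist continuous_fst continuous_snd continuous_third).prodMk
      (continuous_twist continuous_snd continuous_third continuous_fst)).measurable
  untwist := measurePreserving_pair hm hμ hij hC hCij isMcNaughtonPair_twist.symm
    ((continuous_twist continuous_fst continuous_third continuous_snd).prodMk
      (continuous_twist continuous_snd continuous_fst continuous_third)).measurable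
  flip_fst := measurePreserving_pair hm hμ hij hC hCij isMcNaughtonPair_flipFst
    ((measurable_const.sub measurable_fst).prodMk measurable_snd)
  flip_snd := measurePreserving_pair hm hμ hij hC hCij isMcNaughtonPair_flipSnd
    (measurable_fst.prodMk (measurable_const.sub measurable_snd))
  line a b c hab := by
    have h1 : IsMcNaughton fun x : Fin n → unitInterval => (a : ℝ) * x i + b * x j - c :=
      (((IsMcNaughton.coord i).int_mul a).add ((IsMcNaughton.coord j).int_mul b)).sub (.int c)
    have h2 := measure_eq_zero_of_isMcNaughton hw μ hμ h1
      (dense_affine_ne hij (hab.imp Int.cast_ne_zero.2 Int.cast_ne_zero.2) c)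
    have hs : MeasurableSet {p : ℝ × ℝ | a * p.1 + b * p.2 = c} :=
      measurableSet_eq_fun (by fun_prop) measurable_const
    rw [Measure.map_apply (continuous_pairCoord i j).measurable hs]
    refine measure_mono_null (fun x hx => ?_) (Measure.absolutelyContinuous_of_le
      Measure.restrict_le_self h2)
    exact sub_eq_zero.2 hx

theorem volume_pair {i j : Fin n} (hij : i ≠ j) (A B : Set unitInterval) :
    volume {x : Fin n → unitInterval | x i ∈ A ∧ x j ∈ B} = volume A * volume B := by
  classical
  have e : {x : Fin n → unitInterval | x i ∈ A ∧ x j ∈ B} =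
      Set.pi Set.univ fun k => if k = i then A else if k = j then B else Set.univ := by
    ext x
    rw [Set.mem_univ_pi]
    constructor
    · rintro ⟨h1, h2⟩ k
      split_ifs with hki hkj
      · exact hki ▸ h1
      · exact hkj ▸ h2
      · trivial
    · intro h
      have h1 := h i
      have h2 := h j
      rw [if_pos rfl] at h1
      rw [if_neg hij.symm, if_pos rfl] at h2
      exact ⟨h1, h2⟩
  rw [e, volume_pi_pi, Fintype.prod_eq_mul i j hij fun k hk => ?_]
  · rw [if_pos rfl, if_neg hij.symm, if_pos rfl]
  · rw [if_neg hk.1, if_neg hk.2, measure_univ]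

theorem volume_map_pairCoord_patch {i j : Fin n} (hij : i ≠ j) :
    (volume : Measure (Fin n → unitInterval)).map (pairCoord i j) patch ≠ 0 := by
  have hpos : ∀ a b : ℝ, 0 ≤ a → a < b → b ≤ 1 →
      volume ((↑) ⁻¹' Set.Ioo a b : Set unitInterval) ≠ 0 := by
    intro a b ha hab hb
    have hsub : Set.Ioo a b ∩ unitInterval = Set.Ioo a b :=
      Set.inter_eq_left.2 fun x hx => ⟨ha.trans hx.1.le, hx.2.le.trans hb⟩
    have := (measurePreserving_subtype_coe (μa := (volume : Measure ℝ)) (s := unitInterval)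
      measurableSet_Icc).measure_preimage (measurableSet_Ioo (a := a) (b := b)).nullMeasurableSet
    rw [Measure.restrict_apply measurableSet_Ioo, hsub, Real.volume_Ioo] at this
    refine ne_of_eq_of_ne this ?_
    rw [Ne, ENNReal.ofReal_eq_zero, not_le]
    linarith
  rw [Measure.map_apply (continuous_pairCoord i j).measurable measurableSet_patch]
  -- The rectangle (15/64, 16/64) × (9/64, 10/64) lies in the parallelogram: there the difference of
  -- the coordinates is between 5/64 and 7/64.
  refine fun h0 => mul_ne_zero (hpos (15 / 64) (16 / 64) (by norm_num) (by norm_num) (by norm_num))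
    (hpos (9 / 64) (10 / 64) (by norm_num) (by norm_num) (by norm_num)) ?_
  rw [← volume_pair hij]
  refine measure_mono_null ?_ h0
  rintro x ⟨⟨h1, h2⟩, h3, h4⟩
  refine ⟨⟨?_, ?_⟩, ?_, ?_⟩ <;> simp only [pairCoord] <;> linarith

/-- Under an invariant measure, each coordinate is uniformly distributed and independent of the
other coordinates. -/
theorem measure_pi_eq (hn : 2 ≤ n) (hm : IsAutInvariant m) (hw : TendsToOneOnWeakUnits m)
    (hμ : ∀ f, m f = ∫ x, val f x ∂μ) {B : Fin n → Set unitInterval}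
    (hB : ∀ k, MeasurableSet (B k)) (i : Fin n) :
    μ (Set.pi Set.univ B) =
      volume (B i) * μ (Set.pi Set.univ (Function.update B i Set.univ)) := by
  have : Nontrivial (Fin n) := Fin.nontrivial_iff_two_le.2 hn
  obtain ⟨j, hji⟩ := exists_ne i
  have hij := hji.symm
  -- The conditions of the box on all coordinates other than the pair; a second coordinate `j`
  -- exists because `n ≥ 2`.
  let C : Set (Fin n → unitInterval) := ⋂ k, {x | k ≠ i → k ≠ j → x k ∈ B k}
  have hC : MeasurableSet C := by
    refine MeasurableSet.iInter fun k => ?_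
    by_cases hk : k ≠ i ∧ k ≠ j
    · have e : {x : Fin n → unitInterval | k ≠ i → k ≠ j → x k ∈ B k} =
          (fun x : Fin n → unitInterval => x k) ⁻¹' B k :=
        Set.ext fun x => ⟨fun h => h hk.1 hk.2, fun h _ _ => h⟩
      rw [e]
      exact measurable_pi_apply k (hB k)
    · convert MeasurableSet.univ (α := Fin n → unitInterval)
      ext x
      exact ⟨fun _ => trivial, fun _ h1 h2 => absurd ⟨h1, h2⟩ hk⟩
  have hCmem : ∀ x, x ∈ C ↔ ∀ k, k ≠ i → k ≠ j → x k ∈ B k := fun x => Set.mem_iInter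
  have hCij : ∀ x y : Fin n → unitInterval, (∀ k, k ≠ i → k ≠ j → x k = y k) →
      (x ∈ C ↔ y ∈ C) := by
    intro x y h
    rw [hCmem, hCmem]
    refine forall_congr' fun k => forall_congr' fun h1 => forall_congr' fun h2 => ?_
    rw [h k h1 h2]
  have hν := twistInvariant_map_pairCoord hm hw hμ hij hC hCij
  -- Lebesgue measure is itself such a measure, since the average satisfies both conditions; it
  -- serves as the standard of comparison.
  have hν' := twistInvariant_map_pairCoord (n := n) isAutInvariant_average
    tendsToOneOnWeakUnits_average (μ := volume) average_eq hij MeasurableSet.univ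
    fun _ _ _ => Iff.rfl
  rw [Measure.restrict_univ] at hν'
  obtain ⟨κ, hκ⟩ := hν.exists_eq_smul hν' (volume_map_pairCoord_patch hij)
  have hp := (continuous_pairCoord i j).measurable
  have rect : ∀ A A' : Set unitInterval, MeasurableSet A → MeasurableSet A' →
      μ ({x | x i ∈ A ∧ x j ∈ A'} ∩ C) = κ • (volume A * volume A') := by
    intro A A' hA hA'
    have hs : MeasurableSet (((↑) '' A : Set ℝ) ×ˢ ((↑) '' A' : Set ℝ)) :=
      ((MeasurableEmbedding.subtype_coe measurableSet_Icc).measurableSet_image.2 hA).prod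
        ((MeasurableEmbedding.subtype_coe measurableSet_Icc).measurableSet_image.2 hA')
    have hpre : pairCoord i j ⁻¹' (((↑) '' A : Set ℝ) ×ˢ ((↑) '' A' : Set ℝ)) =
        {x | x i ∈ A ∧ x j ∈ A'} := by
      ext x
      exact and_congr Subtype.val_injective.mem_set_image Subtype.val_injective.mem_set_image
    have := congrArg (fun ρ : Measure (ℝ × ℝ) => ρ (((↑) '' A : Set ℝ) ×ˢ ((↑) '' A' : Set ℝ))) hκ
    simp only [Measure.smul_apply] at this
    rw [Measure.map_apply hp hs, Measure.map_apply hp hs, Measure.restrict_apply (hp hs), hpre,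
      volume_pair hij] at this
    exact this
  have split : ∀ D : Fin n → Set unitInterval, (∀ k, k ≠ i → D k = B k) →
      Set.pi Set.univ D = {x | x i ∈ D i ∧ x j ∈ B j} ∩ C := by
    intro D hD
    ext x
    rw [Set.mem_univ_pi, Set.mem_inter_iff, hCmem]
    constructor
    · intro h
      exact ⟨⟨h i, hD j hji ▸ h j⟩, fun k h1 _ => hD k h1 ▸ h k⟩
    · rintro ⟨⟨h1, h2⟩, h3⟩ k
      by_cases hki : k = i
      · exact hki ▸ h1
      · rw [hD k hki]
        by_cases hkj : k = j
        · exact hkj ▸ h2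
        · exact h3 k hki hkj
  -- The factor `κ` depends only on `C`, so it is the same for the box and for the box with its side
  -- `i` widened to the whole interval.
  rw [split B fun _ _ => rfl, split (Function.update B i Set.univ) fun k hk =>
    Function.update_of_ne hk _ _, Function.update_self, rect _ _ (hB i) (hB j),
    rect _ _ MeasurableSet.univ (hB j), measure_univ, one_mul, mul_smul_comm]

/-- Widening the sides of a box one at a time splits off their lengths, until the whole cube is
left. -/
theorem measure_eq_volume (hn : 2 ≤ n) (hm : IsAutInvariant m) (hw : TendsToOneOnWeakUnits m)
    (hμ : ∀ f, m f = ∫ x, val f x ∂μ) : μ = volume := by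
  classical
  refine (Measure.pi_eq fun B hB => ?_).symm
  have key : ∀ s : Finset (Fin n), μ (Set.pi Set.univ (s.piecewise B fun _ => Set.univ)) =
      ∏ k ∈ s, volume (B k) := by
    intro s
    induction s using Finset.induction_on with
    | empty => simp
    | insert i s hi ih =>
      have hmeas : ∀ k, MeasurableSet ((insert i s).piecewise B (fun _ => Set.univ) k) := by
        intro k
        unfold Finset.piecewise
        split_ifs
        · exact hB k
        · exact MeasurableSet.univ
      rw [measure_pi_eq hn hm hw hμ hmeas i, Finset.prod_insert hi, ← ih,
        Finset.piecewise_insert, Function.update_self, Function.update_idem]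
      congr 3
      rw [Function.update_eq_self_iff, Finset.piecewise_eq_of_notMem _ _ _ hi]
  have := key Finset.univ
  rwa [Finset.piecewise_univ] at this

end Uniqueness

end FreeMV

theorem theorem2 (n : ℕ) (hn : 2 ≤ n) :
    (MVAlgebra.IsState (FreeMV.average n) ∧
      MVAlgebra.IsAutInvariant (FreeMV.average n) ∧
      MVAlgebra.TendsToOneOnWeakUnits (FreeMV.average n)) ∧
    ∀ m : FreeMV (Fin n) → ℝ,
      MVAlgebra.IsState m → MVAlgebra.IsAutInvariant m → MVAlgebra.TendsToOneOnWeakUnits m →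
        m = FreeMV.average n := by
  refine ⟨⟨FreeMV.isState_average, FreeMV.isAutInvariant_average,
    FreeMV.tendsToOneOnWeakUnits_average⟩, fun m hs hm hw => ?_⟩
  obtain ⟨μ, _, hμ⟩ := FreeMV.exists_measure_of_isState hs
  funext f
  rw [hμ, FreeMV.average_eq, FreeMV.measure_eq_volume hn hm hw hμ]
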